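/- Let $T\in\{0,1\}$ be a treatment, $Y_0,Y_1$ real potential outcomes, ${\bf X}=({\bf U},{\bf Z})$ covariates, and let ${\bf W}=(T,Y,{\bf X})$ with $Y=TY_1+(1-T)Y_0$ be the observed data. Suppose that $\mathrm{pr}(T=1\mid Y_0,{\bf X})=\pi(Y_0,{\bf U};\theta)$ with $\pi$ a known function and $\theta\in\mathbb{R}^d$, that $g$ is the density of ${\bf X}$, that $f_t(y_t\mid{\bf x},t)$ is the conditional density of $Y_t$ given ${\bf X}={\bf x},T=t$ ($t=0,1$), and that $({\bf X},Y_0)$ has a density (all with respect to products of fixed $\sigma$-finite measures on the covariate space and on $\mathbb{R}$, the latter measure depending on $t$). Suppose also that, for almost all $(y_0,{\bf x})$ with respect to these measures, $0<\pi(y_0,{\bf u};\theta)\le 1-\varepsilon$ for some constant $\varepsilon>0$. The likelihood of one observation is $$p(t,y,{\bf x})=\{D({\bf x})-1\}^{t}D({\bf x})^{-1}f_1(y\mid{\bf x},1)^{t}f_0(y\mid{\bf x},0)^{1-t}g({\bf x}),\qquad D({\bf x})=\int\frac{f_0(y_0\mid{\bf x},0)}{1-\pi(y_0,{\bf u};\theta)}\,dy_0,$$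 with nonparametric nuisance parts $f_0,f_1,g$. Write $w({\bf x})=\mathrm{pr}(T=1\mid{\bf x})$, $\mathrm{E}_t(\cdot\mid{\bf x},t)$ for the conditional expectation given ${\bf X}={\bf x},T=t$, and $\mathrm{E}_0(\cdot\mid{\bf x})$ for the conditional expectation of functions of $(Y_0,{\bf X})$ given ${\bf X}={\bf x}$. Let $\mathcal H$ be the Hilbert space of $d$-dimensional measurable functions of ${\bf W}$ with mean zero and finite variance, with inner product $\langle h_1,h_2\rangle=\mathrm{E}(h_1^{\rm T}h_2)$. The tangent space of a regular parametric submodel with (quadratic mean) score vector $S\in\mathbb{R}^r$ at the truth is $\{BS: B\in\mathbb{R}^{d\times r}\}$, and a nuisance tangent space is the mean squared closure in $\mathcal H$ of the union of the tangent spaces of all regular parametric submodels for the nuisance parts in question, with $\theta$ and the other nuisance parts fixed. Then the nuisance tangent spaces with respect to $f_0$, $f_1$ and $g$ are the following subspaces of $\mathcal H$, respectively: $$\Lambda_0=\Big\{(1-t)\,{\bf c}(y_0,{\bf x})+\frac{t-w({\bf x})}{w({\bf x})}\mathrm{E}_0\{{\bf c}(y_0,{\bf x})\mid{\bf x}\}:\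 \mathrm{E}_0\{{\bf c}(y_0,{\bf x})\mid{\bf x},0\}={\bf 0}\Big\},$$ $$\Lambda_1=\big\{t\,{\bf b}(y_1,{\bf x}):\ \mathrm{E}_1\{{\bf b}(y_1,{\bf x})\mid{\bf x},1\}={\bf 0}\big\},\qquad \Lambda_2=\big\{{\bf a}({\bf x}):\ \mathrm{E}\{{\bf a}({\bf x})\}={\bf 0}\big\},$$ where ${\bf a},{\bf b},{\bf c}$ take values in $\mathbb{R}^d$ and ${\bf c}(Y_0,{\bf X})$, ${\bf b}(Y_1,{\bf X})$ have finite second moments given $T=0$ and given $T=1$, respectively. The nuisance tangent space $\Lambda$ with respect to $(f_0,f_1,g)$ jointly is $\Lambda_0\oplus\Lambda_1\oplus\Lambda_2$, its orthogonal complement in $\mathcal H$ is $$\Lambda^\perp=\Big\{\frac{t-\pi(y_0,{\bf u};\theta)}{1-\pi(y_0,{\bf u};\theta)}\,{\bf g}({\bf x})\in\mathcal H:\ {\bf g}({\bf x})\in\mathbb{R}^d\Big\},$$ and $\mathcal H=\Lambda_0\oplus\Lambda_1\oplus\Lambda_2\oplus\Lambda^\perp$, a direct sum of pairwise orthogonal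 subspaces. -/

import Mathlib

open MeasureTheory ProbabilityTheory Filter Topology
open scoped ENNReal

noncomputable section

namespace ATT

/-- The treatment indicator as a real number. -/
def ind (t : Bool) : ℝ := if t then 1 else 0

/-- The type of one observation `w = (t, y, x)` with `x = (u, z)`. -/
abbrev Obs (𝒰 𝒵 : Type*) : Type _ := Bool × ℝ × (𝒰 × 𝒵)

/-- The known ingredients of the semiparametric model: the form `π(y₀, u; θ)` of the treatment
assignment probability, and the measures "dy₀", "dy₁", "dx" with respect to which the densities
of the potential outcomes and of the covariates are taken. -/
structure Model (d : ℕ) (𝒰 𝒵 : Type*) [MeasurableSpace 𝒰] [MeasurableSpace 𝒵] where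
  π : EuclideanSpace ℝ (Fin d) → ℝ → 𝒰 → ℝ
  μ₀ : Measure ℝ
  μ₁ : Measure ℝ
  ν : Measure (𝒰 × 𝒵)
  measurable_π : ∀ θ, Measurable (fun p : ℝ × 𝒰 => π θ p.1 p.2)
  sigmaFinite_μ₀ : SigmaFinite μ₀
  sigmaFinite_μ₁ : SigmaFinite μ₁
  sigmaFinite_ν : SigmaFinite ν

attribute [instance] Model.sigmaFinite_μ₀ Model.sigmaFinite_μ₁ Model.sigmaFinite_ν

/-- The three nuisance parts: `f₀ x y = f₀(y ∣ x, 0)`, `f₁ x y = f₁(y ∣ x, 1)`, and `g x`. -/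
structure Nuisance (𝒰 𝒵 : Type*) where
  f₀ : 𝒰 × 𝒵 → ℝ → ℝ
  f₁ : 𝒰 × 𝒵 → ℝ → ℝ
  g : 𝒰 × 𝒵 → ℝ

/-- The potential outcomes, the treatment and the covariates `X = (U, Z)` as random variables. -/
structure PotentialOutcomes (Ω 𝒰 𝒵 : Type*)
    [MeasurableSpace Ω] [MeasurableSpace 𝒰] [MeasurableSpace 𝒵] where
  T : Ω → Bool
  Y₀ : Ω → ℝ
  Y₁ : Ω → ℝ
  X : Ω → 𝒰 × 𝒵
  measurable_T : Measurable T
  measurable_Y₀ : Measurable Y₀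
  measurable_Y₁ : Measurable Y₁
  measurable_X : Measurable X

variable {d : ℕ} {Ω 𝒰 𝒵 : Type*} [MeasurableSpace Ω] [MeasurableSpace 𝒰] [MeasurableSpace 𝒵]

namespace PotentialOutcomes

/-- The observed data `W = (T, Y, X)`, where `Y = T Y₁ + (1 - T) Y₀`. -/
def W (D : PotentialOutcomes Ω 𝒰 𝒵) (ω : Ω) : Obs 𝒰 𝒵 :=
  (D.T ω, ind (D.T ω) * D.Y₁ ω + (1 - ind (D.T ω)) * D.Y₀ ω, D.X ω)

/-- The σ-algebra generated by the covariates. -/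
abbrev sigmaX (D : PotentialOutcomes Ω 𝒰 𝒵) : MeasurableSpace Ω :=
  MeasurableSpace.comap D.X inferInstance

/-- The σ-algebra generated by `Y₀` and the covariates. -/
abbrev sigmaY₀X (D : PotentialOutcomes Ω 𝒰 𝒵) : MeasurableSpace Ω :=
  MeasurableSpace.comap (fun ω => (D.Y₀ ω, D.X ω)) inferInstance

/-- The conditional law of all random variables given `T = t`. -/
def given (D : PotentialOutcomes Ω 𝒰 𝒵) (P : Measure Ω) (t : Bool) : Measure Ω :=
  P[|D.T ⁻¹' {t}]

/-- `w(X) = pr(T = 1 ∣ X)`. -/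
def w (D : PotentialOutcomes Ω 𝒰 𝒵) (P : Measure Ω) : Ω → ℝ :=
  P[fun ω => ind (D.T ω) | D.sigmaX]

end PotentialOutcomes

/-- `f` is a conditional density, given `x`, with respect to `μ`. -/
structure IsCondDensity (ν : Measure (𝒰 × 𝒵)) (μ : Measure ℝ) (f : 𝒰 × 𝒵 → ℝ → ℝ) : Prop where
  measurable : Measurable (fun p : (𝒰 × 𝒵) × ℝ => f p.1 p.2)
  nonneg : ∀ x y, 0 ≤ f x y
  lintegral_eq_one : ∀ᵐ x ∂ν, ∫⁻ y, ENNReal.ofReal (f x y) ∂μ = 1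

/-- The three nuisance parts are densities; they are otherwise unrestricted. -/
structure Nuisance.IsDensity (M : Model d 𝒰 𝒵) (η : Nuisance 𝒰 𝒵) : Prop where
  f₀ : IsCondDensity M.ν M.μ₀ η.f₀
  f₁ : IsCondDensity M.ν M.μ₁ η.f₁
  g_measurable : Measurable η.g
  g_nonneg : ∀ x, 0 ≤ η.g x
  g_lintegral : ∫⁻ x, ENNReal.ofReal (η.g x) ∂M.ν = 1

/-- The random variables follow the model with parameter `θ` and nuisance parts `η`:
`pr(T = 1 ∣ Y₀, X) = π(Y₀, U; θ)`, `g` is the density of `X`, `f₀` and `f₁` are the conditional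
densities of `Y₀` given `X, T = 0` and of `Y₁` given `X, T = 1`, and `(X, Y₀)` has a density. -/
structure FollowsModel (M : Model d 𝒰 𝒵) (D : PotentialOutcomes Ω 𝒰 𝒵) (P : Measure Ω)
    (θ : EuclideanSpace ℝ (Fin d)) (η : Nuisance 𝒰 𝒵) : Prop where
  isDensity : η.IsDensity M
  propensity : P[fun ω => ind (D.T ω) | D.sigmaY₀X] =ᵐ[P] fun ω => M.π θ (D.Y₀ ω) (D.X ω).1
  law_X : P.map D.X = M.ν.withDensity (fun x => ENNReal.ofReal (η.g x))
  law_Y₀ : (D.given P false).map (fun ω => (D.X ω, D.Y₀ ω)) =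
    (((D.given P false).map D.X).prod M.μ₀).withDensity (fun p => ENNReal.ofReal (η.f₀ p.1 p.2))
  law_Y₁ : (D.given P true).map (fun ω => (D.X ω, D.Y₁ ω)) =
    (((D.given P true).map D.X).prod M.μ₁).withDensity (fun p => ENNReal.ofReal (η.f₁ p.1 p.2))
  ac_Y₀ : P.map (fun ω => (D.X ω, D.Y₀ ω)) ≪ M.ν.prod M.μ₀

/-- Positivity of the treatment assignment, on the range of `(Y₀, X)` that the model allows:
`π(y₀, u; θ)` is positive and bounded away from `1`. -/
def Overlap (M : Model d 𝒰 𝒵) (θ : EuclideanSpace ℝ (Fin d)) : Prop :=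
  ∃ ε : ℝ, 0 < ε ∧ ∀ᵐ p ∂(M.ν.prod M.μ₀), 0 < M.π θ p.2 p.1.1 ∧ M.π θ p.2 p.1.1 ≤ 1 - ε

/-! ### The likelihood, submodels, scores -/

namespace Model

/-- The measure on the sample space with respect to which the likelihood is a density. -/
def base (M : Model d 𝒰 𝒵) : Measure (Obs 𝒰 𝒵) :=
  (Measure.dirac false).prod (M.μ₀.prod M.ν) + (Measure.dirac true).prod (M.μ₁.prod M.ν)

/-- `∫ f₀(y₀ ∣ x, 0) / (1 - π(y₀, u; θ)) dy₀`. -/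
def oddsIntegral (M : Model d 𝒰 𝒵) (θ : EuclideanSpace ℝ (Fin d)) (η : Nuisance 𝒰 𝒵)
    (x : 𝒰 × 𝒵) : ℝ :=
  ∫ y, η.f₀ x y / (1 - M.π θ y x.1) ∂M.μ₀

/-- The likelihood of one observation. -/
def likelihood (M : Model d 𝒰 𝒵) (θ : EuclideanSpace ℝ (Fin d)) (η : Nuisance 𝒰 𝒵) :
    Obs 𝒰 𝒵 → ℝ
  | (t, y, x) =>
    (if t then M.oddsIntegral θ η x - 1 else 1) * (M.oddsIntegral θ η x)⁻¹ *
      (if t then η.f₁ x y else η.f₀ x y) * η.g x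

end Model

/-- `η` is a regular parametric submodel for the nuisance parts, with parameter `γ ∈ ℝʳ`, through
the truth `η₀` at `γ = 0`, and with score vector `S` at `γ = 0`: the square root of the likelihood
is differentiable in quadratic mean at `γ = 0` with derivative `S √p / 2`. -/
structure IsSubmodel (M : Model d 𝒰 𝒵) (θ : EuclideanSpace ℝ (Fin d)) (η₀ : Nuisance 𝒰 𝒵)
    {r : ℕ} (η : EuclideanSpace ℝ (Fin r) → Nuisance 𝒰 𝒵)
    (S : Obs 𝒰 𝒵 → EuclideanSpace ℝ (Fin r)) : Prop where
  at_zero : η 0 = η₀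
  isDensity : ∀ᶠ γ in 𝓝 0, (η γ).IsDensity M
  measurable_score : Measurable S
  score : Tendsto
    (fun γ : EuclideanSpace ℝ (Fin r) =>
      eLpNorm (fun o => Real.sqrt (M.likelihood θ (η γ) o) - Real.sqrt (M.likelihood θ η₀ o) -
        1 / 2 * inner ℝ γ (S o) * Real.sqrt (M.likelihood θ η₀ o)) 2 M.base / ‖γ‖ₑ)
    (𝓝[≠] 0) (𝓝 0)

/-! ### The Hilbert space and its subspaces -/

/-- The Hilbert space of `d`-dimensional functions of the observed data with mean zero and finite
variance under the law `P` of the observed data, a subspace of `L²(P)` with its inner product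
`⟨h₁, h₂⟩ = E(h₁ᵀ h₂)`. -/
def meanZero (d : ℕ) (P : Measure (Obs 𝒰 𝒵)) [IsFiniteMeasure P] :
    Submodule ℝ (Lp (EuclideanSpace ℝ (Fin d)) 2 P) where
  carrier := {h | ∫ o, h o ∂P = 0}
  zero_mem' := by
    have h : ∫ o, (0 : Lp (EuclideanSpace ℝ (Fin d)) 2 P) o ∂P =
        ∫ _, (0 : EuclideanSpace ℝ (Fin d)) ∂P := integral_congr_ae (Lp.coeFn_zero _ _ _)
    simpa using h
  add_mem' := by
    intro a b ha hb
    have h1 := integral_congr_ae (Lp.coeFn_add a b)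
    have h2 := integral_add ((Lp.memLp a).integrable one_le_two)
      ((Lp.memLp b).integrable one_le_two)
    simp only [Set.mem_ofPred_eq] at ha hb ⊢
    rw [h1]
    simp only [Pi.add_apply]
    rw [h2, ha, hb, add_zero]
  smul_mem' := by
    intro k a ha
    have h1 := integral_congr_ae (Lp.coeFn_smul k a)
    simp only [Set.mem_ofPred_eq] at ha ⊢
    rw [h1]
    simp only [Pi.smul_apply]
    rw [integral_smul, ha, smul_zero]

/-- The space `ℋ`, for the law of the observed data `W`. -/
abbrev HSpace (d : ℕ) (D : PotentialOutcomes Ω 𝒰 𝒵) (P : Measure Ω) [IsFiniteMeasure P] : Type _ :=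
  meanZero d (P.map D.W)

/-- The nuisance tangent space of the submodels whose members satisfy `free`: the mean squared
closure of the union, over all such regular parametric submodels, of the tangent spaces
`{B S : B a d × r matrix}` spanned by their score vectors `S`. The parameter `θ` is kept fixed. -/
def nuisanceTangentSpace (M : Model d 𝒰 𝒵) (D : PotentialOutcomes Ω 𝒰 𝒵) (P : Measure Ω)
    [IsFiniteMeasure P] (θ : EuclideanSpace ℝ (Fin d)) (η₀ : Nuisance 𝒰 𝒵)
    (free : Nuisance 𝒰 𝒵 → Prop) : Set (HSpace d D P) :=
  closure {h | ∃ (r : ℕ) (η : EuclideanSpace ℝ (Fin r) → Nuisance 𝒰 𝒵)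
    (S : Obs 𝒰 𝒵 → EuclideanSpace ℝ (Fin r))
    (B : EuclideanSpace ℝ (Fin r) →ₗ[ℝ] EuclideanSpace ℝ (Fin d)),
    IsSubmodel M θ η₀ η S ∧ (∀ γ, free (η γ)) ∧ h.1 =ᵐ[P.map D.W] fun o => B (S o)}

/-- `(1-t) c(y₀,x) + (t-w(x))/w(x) E₀{c(y₀,x) ∣ x}` with `E₀{c(y₀,x) ∣ x, 0} = 0`. -/
def lambda₀ (d : ℕ) (D : PotentialOutcomes Ω 𝒰 𝒵) (P : Measure Ω) [IsFiniteMeasure P] :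
    Set (HSpace d D P) :=
  {h | ∃ c : ℝ → 𝒰 × 𝒵 → EuclideanSpace ℝ (Fin d),
    Measurable (fun p : ℝ × (𝒰 × 𝒵) => c p.1 p.2) ∧
    MemLp (fun ω => c (D.Y₀ ω) (D.X ω)) 2 (D.given P false) ∧
    (D.given P false)[fun ω => c (D.Y₀ ω) (D.X ω) | D.sigmaX] =ᵐ[D.given P false] 0 ∧
    (fun ω => h.1 (D.W ω)) =ᵐ[P] fun ω =>
      (1 - ind (D.T ω)) • c (D.Y₀ ω) (D.X ω) +
        ((ind (D.T ω) - D.w P ω) / D.w P ω) •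
          (P[fun ω' => c (D.Y₀ ω') (D.X ω') | D.sigmaX]) ω}

/-- `t b(y₁,x)` with `E₁{b(y₁,x) ∣ x, 1} = 0`. -/
def lambda₁ (d : ℕ) (D : PotentialOutcomes Ω 𝒰 𝒵) (P : Measure Ω) [IsFiniteMeasure P] :
    Set (HSpace d D P) :=
  {h | ∃ b : ℝ → 𝒰 × 𝒵 → EuclideanSpace ℝ (Fin d),
    Measurable (fun p : ℝ × (𝒰 × 𝒵) => b p.1 p.2) ∧
    MemLp (fun ω => b (D.Y₁ ω) (D.X ω)) 2 (D.given P true) ∧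
    (D.given P true)[fun ω => b (D.Y₁ ω) (D.X ω) | D.sigmaX] =ᵐ[D.given P true] 0 ∧
    (fun ω => h.1 (D.W ω)) =ᵐ[P] fun ω => ind (D.T ω) • b (D.Y₁ ω) (D.X ω)}

/-- `a(x)` with `E{a(x)} = 0`. -/
def lambda₂ (d : ℕ) (D : PotentialOutcomes Ω 𝒰 𝒵) (P : Measure Ω) [IsFiniteMeasure P] :
    Set (HSpace d D P) :=
  {h | ∃ a : 𝒰 × 𝒵 → EuclideanSpace ℝ (Fin d), Measurable a ∧
    ∫ ω, a (D.X ω) ∂P = 0 ∧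
    (fun ω => h.1 (D.W ω)) =ᵐ[P] fun ω => a (D.X ω)}

/-- `(t-π(θ))/(1-π(θ)) g(x)`. -/
def lambdaPerp (M : Model d 𝒰 𝒵) (D : PotentialOutcomes Ω 𝒰 𝒵) (P : Measure Ω)
    [IsFiniteMeasure P] (θ : EuclideanSpace ℝ (Fin d)) : Set (HSpace d D P) :=
  {h | ∃ g : 𝒰 × 𝒵 → EuclideanSpace ℝ (Fin d), Measurable g ∧
    (fun ω => h.1 (D.W ω)) =ᵐ[P] fun ω =>
      ((ind (D.T ω) - M.π θ (D.Y₀ ω) (D.X ω).1) / (1 - M.π θ (D.Y₀ ω) (D.X ω).1)) • g (D.X ω)}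

end ATT

end

/-! Everything is fibred over the covariates. Write D(x) for `oddsIntegral`. Given x, an observation
falls in the arm t = 0 with probability 1/D(x) and then y follows `kernel₀`, or in the arm t = 1
with probability 1 - 1/D(x) and then y follows `kernel₁` (`FollowsModel.map_W`). Inner products in ℋ
are therefore integrals over x of pairings inside one fibre, and much of the proof is linear algebra
at a fixed x.

Consider four subspaces G₀, ..., G₃ of bounded functions (`boundedSpace`): scores for f₀, f₁, g in
bounded directions, and residuals (t-π)/(1-π) g(x) with g bounded. Writing the pairing of h with a
member of Gᵢ as the pairing of its direction with an expression in h, the i-th defect, shows that h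
is orthogonal to Gᵢ exactly when that defect vanishes (`defect₀_eq_zero_iff` to
`defect₃_eq_zero_iff`): a bounded, centred multiple of the defect is itself an admissible direction.
At a fixed x, h has the form prescribed for Λᵢ exactly when the other three defects vanish
(`isScore₀_iff` to `isResidual_iff`), and h = 0 when all four do. Hence Λᵢ is the intersection of
the complements of the Gⱼ with j ≠ i (`orthogonalToOthers`), while the Gᵢ are pairwise orthogonal
and jointly total. Hilbert space geometry then gives Λᵢ = closure of Gᵢ and the orthogonal
decomposition of ℋ (`topologicalClosure_eq_orthogonalToOthers`, `isInternal_orthogonalToOthers`).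

It remains to squeeze each set of tangent vectors between Gᵢ and Λᵢ. From below: multiplying the
densities by 1 + ⟨γ, direction⟩ is a regular submodel whose score is the given bounded score
(`isSubmodel_tilt`). From above: a member ψ of Gⱼ keeps mean zero along any submodel that fixes the
j-th nuisance part, and along every submodel if j = 3, because θ is fixed. Differentiating this
constant mean at γ = 0 gives E(ψᵀBS) = 0 (`IsSubmodel.integral_inner_score`). The derivative is
taken without differentiating densities pointwise: under a base measure weighted by a bounded
nonnegative function, the squared L² norm of the root likelihood is constant, so its derivative, an
inner product of the root likelihood with the score, is zero (`integral_score_eq_zero`). For the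
joint tangent space only orthogonality to G₃ is needed, since Λ₀ ⊕ Λ₁ ⊕ Λ₂ is the complement of G₃.
-/

noncomputable section

namespace ATT

variable {d : ℕ} {𝒰 𝒵 : Type*} [MeasurableSpace 𝒰] [MeasurableSpace 𝒵]

/-! ### Conditional densities as kernels -/

section CondKernel

variable {𝒳 : Type*} [MeasurableSpace 𝒳]

/-- The kernel `x ↦ f(· ∣ x) dμ`. -/
def condKernel (μ : Measure ℝ) [SFinite μ] (f : 𝒳 → ℝ → ℝ) : Kernel 𝒳 ℝ :=
  (Kernel.const 𝒳 μ).withDensity fun x y => ENNReal.ofReal (f x y)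

instance (μ : Measure ℝ) [SFinite μ] (f : 𝒳 → ℝ → ℝ) : IsSFiniteKernel (condKernel μ f) := by
  unfold condKernel; exact Kernel.IsSFiniteKernel.withDensity _ fun _ _ => ENNReal.ofReal_ne_top

variable {μ : Measure ℝ} [SFinite μ] {f : 𝒳 → ℝ → ℝ}

theorem condKernel_apply (hf : Measurable fun p : 𝒳 × ℝ => f p.1 p.2) (x : 𝒳) :
    condKernel μ f x = μ.withDensity fun y => ENNReal.ofReal (f x y) := by
  unfold condKernel
  rw [Kernel.withDensity_apply, Kernel.const_apply]
  exact hf.ennreal_ofReal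

theorem measurable_section (hf : Measurable fun p : 𝒳 × ℝ => f p.1 p.2) (x : 𝒳) :
    Measurable (f x) :=
  hf.comp (measurable_const.prodMk measurable_id)

theorem condKernel_absolutelyContinuous (hf : Measurable fun p : 𝒳 × ℝ => f p.1 p.2) (x : 𝒳) :
    condKernel μ f x ≪ μ := by
  rw [condKernel_apply hf]; exact withDensity_absolutelyContinuous _ _

theorem lintegral_condKernel (hf : Measurable fun p : 𝒳 × ℝ => f p.1 p.2) (x : 𝒳)
    {u : ℝ → ℝ≥0∞} (hu : Measurable u) :
    ∫⁻ y, u y ∂condKernel μ f x = ∫⁻ y, ENNReal.ofReal (f x y) * u y ∂μ := by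
  rw [condKernel_apply hf, lintegral_withDensity_eq_lintegral_mul _
    (measurable_section hf x).ennreal_ofReal hu]
  rfl

theorem integral_condKernel {E : Type*} [NormedAddCommGroup E] [NormedSpace ℝ E]
    (hf : Measurable fun p : 𝒳 × ℝ => f p.1 p.2) (h0 : ∀ x y, 0 ≤ f x y) (x : 𝒳) (u : ℝ → E) :
    ∫ y, u y ∂condKernel μ f x = ∫ y, f x y • u y ∂μ := by
  rw [condKernel_apply hf, integral_withDensity_eq_integral_toReal_smul
    (measurable_section hf x).ennreal_ofReal (by simp)]
  simp [ENNReal.toReal_ofReal (h0 x _)]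

/-- Bridge from the densities against product measures, in which the model is stated, to the kernels
in which the proof works; it is Tonelli's theorem. -/
theorem prod_withDensity_eq_compProd (hf : Measurable fun p : 𝒳 × ℝ => f p.1 p.2)
    (m : Measure 𝒳) [SFinite m] :
    (m.prod μ).withDensity (fun p => ENNReal.ofReal (f p.1 p.2)) = m ⊗ₘ condKernel μ f := by
  refine Measure.ext_of_lintegral _ fun F hF => ?_
  rw [lintegral_withDensity_eq_lintegral_mul _ hf.ennreal_ofReal hF,
    lintegral_prod _ (hf.ennreal_ofReal.mul hF).aemeasurable, Measure.lintegral_compProd hF]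
  refine lintegral_congr fun x => ?_
  exact (lintegral_condKernel hf x (u := fun y => F (x, y))
    (hF.comp (measurable_const.prodMk measurable_id))).symm

end CondKernel

/-! ### The law of one observation -/

variable (M : Model d 𝒰 𝒵) (θ : EuclideanSpace ℝ (Fin d)) (η : Nuisance 𝒰 𝒵)

/-- The conditional law of `Y₀` given `X = x, T = 0`. -/
abbrev kernel₀ : Kernel (𝒰 × 𝒵) ℝ := condKernel M.μ₀ η.f₀

/-- The conditional law of `Y₁` given `X = x, T = 1`. -/
abbrev kernel₁ : Kernel (𝒰 × 𝒵) ℝ := condKernel M.μ₁ η.f₁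

/-- The law of the covariates. -/
def covLaw : Measure (𝒰 × 𝒵) := M.ν.withDensity fun x => ENNReal.ofReal (η.g x)

instance : SFinite (covLaw M η) := by unfold covLaw; infer_instance

/-- The law of `X` on `T = 0`. -/
def covLaw₀ : Measure (𝒰 × 𝒵) :=
  (covLaw M η).withDensity fun x => ENNReal.ofReal (M.oddsIntegral θ η x)⁻¹

/-- The law of `X` on `T = 1`. -/
def covLaw₁ : Measure (𝒰 × 𝒵) :=
  (covLaw M η).withDensity fun x => ENNReal.ofReal (1 - (M.oddsIntegral θ η x)⁻¹)

instance : SFinite (covLaw₀ M θ η) := by unfold covLaw₀; infer_instance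
instance : SFinite (covLaw₁ M θ η) := by unfold covLaw₁; infer_instance

/-- The observation with treatment `t`, from covariates and outcome. -/
def mkObs (t : Bool) (p : (𝒰 × 𝒵) × ℝ) : Obs 𝒰 𝒵 := (t, p.2, p.1)

theorem measurable_mkObs (t : Bool) : Measurable (mkObs t : (𝒰 × 𝒵) × ℝ → Obs 𝒰 𝒵) :=
  measurable_const.prodMk (measurable_snd.prodMk measurable_fst)

/-- The law of one observation. -/
def obsLaw : Measure (Obs 𝒰 𝒵) :=
  (covLaw₀ M θ η ⊗ₘ kernel₀ M η).map (mkObs false) +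
    (covLaw₁ M θ η ⊗ₘ kernel₁ M η).map (mkObs true)

variable {M θ η}

theorem measurable_one_sub_π (M : Model d 𝒰 𝒵) (θ : EuclideanSpace ℝ (Fin d)) :
    Measurable fun p : (𝒰 × 𝒵) × ℝ => 1 - M.π θ p.2 p.1.1 :=
  measurable_const.sub ((M.measurable_π θ).comp
    (measurable_snd.prodMk (measurable_fst.comp measurable_fst)))

theorem oddsIntegral_eq (hη : η.IsDensity M) (x : 𝒰 × 𝒵) :
    M.oddsIntegral θ η x = ∫ y, (1 - M.π θ y x.1)⁻¹ ∂kernel₀ M η x := by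
  rw [integral_condKernel hη.f₀.measurable hη.f₀.nonneg]
  simp [Model.oddsIntegral, div_eq_mul_inv]

theorem measurable_oddsIntegral (hη : η.IsDensity M) : Measurable (M.oddsIntegral θ η) := by
  have := (StronglyMeasurable.integral_kernel_prod_right' (κ := kernel₀ M η)
    (measurable_one_sub_π M θ).inv.stronglyMeasurable).measurable
  convert this using 2 with x
  exact oddsIntegral_eq hη x

theorem measurable_inv_odds (hη : η.IsDensity M) :
    Measurable fun x => ENNReal.ofReal (M.oddsIntegral θ η x)⁻¹ :=
  (measurable_oddsIntegral hη).inv.ennreal_ofReal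

theorem measurable_one_sub_inv_odds (hη : η.IsDensity M) :
    Measurable fun x => ENNReal.ofReal (1 - (M.oddsIntegral θ η x)⁻¹) :=
  (measurable_const.sub (measurable_oddsIntegral hη).inv).ennreal_ofReal

variable (M θ η)

/-- Covariate values at which the densities and the propensity score are nondegenerate. -/
structure IsRegularPoint (ε : ℝ) (x : 𝒰 × 𝒵) : Prop where
  prob₀ : IsProbabilityMeasure (kernel₀ M η x)
  prob₁ : IsProbabilityMeasure (kernel₁ M η x)
  π_bounds : ∀ᵐ y ∂kernel₀ M η x, 0 < M.π θ y x.1 ∧ M.π θ y x.1 ≤ 1 - ε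
  one_lt_odds : 1 < M.oddsIntegral θ η x

variable {M θ η} {ε : ℝ}

theorem IsRegularPoint.inv_bounds (hε : 0 < ε) {x : 𝒰 × 𝒵} (hx : IsRegularPoint M θ η ε x) :
    ∀ᵐ y ∂kernel₀ M η x, 1 < (1 - M.π θ y x.1)⁻¹ ∧ (1 - M.π θ y x.1)⁻¹ ≤ ε⁻¹ := by
  filter_upwards [hx.π_bounds] with y hy
  refine ⟨one_lt_inv_iff₀.2 ⟨by linarith, by linarith⟩, inv_anti₀ hε (by linarith)⟩

theorem measurable_inv_section (M : Model d 𝒰 𝒵) (θ : EuclideanSpace ℝ (Fin d)) (x : 𝒰 × 𝒵) :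
    Measurable fun y => (1 - M.π θ y x.1)⁻¹ :=
  ((measurable_one_sub_π M θ).comp (measurable_const.prodMk measurable_id)).inv

theorem IsRegularPoint.integrable_inv (hε : 0 < ε) {x : 𝒰 × 𝒵}
    (hx : IsRegularPoint M θ η ε x) :
    Integrable (fun y => (1 - M.π θ y x.1)⁻¹) (kernel₀ M η x) := by
  have := hx.prob₀
  refine Integrable.of_bound (measurable_inv_section M θ x).aestronglyMeasurable ε⁻¹ ?_
  filter_upwards [hx.inv_bounds hε] with y hy
  rw [Real.norm_of_nonneg (by linarith)]; exact hy.2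

/-- Fubini turns overlap for almost all pairs into overlap along almost every fibre. Of the nuisance
parts only their being densities is used, so one ε serves all members of a submodel near the truth.
-/
theorem ae_isRegularPoint (hη : η.IsDensity M) (hε : 0 < ε)
    (hπ : ∀ᵐ p ∂(M.ν.prod M.μ₀), 0 < M.π θ p.2 p.1.1 ∧ M.π θ p.2 p.1.1 ≤ 1 - ε) :
    ∀ᵐ x ∂M.ν, IsRegularPoint M θ η ε x := by
  filter_upwards [Measure.ae_ae_of_ae_prod hπ, hη.f₀.lintegral_eq_one,
    hη.f₁.lintegral_eq_one] with x h1 h2 h3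
  have p0 : IsProbabilityMeasure (kernel₀ M η x) := ⟨by
    rw [condKernel_apply hη.f₀.measurable, withDensity_apply _ MeasurableSet.univ,
      Measure.restrict_univ, h2]⟩
  have p1 : IsProbabilityMeasure (kernel₁ M η x) := ⟨by
    rw [condKernel_apply hη.f₁.measurable, withDensity_apply _ MeasurableSet.univ,
      Measure.restrict_univ, h3]⟩
  have hb : ∀ᵐ y ∂kernel₀ M η x, 0 < M.π θ y x.1 ∧ M.π θ y x.1 ≤ 1 - ε :=
    (condKernel_absolutelyContinuous hη.f₀.measurable x).ae_le h1
  have hb' : ∀ᵐ y ∂kernel₀ M η x, 1 < (1 - M.π θ y x.1)⁻¹ ∧ (1 - M.π θ y x.1)⁻¹ ≤ ε⁻¹ := by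
    filter_upwards [hb] with y hy
    exact ⟨one_lt_inv_iff₀.2 ⟨by linarith, by linarith⟩, inv_anti₀ hε (by linarith)⟩
  have hint : Integrable (fun y => (1 - M.π θ y x.1)⁻¹) (kernel₀ M η x) := by
    refine Integrable.of_bound (measurable_inv_section M θ x).aestronglyMeasurable ε⁻¹ ?_
    filter_upwards [hb'] with y hy
    rw [Real.norm_of_nonneg (by linarith)]; exact hy.2
  refine ⟨p0, p1, hb, ?_⟩
  rw [oddsIntegral_eq hη]
  have hnn : 0 ≤ᵐ[kernel₀ M η x] fun y => (1 - M.π θ y x.1)⁻¹ - 1 := by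
    filter_upwards [hb'] with y hy
    exact sub_nonneg.2 hy.1.le
  have h4 : 0 < ∫ y, ((1 - M.π θ y x.1)⁻¹ - 1) ∂kernel₀ M η x := by
    -- If the mean of the nonnegative function (1-π)⁻¹ - 1 were zero, it would vanish almost
    -- everywhere, against π > 0.
    refine lt_of_le_of_ne (integral_nonneg_of_ae hnn) fun h => ?_
    have h5 := (integral_eq_zero_iff_of_nonneg_ae hnn (hint.sub (integrable_const _))).1 h.symm
    have h6 : ∀ᵐ y ∂kernel₀ M η x, False := by
      filter_upwards [h5, hb'] with y hy1 hy2
      simp only [Pi.zero_apply] at hy1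
      linarith [hy2.1]
    rw [ae_iff] at h6
    simp at h6
  rw [integral_sub hint (integrable_const _)] at h4
  simpa using h4

theorem covLaw_absolutelyContinuous : covLaw M η ≪ M.ν := withDensity_absolutelyContinuous _ _

theorem isProbabilityMeasure_covLaw (hη : η.IsDensity M) : IsProbabilityMeasure (covLaw M η) :=
  ⟨by rw [covLaw, withDensity_apply _ MeasurableSet.univ, Measure.restrict_univ, hη.g_lintegral]⟩

theorem lintegral_obsLaw (hη : η.IsDensity M) {F : Obs 𝒰 𝒵 → ℝ≥0∞} (hF : Measurable F) :
    ∫⁻ o, F o ∂obsLaw M θ η =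
      ∫⁻ x, ENNReal.ofReal (M.oddsIntegral θ η x)⁻¹ *
        ∫⁻ y, F (false, y, x) ∂kernel₀ M η x ∂covLaw M η
      + ∫⁻ x, ENNReal.ofReal (1 - (M.oddsIntegral θ η x)⁻¹) *
          ∫⁻ y, F (true, y, x) ∂kernel₁ M η x ∂covLaw M η := by
  have h0 : Measurable fun p => F (mkObs false p) := hF.comp (measurable_mkObs false)
  have h1 : Measurable fun p => F (mkObs true p) := hF.comp (measurable_mkObs true)
  rw [obsLaw, lintegral_add_measure, lintegral_map hF (measurable_mkObs _),
    lintegral_map hF (measurable_mkObs _), Measure.lintegral_compProd h0,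
    Measure.lintegral_compProd h1, covLaw₀, covLaw₁,
    lintegral_withDensity_eq_lintegral_mul _ (measurable_inv_odds hη)
      (h0.lintegral_kernel_prod_right' ),
    lintegral_withDensity_eq_lintegral_mul _ (measurable_one_sub_inv_odds hη)
      h1.lintegral_kernel_prod_right']
  rfl

/-! ### Null sets and integrals under the law of an observation, fibre by fibre -/

section Formula

variable {E : Type*} [NormedAddCommGroup E]

theorem ae_inv_odds_pos (hreg : ∀ᵐ x ∂M.ν, IsRegularPoint M θ η ε x) :
    ∀ᵐ x ∂covLaw M η, 0 < (M.oddsIntegral θ η x)⁻¹ ∧ 0 < 1 - (M.oddsIntegral θ η x)⁻¹ := by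
  filter_upwards [covLaw_absolutelyContinuous.ae_le hreg] with x hx
  exact ⟨inv_pos.2 (by linarith [hx.one_lt_odds]),
    sub_pos.2 (inv_lt_one_of_one_lt₀ hx.one_lt_odds)⟩

/-- The weight 1/D of this arm is positive, so passing to the arm creates no new null sets of
covariates. The same holds for the other arm, because D > 1. -/
theorem ae_covLaw₀_iff (hη : η.IsDensity M) (hreg : ∀ᵐ x ∂M.ν, IsRegularPoint M θ η ε x)
    {p : 𝒰 × 𝒵 → Prop} : (∀ᵐ x ∂covLaw₀ M θ η, p x) ↔ ∀ᵐ x ∂covLaw M η, p x := by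
  rw [covLaw₀, ae_withDensity_iff (measurable_inv_odds hη)]
  constructor
  · intro h
    filter_upwards [h, ae_inv_odds_pos hreg] with x hx h2
    exact hx (by simpa using h2.1)
  · intro h
    filter_upwards [h] with x hx _ using hx

theorem ae_covLaw₁_iff (hη : η.IsDensity M) (hreg : ∀ᵐ x ∂M.ν, IsRegularPoint M θ η ε x)
    {p : 𝒰 × 𝒵 → Prop} : (∀ᵐ x ∂covLaw₁ M θ η, p x) ↔ ∀ᵐ x ∂covLaw M η, p x := by
  rw [covLaw₁, ae_withDensity_iff (measurable_one_sub_inv_odds hη)]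
  constructor
  · intro h
    filter_upwards [h, ae_inv_odds_pos hreg] with x hx h2
    exact hx (by simpa using h2.2)
  · intro h
    filter_upwards [h] with x hx _ using hx

theorem ae_of_ae_obsLaw (hη : η.IsDensity M) (hreg : ∀ᵐ x ∂M.ν, IsRegularPoint M θ η ε x)
    {p : Obs 𝒰 𝒵 → Prop} (h : ∀ᵐ o ∂obsLaw M θ η, p o) :
    ∀ᵐ x ∂covLaw M η, (∀ᵐ y ∂kernel₀ M η x, p (false, y, x)) ∧
      ∀ᵐ y ∂kernel₁ M η x, p (true, y, x) := by
  rw [obsLaw, ae_add_measure_iff] at h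
  have h0 := Measure.ae_ae_of_ae_compProd
    (ae_of_ae_map (measurable_mkObs false).aemeasurable h.1)
  have h1 := Measure.ae_ae_of_ae_compProd
    (ae_of_ae_map (measurable_mkObs true).aemeasurable h.2)
  rw [ae_covLaw₀_iff hη hreg] at h0
  rw [ae_covLaw₁_iff hη hreg] at h1
  filter_upwards [h0, h1] with x a b using ⟨a, b⟩

theorem ae_obsLaw_of_ae (hη : η.IsDensity M) (hreg : ∀ᵐ x ∂M.ν, IsRegularPoint M θ η ε x)
    {p : Obs 𝒰 𝒵 → Prop} (hp : MeasurableSet {o | p o})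
    (h : ∀ᵐ x ∂covLaw M η, (∀ᵐ y ∂kernel₀ M η x, p (false, y, x)) ∧
      ∀ᵐ y ∂kernel₁ M η x, p (true, y, x)) : ∀ᵐ o ∂obsLaw M θ η, p o := by
  rw [obsLaw, ae_add_measure_iff, ae_map_iff (measurable_mkObs _).aemeasurable hp,
    ae_map_iff (measurable_mkObs _).aemeasurable hp]
  constructor
  · refine Measure.ae_compProd_of_ae_ae ((measurable_mkObs false) hp) ?_
    rw [ae_covLaw₀_iff hη hreg]
    filter_upwards [h] with x hx using hx.1
  · refine Measure.ae_compProd_of_ae_ae ((measurable_mkObs true) hp) ?_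
    rw [ae_covLaw₁_iff hη hreg]
    filter_upwards [h] with x hx using hx.2

theorem integrable_compProd_obsLaw {F : Obs 𝒰 𝒵 → E} (hF : Integrable F (obsLaw M θ η)) :
    Integrable (fun p => F (mkObs false p)) (covLaw₀ M θ η ⊗ₘ kernel₀ M η) ∧
    Integrable (fun p => F (mkObs true p)) (covLaw₁ M θ η ⊗ₘ kernel₁ M η) := by
  rw [obsLaw, integrable_add_measure] at hF
  exact ⟨hF.1.comp_measurable (measurable_mkObs _), hF.2.comp_measurable (measurable_mkObs _)⟩

theorem ae_integrable_of_integrable_obsLaw (hη : η.IsDensity M)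
    (hreg : ∀ᵐ x ∂M.ν, IsRegularPoint M θ η ε x) {F : Obs 𝒰 𝒵 → E}
    (hF : Integrable F (obsLaw M θ η)) :
    ∀ᵐ x ∂covLaw M η, Integrable (fun y => F (false, y, x)) (kernel₀ M η x) ∧
      Integrable (fun y => F (true, y, x)) (kernel₁ M η x) := by
  obtain ⟨h0, h1⟩ := integrable_compProd_obsLaw hF
  have i0 := ((Measure.integrable_compProd_iff h0.aestronglyMeasurable).1 h0).1
  have i1 := ((Measure.integrable_compProd_iff h1.aestronglyMeasurable).1 h1).1
  rw [ae_covLaw₀_iff hη hreg] at i0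
  rw [ae_covLaw₁_iff hη hreg] at i1
  filter_upwards [i0, i1] with x a b using ⟨a, b⟩

variable [NormedSpace ℝ E]

/-- The integral of a function of the observed data, by conditioning on the covariates. -/
def condMean (M : Model d 𝒰 𝒵) (θ : EuclideanSpace ℝ (Fin d)) (η : Nuisance 𝒰 𝒵)
    (F : Obs 𝒰 𝒵 → E) (x : 𝒰 × 𝒵) : E :=
  (M.oddsIntegral θ η x)⁻¹ • ∫ y, F (false, y, x) ∂kernel₀ M η x +
    (1 - (M.oddsIntegral θ η x)⁻¹) • ∫ y, F (true, y, x) ∂kernel₁ M η x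

/-- Fubini in each arm, with the arm probabilities pulled out as weights. Means and inner products
are computed through this formula. -/
theorem integrable_condMean_and_integral_obsLaw (hη : η.IsDensity M)
    (hreg : ∀ᵐ x ∂M.ν, IsRegularPoint M θ η ε x)
    {F : Obs 𝒰 𝒵 → E} (hF : Integrable F (obsLaw M θ η)) :
    Integrable (condMean M θ η F) (covLaw M η) ∧
      ∫ o, F o ∂obsLaw M θ η = ∫ x, condMean M θ η F x ∂covLaw M η := by
  obtain ⟨h0, h1⟩ := integrable_compProd_obsLaw hF
  have m0 := measurable_inv_odds (θ := θ) hη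
  have m1 := measurable_one_sub_inv_odds (θ := θ) hη
  have i0 : Integrable (fun x => ∫ y, F (mkObs false (x, y)) ∂kernel₀ M η x)
      (covLaw₀ M θ η) := h0.integral_compProd
  have i1 : Integrable (fun x => ∫ y, F (mkObs true (x, y)) ∂kernel₁ M η x)
      (covLaw₁ M θ η) := h1.integral_compProd
  rw [covLaw₀, integrable_withDensity_iff_integrable_smul₀' m0.aemeasurable (by simp)] at i0
  rw [covLaw₁, integrable_withDensity_iff_integrable_smul₀' m1.aemeasurable (by simp)] at i1
  have e0 : (fun x => (ENNReal.ofReal (M.oddsIntegral θ η x)⁻¹).toReal •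
      ∫ y, F (mkObs false (x, y)) ∂kernel₀ M η x) =ᵐ[covLaw M η]
      fun x => (M.oddsIntegral θ η x)⁻¹ • ∫ y, F (false, y, x) ∂kernel₀ M η x := by
    filter_upwards [ae_inv_odds_pos hreg] with x hx
    rw [ENNReal.toReal_ofReal hx.1.le]; rfl
  have e1 : (fun x => (ENNReal.ofReal (1 - (M.oddsIntegral θ η x)⁻¹)).toReal •
      ∫ y, F (mkObs true (x, y)) ∂kernel₁ M η x) =ᵐ[covLaw M η]
      fun x => (1 - (M.oddsIntegral θ η x)⁻¹) • ∫ y, F (true, y, x) ∂kernel₁ M η x := by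
    filter_upwards [ae_inv_odds_pos hreg] with x hx
    rw [ENNReal.toReal_ofReal hx.2.le]; rfl
  have j0 := i0.congr e0
  have j1 := i1.congr e1
  refine ⟨j0.add j1, ?_⟩
  have hF' := hF
  rw [obsLaw, integrable_add_measure] at hF'
  rw [obsLaw, integral_add_measure hF'.1 hF'.2,
    integral_map (measurable_mkObs _).aemeasurable hF'.1.aestronglyMeasurable,
    integral_map (measurable_mkObs _).aemeasurable hF'.2.aestronglyMeasurable,
    Measure.integral_compProd h0, Measure.integral_compProd h1, covLaw₀, covLaw₁,
    integral_withDensity_eq_integral_toReal_smul m0 (by simp),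
    integral_withDensity_eq_integral_toReal_smul m1 (by simp),
    integral_congr_ae e0, integral_congr_ae e1, ← integral_add j0 j1]
  rfl

end Formula

/-- The arm probabilities add up to one. This is derived from the densities and not from a random
variable, because it is needed for every member of a submodel. -/
theorem isProbabilityMeasure_obsLaw (hη : η.IsDensity M)
    (hreg : ∀ᵐ x ∂M.ν, IsRegularPoint M θ η ε x) : IsProbabilityMeasure (obsLaw M θ η) := by
  have := isProbabilityMeasure_covLaw hη
  refine ⟨?_⟩
  have h := lintegral_obsLaw (θ := θ) hη (F := fun _ => 1) measurable_const
  rw [lintegral_one] at h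
  rw [h, ← lintegral_add_left (by
    exact (measurable_inv_odds hη).mul (measurable_const.lintegral_kernel (κ := kernel₀ M η)))]
  have : ∫⁻ x, 1 ∂covLaw M η = 1 := by simp
  rw [← this]
  refine lintegral_congr_ae ?_
  filter_upwards [covLaw_absolutelyContinuous.ae_le hreg, ae_inv_odds_pos hreg] with x hx h2
  have := hx.prob₀
  have := hx.prob₁
  simp only [lintegral_one, measure_univ, mul_one]
  rw [← ENNReal.ofReal_add h2.1.le h2.2.le]
  simp

end ATT

/-! ### The likelihood as the density of the law of an observation -/

namespace ATT

variable {d : ℕ} {𝒰 𝒵 : Type*} [MeasurableSpace 𝒰] [MeasurableSpace 𝒵]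
variable {M : Model d 𝒰 𝒵} {θ : EuclideanSpace ℝ (Fin d)} {η : Nuisance 𝒰 𝒵} {ε : ℝ}

theorem measurable_likelihood (hη : η.IsDensity M) : Measurable (M.likelihood θ η) := by
  refine measurable_from_prod_countable_right fun t => ?_
  have hD : Measurable fun p : ℝ × (𝒰 × 𝒵) => M.oddsIntegral θ η p.2 :=
    (measurable_oddsIntegral hη).comp measurable_snd
  have hg : Measurable fun p : ℝ × (𝒰 × 𝒵) => η.g p.2 := hη.g_measurable.comp measurable_snd
  cases t
  · exact ((measurable_const.mul hD.inv).mul (hη.f₀.measurable.comp measurable_swap)).mul hg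
  · exact (((hD.sub measurable_const).mul hD.inv).mul
      (hη.f₁.measurable.comp measurable_swap)).mul hg

theorem lintegral_base {F : Obs 𝒰 𝒵 → ℝ≥0∞} (hF : Measurable F) :
    ∫⁻ o, F o ∂M.base = ∫⁻ x, ∫⁻ y, F (false, y, x) ∂M.μ₀ ∂M.ν +
      ∫⁻ x, ∫⁻ y, F (true, y, x) ∂M.μ₁ ∂M.ν := by
  have h : ∀ t, Measurable fun p : ℝ × (𝒰 × 𝒵) => F (t, p) := fun t =>
    hF.comp (measurable_const.prodMk measurable_id)
  rw [Model.base, lintegral_add_measure, lintegral_prod _ hF.aemeasurable,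
    lintegral_prod _ hF.aemeasurable, lintegral_dirac' _ hF.lintegral_prod_right',
    lintegral_dirac' _ hF.lintegral_prod_right', lintegral_prod_symm _ (h _).aemeasurable,
    lintegral_prod_symm _ (h _).aemeasurable]

theorem likelihood_nonneg (hη : η.IsDensity M) {x : 𝒰 × 𝒵} (hx : IsRegularPoint M θ η ε x)
    (t : Bool) (y : ℝ) : 0 ≤ M.likelihood θ η (t, y, x) := by
  have h1 := hx.one_lt_odds
  have h2 : 0 ≤ (M.oddsIntegral θ η x)⁻¹ := inv_nonneg.2 (by linarith)
  cases t
  · simpa [Model.likelihood] using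
      mul_nonneg (mul_nonneg h2 (hη.f₀.nonneg x y)) (hη.g_nonneg x)
  · simpa [Model.likelihood] using
      mul_nonneg (mul_nonneg (mul_nonneg (by linarith) h2) (hη.f₁.nonneg x y)) (hη.g_nonneg x)

/-- The likelihood is the density of the law of one observation. -/
theorem withDensity_likelihood (hη : η.IsDensity M)
    (hreg : ∀ᵐ x ∂M.ν, IsRegularPoint M θ η ε x) :
    M.base.withDensity (fun o => ENNReal.ofReal (M.likelihood θ η o)) = obsLaw M θ η := by
  have hL := (measurable_likelihood (θ := θ) hη).ennreal_ofReal
  refine Measure.ext_of_lintegral _ fun F hF => ?_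
  have hFs : ∀ t x, Measurable fun y => F (t, y, x) := fun t x =>
    hF.comp (measurable_const.prodMk (measurable_id.prodMk measurable_const))
  rw [lintegral_withDensity_eq_lintegral_mul _ hL hF, lintegral_base (hL.mul hF),
    lintegral_obsLaw hη hF, covLaw,
    lintegral_withDensity_eq_lintegral_mul _ hη.g_measurable.ennreal_ofReal
      (by exact (measurable_inv_odds hη).mul
            (hF.comp (measurable_mkObs false)).lintegral_kernel_prod_right'),
    lintegral_withDensity_eq_lintegral_mul _ hη.g_measurable.ennreal_ofReal
      (by exact (measurable_one_sub_inv_odds hη).mul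
            (hF.comp (measurable_mkObs true)).lintegral_kernel_prod_right')]
  congr 1
  · refine lintegral_congr_ae ?_
    filter_upwards [hreg] with x hx
    have h1 := hx.one_lt_odds
    have h2 : 0 ≤ (M.oddsIntegral θ η x)⁻¹ := inv_nonneg.2 (by linarith)
    simp only [Pi.mul_apply]
    rw [lintegral_condKernel hη.f₀.measurable x (hFs _ x), ← mul_assoc,
      ← ENNReal.ofReal_mul (hη.g_nonneg x), ← lintegral_const_mul' _ _ ENNReal.ofReal_ne_top]
    refine lintegral_congr fun y => ?_
    rw [← mul_assoc, ← ENNReal.ofReal_mul (mul_nonneg (hη.g_nonneg x) h2)]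
    congr 2
    simp [Model.likelihood]; ring
  · refine lintegral_congr_ae ?_
    filter_upwards [hreg] with x hx
    have h1 := hx.one_lt_odds
    have h2 : 0 ≤ 1 - (M.oddsIntegral θ η x)⁻¹ := sub_nonneg.2 (inv_le_one_of_one_le₀ h1.le)
    simp only [Pi.mul_apply]
    rw [lintegral_condKernel hη.f₁.measurable x (hFs _ x), ← mul_assoc,
      ← ENNReal.ofReal_mul (hη.g_nonneg x), ← lintegral_const_mul' _ _ ENNReal.ofReal_ne_top]
    refine lintegral_congr fun y => ?_
    rw [← mul_assoc, ← ENNReal.ofReal_mul (mul_nonneg (hη.g_nonneg x) h2)]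
    congr 2
    simp only [Model.likelihood, if_true]
    field_simp

/-- Only null sets matter: projections of products are quasi measure preserving even if the outcome
measures are infinite. -/
theorem ae_base_of_ae {p : 𝒰 × 𝒵 → Prop} (h : ∀ᵐ x ∂M.ν, p x) :
    ∀ᵐ o ∂M.base, p o.2.2 := by
  have hq : ∀ (m : Measure ℝ) [SigmaFinite m] (t : Bool),
      ∀ᵐ o ∂((Measure.dirac t).prod (m.prod M.ν)), p o.2.2 := fun m _ t =>
    (Measure.quasiMeasurePreserving_snd.comp Measure.quasiMeasurePreserving_snd).ae h
  rw [Model.base, ae_add_measure_iff]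
  exact ⟨hq _ _, hq _ _⟩

theorem ae_base_of_ae_prod {p : Obs 𝒰 𝒵 → Prop}
    (h0 : ∀ᵐ q ∂(M.ν.prod M.μ₀), p (false, q.2, q.1))
    (h1 : ∀ᵐ q ∂(M.ν.prod M.μ₁), p (true, q.2, q.1)) (hp : MeasurableSet {o | p o}) :
    ∀ᵐ o ∂M.base, p o := by
  have hq : ∀ (m : Measure ℝ) [SigmaFinite m] (t : Bool),
      (∀ᵐ q ∂(M.ν.prod m), p (t, q.2, q.1)) →
      ∀ᵐ o ∂((Measure.dirac t).prod (m.prod M.ν)), p o := by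
    intro m _ t h
    rw [Measure.dirac_prod, ae_map_iff (by fun_prop) hp]
    rw [← Measure.prod_swap]
    have hp' : MeasurableSet {q : ℝ × (𝒰 × 𝒵) | p (t, q)} :=
      (measurable_const.prodMk measurable_id : Measurable fun q : ℝ × (𝒰 × 𝒵) => (t, q)) hp
    exact (ae_map_iff measurable_swap.aemeasurable hp').2 h
  rw [Model.base, ae_add_measure_iff]
  exact ⟨hq _ _ h0, hq _ _ h1⟩

end ATT

namespace ATT

/-! ### Conditional expectations as integrals against kernels -/

/-- An event generated by X is a cylinder A × ℝ for the pair (X, Y), and there the disintegration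
gives the defining set integrals of the conditional expectation. -/
theorem condExp_ae_eq_integral_kernel {Ω 𝒳 E : Type*} [MeasurableSpace Ω] [MeasurableSpace 𝒳]
    [NormedAddCommGroup E] [NormedSpace ℝ E] [CompleteSpace E]
    {Q : Measure Ω} [IsFiniteMeasure Q] {X : Ω → 𝒳} {Y : Ω → ℝ} (hX : Measurable X)
    (hY : Measurable Y) {κ : Kernel 𝒳 ℝ} [IsSFiniteKernel κ]
    (h : Q.map (fun ω => (X ω, Y ω)) = Q.map X ⊗ₘ κ) {c : ℝ → 𝒳 → E}
    (hc : StronglyMeasurable fun p : 𝒳 × ℝ => c p.2 p.1)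
    (hi : Integrable (fun ω => c (Y ω) (X ω)) Q) :
    Q[fun ω => c (Y ω) (X ω) | MeasurableSpace.comap X inferInstance] =ᵐ[Q]
      fun ω => ∫ y, c y (X ω) ∂κ (X ω) := by
  have hZ : Measurable fun ω => (X ω, Y ω) := hX.prodMk hY
  have hi' : Integrable (fun p : 𝒳 × ℝ => c p.2 p.1) (Q.map X ⊗ₘ κ) := by
    rw [← h, integrable_map_measure hc.aestronglyMeasurable hZ.aemeasurable]; exact hi
  have hI : StronglyMeasurable fun x => ∫ y, c y x ∂κ x := hc.integral_kernel_prod_right'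
  have hIi : Integrable (fun x => ∫ y, c y x ∂κ x) (Q.map X) := hi'.integral_compProd
  symm
  refine ae_eq_condExp_of_forall_setIntegral_eq hX.comap_le hi
    (fun s _ _ => (hIi.comp_measurable hX).integrableOn) ?_
    (hI.comp_measurable (comap_measurable X)).aestronglyMeasurable
  rintro _ ⟨A, hA, rfl⟩ _
  rw [← setIntegral_map (f := fun x => ∫ y, c y x ∂κ x) hA hI.aestronglyMeasurable
    hX.aemeasurable]
  have e : X ⁻¹' A = (fun ω => (X ω, Y ω)) ⁻¹' (A ×ˢ Set.univ) := by ext; simp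
  rw [e, ← setIntegral_map (f := fun p : 𝒳 × ℝ => c p.2 p.1) (hA.prod MeasurableSet.univ)
    hc.aestronglyMeasurable hZ.aemeasurable, h,
    Measure.setIntegral_compProd hA MeasurableSet.univ hi'.integrableOn]
  simp

/-! ### The law of the observed data under the model -/

variable {d : ℕ} {Ω 𝒰 𝒵 : Type*} [MeasurableSpace Ω] [MeasurableSpace 𝒰] [MeasurableSpace 𝒵]
variable {M : Model d 𝒰 𝒵} {D : PotentialOutcomes Ω 𝒰 𝒵} {P : Measure Ω}
  {θ : EuclideanSpace ℝ (Fin d)} {η : Nuisance 𝒰 𝒵} {ε : ℝ}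

theorem measurableSet_treatment (D : PotentialOutcomes Ω 𝒰 𝒵) (t : Bool) :
    MeasurableSet (D.T ⁻¹' {t}) := D.measurable_T (measurableSet_singleton t)

instance [IsProbabilityMeasure P] (t : Bool) : IsZeroOrProbabilityMeasure (D.given P t) := by
  unfold PotentialOutcomes.given; infer_instance

/-- If the arm has probability zero, both sides are the zero measure, so nothing need be known yet
about the arm. -/
theorem smul_given [IsProbabilityMeasure P] (t : Bool) :
    P (D.T ⁻¹' {t}) • D.given P t = P.restrict (D.T ⁻¹' {t}) := by
  unfold PotentialOutcomes.given ProbabilityTheory.cond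
  by_cases h : P (D.T ⁻¹' {t}) = 0
  · rw [h, zero_smul, Measure.restrict_eq_zero.2 h]
  · rw [smul_smul, ENNReal.mul_inv_cancel h (measure_ne_top _ _), one_smul]

theorem map_restrict_eq_compProd [IsProbabilityMeasure P] {t : Bool} {Y : Ω → ℝ}
    {κ : Kernel (𝒰 × 𝒵) ℝ} [IsSFiniteKernel κ]
    (h : (D.given P t).map (fun ω => (D.X ω, Y ω)) = (D.given P t).map D.X ⊗ₘ κ) :
    (P.restrict (D.T ⁻¹' {t})).map (fun ω => (D.X ω, Y ω)) =
      (P.restrict (D.T ⁻¹' {t})).map D.X ⊗ₘ κ := by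
  rw [← smul_given, Measure.map_smul, h, Measure.map_smul, Measure.compProd_smul_left]

theorem PotentialOutcomes.restrict_add_restrict (D : PotentialOutcomes Ω 𝒰 𝒵) :
    P.restrict (D.T ⁻¹' {false}) + P.restrict (D.T ⁻¹' {true}) = P := by
  have : D.T ⁻¹' {true} = (D.T ⁻¹' {false})ᶜ := by ext ω; simp
  rw [this, Measure.restrict_add_restrict_compl (measurableSet_treatment D false)]

theorem PotentialOutcomes.measurable_W (D : PotentialOutcomes Ω 𝒰 𝒵) : Measurable D.W := by
  have hi : Measurable ind := measurable_of_countable _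
  have := D.measurable_T
  have := D.measurable_Y₀
  have := D.measurable_Y₁
  have := D.measurable_X
  unfold PotentialOutcomes.W
  fun_prop

namespace FollowsModel

theorem map_given_false (h : FollowsModel M D P θ η) [IsProbabilityMeasure P] :
    (D.given P false).map (fun ω => (D.X ω, D.Y₀ ω)) =
      (D.given P false).map D.X ⊗ₘ kernel₀ M η := by
  rw [h.law_Y₀, prod_withDensity_eq_compProd h.isDensity.f₀.measurable]

theorem map_given_true (h : FollowsModel M D P θ η) [IsProbabilityMeasure P] :
    (D.given P true).map (fun ω => (D.X ω, D.Y₁ ω)) =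
      (D.given P true).map D.X ⊗ₘ kernel₁ M η := by
  rw [h.law_Y₁, prod_withDensity_eq_compProd h.isDensity.f₁.measurable]

theorem map_X (h : FollowsModel M D P θ η) : P.map D.X = covLaw M η := h.law_X

theorem ae_π_bounds (h : FollowsModel M D P θ η)
    (hπ : ∀ᵐ p ∂(M.ν.prod M.μ₀), 0 < M.π θ p.2 p.1.1 ∧ M.π θ p.2 p.1.1 ≤ 1 - ε) :
    ∀ᵐ ω ∂P, 0 < M.π θ (D.Y₀ ω) (D.X ω).1 ∧ M.π θ (D.Y₀ ω) (D.X ω).1 ≤ 1 - ε :=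
  ae_of_ae_map (D.measurable_X.prodMk D.measurable_Y₀).aemeasurable (h.ac_Y₀.ae_le hπ)

/-- Events of the form (X, Y₀) ∈ A belong to the σ-algebra on which the propensity is conditioned.
Over such an event 1 - T and 1 - π have the same integral, and the integral of 1 - T is the mass of
the event inside T = 0. -/
theorem map_restrict_false (h : FollowsModel M D P θ η) [IsProbabilityMeasure P] (hε : 0 < ε)
    (hπ : ∀ᵐ p ∂(M.ν.prod M.μ₀), 0 < M.π θ p.2 p.1.1 ∧ M.π θ p.2 p.1.1 ≤ 1 - ε) :
    (P.restrict (D.T ⁻¹' {false})).map (fun ω => (D.X ω, D.Y₀ ω)) =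
      (P.map (fun ω => (D.X ω, D.Y₀ ω))).withDensity
        (fun p => ENNReal.ofReal (1 - M.π θ p.2 p.1.1)) := by
  have hZ : Measurable fun ω => (D.X ω, D.Y₀ ω) := D.measurable_X.prodMk D.measurable_Y₀
  have hm : D.sigmaY₀X ≤ ‹MeasurableSpace Ω› := (D.measurable_Y₀.prodMk D.measurable_X).comap_le
  have hT : Integrable (fun ω => ind (D.T ω)) P := by
    refine Integrable.of_bound ((measurable_of_countable ind).comp
      D.measurable_T).aestronglyMeasurable 1 (.of_forall fun ω => ?_)
    cases D.T ω <;> simp [ind]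
  have hp := h.propensity
  have hπi : Integrable (fun ω => M.π θ (D.Y₀ ω) (D.X ω).1) P := integrable_condExp.congr hp
  refine Measure.ext fun A hA => ?_
  rw [Measure.map_apply hZ hA, Measure.restrict_apply (hZ hA), withDensity_apply _ hA,
    setLIntegral_map hA (measurable_one_sub_π M θ).ennreal_ofReal hZ]
  have hA' : MeasurableSet[D.sigmaY₀X] ((fun ω => (D.X ω, D.Y₀ ω)) ⁻¹' A) :=
    ⟨Prod.swap ⁻¹' A, measurable_swap hA, rfl⟩
  have e1 := setIntegral_condExp hm hT hA'
  rw [integral_congr_ae (ae_restrict_of_ae hp)] at e1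
  rw [← ofReal_integral_eq_lintegral_ofReal
    (f := fun ω => 1 - M.π θ (D.Y₀ ω) (D.X ω).1) ((integrable_const 1).sub hπi).integrableOn
    (ae_restrict_of_ae ((h.ae_π_bounds hπ).mono fun ω hω => sub_nonneg.2 (by linarith [hω.2])))]
  have e2 : ∫ ω in (fun ω => (D.X ω, D.Y₀ ω)) ⁻¹' A, (1 - M.π θ (D.Y₀ ω) (D.X ω).1) ∂P =
      ∫ ω in (fun ω => (D.X ω, D.Y₀ ω)) ⁻¹' A, (1 - ind (D.T ω)) ∂P := by
    rw [integral_sub (integrable_const 1) hπi.integrableOn,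
      integral_sub (integrable_const 1) hT.integrableOn, e1]
  rw [e2]
  have e3 : (fun ω => 1 - ind (D.T ω)) = (D.T ⁻¹' {false}).indicator 1 := by
    ext ω
    cases hω : D.T ω <;> simp [ind, Set.indicator, hω]
  rw [e3, integral_indicator_one (measurableSet_treatment D false), measureReal_def,
    ENNReal.ofReal_toReal (measure_ne_top _ _),
    Measure.restrict_apply (measurableSet_treatment D false), Set.inter_comm]

/-- Since 1 - π is bounded below by ε, the density in `map_restrict_false` can be inverted: the law
of Y₀ for everyone is recovered from the untreated. -/
theorem map_Y₀ (h : FollowsModel M D P θ η) [IsProbabilityMeasure P] (hε : 0 < ε)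
    (hπ : ∀ᵐ p ∂(M.ν.prod M.μ₀), 0 < M.π θ p.2 p.1.1 ∧ M.π θ p.2 p.1.1 ≤ 1 - ε) :
    P.map (fun ω => (D.X ω, D.Y₀ ω)) =
      ((P.restrict (D.T ⁻¹' {false})).map D.X ⊗ₘ kernel₀ M η).withDensity
        (fun p => ENNReal.ofReal (1 - M.π θ p.2 p.1.1)⁻¹) := by
  rw [← map_restrict_eq_compProd h.map_given_false, h.map_restrict_false hε hπ]
  have hb := h.ac_Y₀.ae_le hπ
  have hb' : ∀ᵐ p ∂((P.map (fun ω => (D.X ω, D.Y₀ ω))).withDensity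
        (fun p => ENNReal.ofReal (1 - M.π θ p.2 p.1.1))),
        0 < M.π θ p.2 p.1.1 ∧ M.π θ p.2 p.1.1 ≤ 1 - ε :=
    (withDensity_absolutelyContinuous _ _).ae_le hb
  rw [withDensity_congr_ae (g := fun p => (ENNReal.ofReal (1 - M.π θ p.2 p.1.1))⁻¹)]
  · refine (withDensity_inv_same (measurable_one_sub_π M θ).ennreal_ofReal ?_ (by simp)).symm
    filter_upwards [hb] with p hp
    simp only [ne_eq, ENNReal.ofReal_eq_zero, not_le]; linarith
  · filter_upwards [hb'] with p hp
    exact ENNReal.ofReal_inv_of_pos (by linarith)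

/-- Integrating y out of `map_Y₀` replaces the weight (1-π)⁻¹ by its `kernel₀`-mean, which is D.
This is the origin of pr(T = 0 ∣ x) = 1/D(x). -/
theorem map_X_eq_withDensity (h : FollowsModel M D P θ η) [IsProbabilityMeasure P] (hε : 0 < ε)
    (hπ : ∀ᵐ p ∂(M.ν.prod M.μ₀), 0 < M.π θ p.2 p.1.1 ∧ M.π θ p.2 p.1.1 ≤ 1 - ε) :
    covLaw M η = ((P.restrict (D.T ⁻¹' {false})).map D.X).withDensity
        (fun x => ENNReal.ofReal (M.oddsIntegral θ η x)) := by
  have hZ : Measurable fun ω => (D.X ω, D.Y₀ ω) := D.measurable_X.prodMk D.measurable_Y₀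
  have hreg := ae_isRegularPoint h.isDensity hε hπ
  have hac : (P.restrict (D.T ⁻¹' {false})).map D.X ≪ M.ν :=
    ((Measure.absolutelyContinuous_of_le Measure.restrict_le_self).map D.measurable_X).trans
      (h.map_X ▸ covLaw_absolutelyContinuous)
  refine Measure.ext_of_lintegral _ fun F hF => ?_
  have hF' : Measurable fun p : (𝒰 × 𝒵) × ℝ => F p.1 := hF.comp measurable_fst
  have hinv := (measurable_one_sub_π M θ).inv.ennreal_ofReal
  rw [← h.map_X, lintegral_map hF D.measurable_X,
    ← lintegral_map (f := fun p : (𝒰 × 𝒵) × ℝ => F p.1) hF' hZ, h.map_Y₀ hε hπ,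
    lintegral_withDensity_eq_lintegral_mul _ (by exact hinv) hF',
    Measure.lintegral_compProd (by exact hinv.mul hF'),
    lintegral_withDensity_eq_lintegral_mul _ (measurable_oddsIntegral h.isDensity).ennreal_ofReal
      hF]
  refine lintegral_congr_ae ?_
  filter_upwards [hac.ae_le hreg] with x hx
  simp only [Pi.mul_apply]
  rw [lintegral_mul_const _ (measurable_inv_section M θ x).ennreal_ofReal,
    oddsIntegral_eq h.isDensity, ofReal_integral_eq_lintegral_ofReal (hx.integrable_inv hε)]
  filter_upwards [hx.inv_bounds hε] with y hy
  simp only [Pi.zero_apply]; linarith [hy.1]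

theorem map_X_restrict_false (h : FollowsModel M D P θ η) [IsProbabilityMeasure P] (hε : 0 < ε)
    (hπ : ∀ᵐ p ∂(M.ν.prod M.μ₀), 0 < M.π θ p.2 p.1.1 ∧ M.π θ p.2 p.1.1 ≤ 1 - ε) :
    (P.restrict (D.T ⁻¹' {false})).map D.X = covLaw₀ M θ η := by
  have hreg := ae_isRegularPoint h.isDensity hε hπ
  have hac : (P.restrict (D.T ⁻¹' {false})).map D.X ≪ M.ν :=
    ((Measure.absolutelyContinuous_of_le Measure.restrict_le_self).map D.measurable_X).trans
      (h.map_X ▸ covLaw_absolutelyContinuous)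
  rw [covLaw₀, withDensity_congr_ae
    (g := fun x => (ENNReal.ofReal (M.oddsIntegral θ η x))⁻¹), h.map_X_eq_withDensity hε hπ]
  · refine (withDensity_inv_same (measurable_oddsIntegral h.isDensity).ennreal_ofReal ?_
      (by simp)).symm
    filter_upwards [hac.ae_le hreg] with x hx
    simp only [ne_eq, ENNReal.ofReal_eq_zero, not_le]; linarith [hx.one_lt_odds]
  · filter_upwards [covLaw_absolutelyContinuous.ae_le hreg] with x hx
    exact ENNReal.ofReal_inv_of_pos (by linarith [hx.one_lt_odds])

/-- The two arms add up to the law of X, and the weights 1/D and 1 - 1/D add up to one; the part on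
T = 0 is finite, so it cancels. -/
theorem map_X_restrict_true (h : FollowsModel M D P θ η) [IsProbabilityMeasure P] (hε : 0 < ε)
    (hπ : ∀ᵐ p ∂(M.ν.prod M.μ₀), 0 < M.π θ p.2 p.1.1 ∧ M.π θ p.2 p.1.1 ≤ 1 - ε) :
    (P.restrict (D.T ⁻¹' {true})).map D.X = covLaw₁ M θ η := by
  have hreg := ae_isRegularPoint h.isDensity hε hπ
  have h0 := h.map_X_restrict_false hε hπ
  have : IsFiniteMeasure (covLaw₀ M θ η) := by rw [← h0]; infer_instance
  rw [← Measure.add_right_inj (covLaw₀ M θ η)]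
  nth_rw 1 [← h0]
  rw [← Measure.map_add _ _ D.measurable_X, D.restrict_add_restrict, h.map_X, covLaw₀, covLaw₁,
    ← withDensity_add_left (measurable_inv_odds h.isDensity)]
  rw [withDensity_congr_ae (g := 1), withDensity_one]
  filter_upwards [ae_inv_odds_pos hreg] with x hx
  simp only [Pi.add_apply, Pi.one_apply]
  rw [← ENNReal.ofReal_add hx.1.le hx.2.le]
  simp

/-- The law of the observed data is given by the likelihood. -/
theorem map_W (h : FollowsModel M D P θ η) [IsProbabilityMeasure P] (hε : 0 < ε)
    (hπ : ∀ᵐ p ∂(M.ν.prod M.μ₀), 0 < M.π θ p.2 p.1.1 ∧ M.π θ p.2 p.1.1 ≤ 1 - ε) :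
    P.map D.W = obsLaw M θ η := by
  have hW : Measurable D.W := D.measurable_W
  have e0 : (P.restrict (D.T ⁻¹' {false})).map D.W =
      ((P.restrict (D.T ⁻¹' {false})).map (fun ω => (D.X ω, D.Y₀ ω))).map (mkObs false) := by
    rw [Measure.map_map (measurable_mkObs _) (D.measurable_X.prodMk D.measurable_Y₀)]
    refine Measure.map_congr ((ae_restrict_iff' (measurableSet_treatment D false)).2
      (.of_forall fun ω hω => ?_))
    have hω : D.T ω = false := hω
    simp [PotentialOutcomes.W, mkObs, hω, ind]
  have e1 : (P.restrict (D.T ⁻¹' {true})).map D.W =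
      ((P.restrict (D.T ⁻¹' {true})).map (fun ω => (D.X ω, D.Y₁ ω))).map (mkObs true) := by
    rw [Measure.map_map (measurable_mkObs _) (D.measurable_X.prodMk D.measurable_Y₁)]
    refine Measure.map_congr ((ae_restrict_iff' (measurableSet_treatment D true)).2
      (.of_forall fun ω hω => ?_))
    have hω : D.T ω = true := hω
    simp [PotentialOutcomes.W, mkObs, hω, ind]
  rw [obsLaw, ← h.map_X_restrict_false hε hπ, ← h.map_X_restrict_true hε hπ,
    ← map_restrict_eq_compProd h.map_given_false, ← map_restrict_eq_compProd h.map_given_true,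
    ← e0, ← e1, ← Measure.map_add _ _ hW, D.restrict_add_restrict]

/-- The conditional law of `Y₀` given the covariates. -/
theorem map_Y₀_eq_compProd (h : FollowsModel M D P θ η) [IsProbabilityMeasure P] (hε : 0 < ε)
    (hπ : ∀ᵐ p ∂(M.ν.prod M.μ₀), 0 < M.π θ p.2 p.1.1 ∧ M.π θ p.2 p.1.1 ≤ 1 - ε) :
    P.map (fun ω => (D.X ω, D.Y₀ ω)) = P.map D.X ⊗ₘ condKernel M.μ₀ (fun x y =>
      (M.oddsIntegral θ η x)⁻¹ * ((1 - M.π θ y x.1)⁻¹ * η.f₀ x y)) := by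
  have hreg := ae_isRegularPoint h.isDensity hε hπ
  have hD := measurable_oddsIntegral (θ := θ) h.isDensity
  have hinv := (measurable_one_sub_π M θ).inv
  have hm : Measurable fun p : (𝒰 × 𝒵) × ℝ =>
      (M.oddsIntegral θ η p.1)⁻¹ * ((1 - M.π θ p.2 p.1.1)⁻¹ * η.f₀ p.1 p.2) :=
    (hD.comp measurable_fst).inv.mul (hinv.mul h.isDensity.f₀.measurable)
  rw [h.map_Y₀ hε hπ, h.map_X_restrict_false hε hπ, h.map_X]
  refine Measure.ext_of_lintegral _ fun F hF => ?_
  have hFx : ∀ x, Measurable fun y => F (x, y) := fun x =>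
    hF.comp (measurable_const.prodMk measurable_id)
  have hFi : Measurable fun p : (𝒰 × 𝒵) × ℝ =>
      ENNReal.ofReal (1 - M.π θ p.2 p.1.1)⁻¹ * F p := hinv.ennreal_ofReal.mul hF
  rw [lintegral_withDensity_eq_lintegral_mul _ (by exact hinv.ennreal_ofReal) hF,
    Measure.lintegral_compProd (by exact hFi), Measure.lintegral_compProd hF, covLaw₀,
    lintegral_withDensity_eq_lintegral_mul _ (measurable_inv_odds h.isDensity)
      (by exact hFi.lintegral_kernel_prod_right')]
  refine lintegral_congr_ae ?_
  filter_upwards [covLaw_absolutelyContinuous.ae_le hreg] with x hx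
  simp only [Pi.mul_apply]
  rw [lintegral_condKernel hm x (hFx x), lintegral_condKernel h.isDensity.f₀.measurable x
    (u := fun y => ENNReal.ofReal (1 - M.π θ y x.1)⁻¹ * F (x, y))
    ((measurable_inv_section M θ x).ennreal_ofReal.mul (hFx x)),
    ← lintegral_const_mul' _ _ ENNReal.ofReal_ne_top]
  have hac : ∀ᵐ y ∂M.μ₀, ENNReal.ofReal (η.f₀ x y) ≠ 0 →
      1 < (1 - M.π θ y x.1)⁻¹ ∧ (1 - M.π θ y x.1)⁻¹ ≤ ε⁻¹ := by
    have := hx.inv_bounds hε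
    rwa [condKernel_apply h.isDensity.f₀.measurable,
      ae_withDensity_iff (measurable_section h.isDensity.f₀.measurable x).ennreal_ofReal] at this
  refine lintegral_congr_ae ?_
  filter_upwards [hac] with y hy
  -- In the fibre the bounds on π are available only where f₀ is positive; elsewhere both integrands
  -- vanish, whatever the sign of 1 - π.
  by_cases h0 : ENNReal.ofReal (η.f₀ x y) = 0
  · have h0' : η.f₀ x y = 0 := le_antisymm (ENNReal.ofReal_eq_zero.1 h0) (h.isDensity.f₀.nonneg x y)
    simp [h0']
  · have hy := hy h0
    rw [ENNReal.ofReal_mul (inv_nonneg.2 (by linarith [hx.one_lt_odds])),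
      ENNReal.ofReal_mul (by linarith)]
    ring

/-- The probability of T = 1 inside an event X ∈ A is the mass of A under `covLaw₁`, whose density
relative to the law of X is the claimed function. -/
theorem w_ae_eq (h : FollowsModel M D P θ η) [IsProbabilityMeasure P] (hε : 0 < ε)
    (hπ : ∀ᵐ p ∂(M.ν.prod M.μ₀), 0 < M.π θ p.2 p.1.1 ∧ M.π θ p.2 p.1.1 ≤ 1 - ε) :
    D.w P =ᵐ[P] fun ω => 1 - (M.oddsIntegral θ η (D.X ω))⁻¹ := by
  have hreg := ae_isRegularPoint h.isDensity hε hπ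
  have hcov := isProbabilityMeasure_covLaw h.isDensity
  have hX := D.measurable_X
  have hT : Integrable (fun ω => ind (D.T ω)) P := by
    refine Integrable.of_bound ((measurable_of_countable ind).comp
      D.measurable_T).aestronglyMeasurable 1 (.of_forall fun ω => ?_)
    cases D.T ω <;> simp [ind]
  have hm : Measurable fun x => 1 - (M.oddsIntegral θ η x)⁻¹ :=
    measurable_const.sub (measurable_oddsIntegral h.isDensity).inv
  have hi : Integrable (fun x => 1 - (M.oddsIntegral θ η x)⁻¹) (covLaw M η) := by
    refine Integrable.of_bound hm.aestronglyMeasurable 1 ?_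
    filter_upwards [ae_inv_odds_pos hreg] with x hx
    rw [Real.norm_of_nonneg hx.2.le]; linarith
  symm
  refine ae_eq_condExp_of_forall_setIntegral_eq hX.comap_le hT
    (fun s _ _ => ?_) ?_
    (hm.stronglyMeasurable.comp_measurable (comap_measurable D.X)).aestronglyMeasurable
  · rw [← h.map_X] at hi
    exact (hi.comp_measurable hX).integrableOn
  rintro _ ⟨A, hA, rfl⟩ _
  rw [← setIntegral_map (f := fun x => 1 - (M.oddsIntegral θ η x)⁻¹) hA
    hm.aestronglyMeasurable hX.aemeasurable, h.map_X]
  have e3 : (fun ω => ind (D.T ω)) = (D.T ⁻¹' {true}).indicator 1 := by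
    ext ω
    cases hω : D.T ω <;> simp [ind, Set.indicator, hω]
  have h1 : P.restrict (D.T ⁻¹' {true}) (D.X ⁻¹' A) = covLaw₁ M θ η A := by
    rw [← h.map_X_restrict_true hε hπ, Measure.map_apply hX hA]
  rw [e3, integral_indicator_one (measurableSet_treatment D true), measureReal_def,
    Measure.restrict_apply (measurableSet_treatment D true), ← Measure.restrict_apply' (hX hA),
    Measure.restrict_apply (measurableSet_treatment D true), Set.inter_comm,
    ← Measure.restrict_apply (hX hA), h1, covLaw₁, withDensity_apply _ hA,
    ← ofReal_integral_eq_lintegral_ofReal hi.integrableOn, ENNReal.toReal_ofReal]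
  · exact setIntegral_nonneg_of_ae (ae_inv_odds_pos hreg |>.mono fun x hx => hx.2.le)
  · exact ae_restrict_of_ae (ae_inv_odds_pos hreg |>.mono fun x hx => hx.2.le)

end FollowsModel

end ATT

namespace ATT

variable {d : ℕ} {𝒰 𝒵 : Type*} [MeasurableSpace 𝒰] [MeasurableSpace 𝒵]

/-! ### Scores in the directions of the nuisance parts -/

section Scores

variable (M : Model d 𝒰 𝒵) (θ : EuclideanSpace ℝ (Fin d)) (η : Nuisance 𝒰 𝒵)
variable {E : Type*} [NormedAddCommGroup E] [NormedSpace ℝ E]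

/-- `E₀{c(y₀, x) ∣ x}`, as an integral with respect to the law of `Y₀` given `X = x, T = 0`. -/
def outcomeMean (c : ℝ → 𝒰 × 𝒵 → E) (x : 𝒰 × 𝒵) : E :=
  (M.oddsIntegral θ η x)⁻¹ • ∫ y, (1 - M.π θ y x.1)⁻¹ • c y x ∂kernel₀ M η x

/-- The score of the likelihood when `f₀` is perturbed in the direction `c`. -/
def score₀ (c : ℝ → 𝒰 × 𝒵 → E) : Obs 𝒰 𝒵 → E
  | (t, y, x) => if t then (M.oddsIntegral θ η x - 1)⁻¹ • outcomeMean M θ η c x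
      else c y x - outcomeMean M θ η c x

/-- The score of the likelihood when `f₁` is perturbed in the direction `b`. -/
def score₁ (b : ℝ → 𝒰 × 𝒵 → E) : Obs 𝒰 𝒵 → E
  | (t, y, x) => if t then b y x else 0

/-- The score of the likelihood when `g` is perturbed in the direction `a`. -/
def score₂ (a : 𝒰 × 𝒵 → E) : Obs 𝒰 𝒵 → E
  | (_, _, x) => a x

/-- `(t - π) / (1 - π) g(x)`, with the value `g(x)` for `t = 1`. -/
def residual (g : 𝒰 × 𝒵 → E) : Obs 𝒰 𝒵 → E
  | (t, y, x) => if t then g x else (1 - (1 - M.π θ y x.1)⁻¹) • g x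

/-- `E{h ∣ x, 0}`. -/
def armMean₀ (h : Obs 𝒰 𝒵 → E) (x : 𝒰 × 𝒵) : E := ∫ y, h (false, y, x) ∂kernel₀ M η x

/-- `E{h ∣ x, 1}`. -/
def armMean₁ (h : Obs 𝒰 𝒵 → E) (x : 𝒰 × 𝒵) : E := ∫ y, h (true, y, x) ∂kernel₁ M η x

/-- The component of `h(0, ·, x)` in the direction of scores for `f₀`. -/
def defect₀ (h : Obs 𝒰 𝒵 → E) (y : ℝ) (x : 𝒰 × 𝒵) : E :=
  h (false, y, x) - armMean₁ M η h x + (1 - M.π θ y x.1)⁻¹ •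
    (M.oddsIntegral θ η x)⁻¹ • (armMean₁ M η h x - armMean₀ M η h x)

/-- The component of `h(1, ·, x)` in the direction of scores for `f₁`. -/
def defect₁ (h : Obs 𝒰 𝒵 → E) (y : ℝ) (x : 𝒰 × 𝒵) : E := h (true, y, x) - armMean₁ M η h x

/-- A multiple of `E{h ∣ x}`. -/
def defect₂ (h : Obs 𝒰 𝒵 → E) (x : 𝒰 × 𝒵) : E :=
  armMean₀ M η h x + (M.oddsIntegral θ η x - 1) • armMean₁ M η h x

/-- A multiple of the conditional expectation given `x` of `(t - π) / (1 - π) h`. -/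
def defect₃ (h : Obs 𝒰 𝒵 → E) (x : 𝒰 × 𝒵) : E :=
  ∫ y, (1 - (1 - M.π θ y x.1)⁻¹) • h (false, y, x) ∂kernel₀ M η x +
    (M.oddsIntegral θ η x - 1) • armMean₁ M η h x

end Scores

variable {M : Model d 𝒰 𝒵} {θ : EuclideanSpace ℝ (Fin d)} {η : Nuisance 𝒰 𝒵} {ε : ℝ}
variable {E : Type*} [NormedAddCommGroup E] [InnerProductSpace ℝ E]

theorem integrable_inner_of_bound {α : Type*} [MeasurableSpace α] {μ : Measure α} {c q : α → E}
    {K : ℝ} (hc : AEStronglyMeasurable c μ) (hK : ∀ᵐ x ∂μ, ‖c x‖ ≤ K) (hq : Integrable q μ) :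
    Integrable (fun x => inner ℝ (c x) (q x)) μ := by
  refine (hq.norm.const_mul K).mono' (hc.inner hq.aestronglyMeasurable) ?_
  filter_upwards [hK] with x hx
  exact (norm_inner_le_norm _ _).trans (mul_le_mul_of_nonneg_right hx (norm_nonneg _))

theorem integral_inner_const [CompleteSpace E] {α : Type*} [MeasurableSpace α] {μ : Measure α}
    {c : α → E} (hc : Integrable c μ) (v : E) :
    ∫ x, inner ℝ (c x) v ∂μ = inner ℝ (∫ x, c x ∂μ) v := by
  simp_rw [real_inner_comm v]
  exact integral_inner hc v

theorem integral_inv_smul_const [CompleteSpace E] (hη : η.IsDensity M) (x : 𝒰 × 𝒵) (v : E) :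
    ∫ y, (1 - M.π θ y x.1)⁻¹ • v ∂kernel₀ M η x = M.oddsIntegral θ η x • v := by
  rw [integral_smul_const, oddsIntegral_eq hη]

/-! ### Pairings with scores and residuals at a fixed covariate value -/

namespace IsRegularPoint

variable {x : 𝒰 × 𝒵}

theorem odds_pos (hx : IsRegularPoint M θ η ε x) : 0 < M.oddsIntegral θ η x := by
  linarith [hx.one_lt_odds]

theorem odds_sub_one_pos (hx : IsRegularPoint M θ η ε x) : 0 < M.oddsIntegral θ η x - 1 := by
  linarith [hx.one_lt_odds]

theorem integrable_inv_smul (hx : IsRegularPoint M θ η ε x) {F : Type*} [NormedAddCommGroup F]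
    [NormedSpace ℝ F] (hε : 0 < ε) {q : ℝ → F} (hq : Integrable q (kernel₀ M η x)) :
    Integrable (fun y => (1 - M.π θ y x.1)⁻¹ • q y) (kernel₀ M η x) := by
  refine (hq.norm.const_mul ε⁻¹).mono'
    ((measurable_inv_section M θ x).aestronglyMeasurable.smul hq.aestronglyMeasurable) ?_
  filter_upwards [hx.inv_bounds hε] with y hy
  rw [norm_smul, Real.norm_of_nonneg (by linarith)]
  exact mul_le_mul_of_nonneg_right hy.2 (norm_nonneg _)

variable {h : Obs 𝒰 𝒵 → E}

theorem integrable_defect₀ (hx : IsRegularPoint M θ η ε x) (hε : 0 < ε)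
    (hq : Integrable (fun y => h (false, y, x)) (kernel₀ M η x)) :
    Integrable (fun y => defect₀ M θ η h y x) (kernel₀ M η x) := by
  have := hx.prob₀
  exact (hq.sub (integrable_const _)).add (hx.integrable_inv_smul hε (integrable_const _))

theorem integral_defect₀ (hx : IsRegularPoint M θ η ε x) [CompleteSpace E]
    (hη : η.IsDensity M) (hε : 0 < ε)
    (hq : Integrable (fun y => h (false, y, x)) (kernel₀ M η x)) :
    ∫ y, defect₀ M θ η h y x ∂kernel₀ M η x = 0 := by
  have := hx.prob₀
  have i1 : Integrable (fun y => h (false, y, x) - armMean₁ M η h x) (kernel₀ M η x) :=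
    hq.sub (integrable_const _)
  unfold defect₀
  rw [integral_add i1 (hx.integrable_inv_smul hε (integrable_const _)),
    integral_sub hq (integrable_const _), integral_inv_smul_const hη, smul_smul,
    mul_inv_cancel₀ hx.odds_pos.ne']
  simp [armMean₀]

/-- With e the `outcomeMean` of c, the two arms contribute -⟨e, armMean₀⟩/D and ⟨e, armMean₁⟩/D,
because (1 - 1/D)/(D - 1) = 1/D. As e is itself a weighted mean of c, these terms can be moved onto
the other factor, where they form the last summand of `defect₀`. Subtracting `armMean₁` there costs
nothing, since c has mean zero, and makes the defect have mean zero too. -/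
theorem condMean_inner_score₀ (hx : IsRegularPoint M θ η ε x) [CompleteSpace E] (hε : 0 < ε)
    (hq : Integrable (fun y => h (false, y, x)) (kernel₀ M η x))
    (hp : Integrable (fun y => h (true, y, x)) (kernel₁ M η x))
    {c : ℝ → 𝒰 × 𝒵 → E} {K : ℝ} (hc : StronglyMeasurable fun y => c y x)
    (hK : ∀ y, ‖c y x‖ ≤ K) (h0 : ∫ y, c y x ∂kernel₀ M η x = 0) :
    condMean M θ η (fun o => inner ℝ (score₀ M θ η c o) (h o)) x =
      (M.oddsIntegral θ η x)⁻¹ * ∫ y, inner ℝ (c y x) (defect₀ M θ η h y x) ∂kernel₀ M η x := by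
  have := hx.prob₀
  have := hx.prob₁
  have hD := hx.odds_pos
  have hD1 := hx.odds_sub_one_pos
  have hci : Integrable (fun y => c y x) (kernel₀ M η x) :=
    .of_bound hc.aestronglyMeasurable K (.of_forall hK)
  have hcq := integrable_inner_of_bound (μ := kernel₀ M η x) hc.aestronglyMeasurable
    (.of_forall hK) hq
  set v := armMean₁ M η h x - armMean₀ M η h x with hv
  set e := outcomeMean M θ η c x with he
  have e1 : ∫ y, inner ℝ (c y x) ((1 - M.π θ y x.1)⁻¹ • (M.oddsIntegral θ η x)⁻¹ • v)
      ∂kernel₀ M η x = inner ℝ e v := by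
    have : ∀ y, inner ℝ (c y x) ((1 - M.π θ y x.1)⁻¹ • (M.oddsIntegral θ η x)⁻¹ • v) =
        inner ℝ ((1 - M.π θ y x.1)⁻¹ • c y x) ((M.oddsIntegral θ η x)⁻¹ • v) := fun y => by
      rw [inner_smul_right, real_inner_smul_left]
    simp_rw [this]
    rw [integral_inner_const (hx.integrable_inv_smul hε hci), he, outcomeMean, inner_smul_right,
      real_inner_smul_left]
  have e2 : ∫ y, inner ℝ (c y x) (defect₀ M θ η h y x) ∂kernel₀ M η x =
      ∫ y, inner ℝ (c y x) (h (false, y, x)) ∂kernel₀ M η x + inner ℝ e v := by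
    have i2 := integrable_inner_of_bound (μ := kernel₀ M η x) hc.aestronglyMeasurable
      (.of_forall hK) (integrable_const (armMean₁ M η h x))
    have i3 := integrable_inner_of_bound (μ := kernel₀ M η x) hc.aestronglyMeasurable
      (.of_forall hK) (hx.integrable_inv_smul hε (integrable_const ((M.oddsIntegral θ η x)⁻¹ • v)))
    have i4 : Integrable (fun y => inner ℝ (c y x) (h (false, y, x)) -
        inner ℝ (c y x) (armMean₁ M η h x)) (kernel₀ M η x) := hcq.sub i2
    simp_rw [defect₀, ← hv, inner_add_right, inner_sub_right]
    rw [integral_add i4 i3, integral_sub hcq i2, integral_inner_const hci, h0, e1]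
    simp
  have e3 : ∫ y, inner ℝ (c y x - e) (h (false, y, x)) ∂kernel₀ M η x =
      ∫ y, inner ℝ (c y x) (h (false, y, x)) ∂kernel₀ M η x - inner ℝ e (armMean₀ M η h x) := by
    simp_rw [inner_sub_left]
    rw [integral_sub hcq (hq.const_inner _), integral_inner hq]
    rfl
  have e4 : ∫ y, inner ℝ ((M.oddsIntegral θ η x - 1)⁻¹ • e) (h (true, y, x)) ∂kernel₁ M η x =
      (M.oddsIntegral θ η x - 1)⁻¹ * inner ℝ e (armMean₁ M η h x) := by
    rw [integral_inner hp, real_inner_smul_left]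
    rfl
  simp only [condMean, score₀, Bool.false_eq_true, if_false, if_true, smul_eq_mul]
  rw [← he, e2, e3, e4, hv, inner_sub_right]
  field_simp
  ring

theorem condMean_inner_score₁ (hx : IsRegularPoint M θ η ε x) [CompleteSpace E]
    (hp : Integrable (fun y => h (true, y, x)) (kernel₁ M η x))
    {b : ℝ → 𝒰 × 𝒵 → E} {K : ℝ} (hb : StronglyMeasurable fun y => b y x)
    (hK : ∀ y, ‖b y x‖ ≤ K) (h0 : ∫ y, b y x ∂kernel₁ M η x = 0) :
    condMean M θ η (fun o => inner ℝ (score₁ b o) (h o)) x =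
      (1 - (M.oddsIntegral θ η x)⁻¹) *
        ∫ y, inner ℝ (b y x) (defect₁ M η h y x) ∂kernel₁ M η x := by
  have := hx.prob₁
  have hbi : Integrable (fun y => b y x) (kernel₁ M η x) :=
    .of_bound hb.aestronglyMeasurable K (.of_forall hK)
  simp only [condMean, score₁, Bool.false_eq_true, if_false, if_true, smul_eq_mul, inner_zero_left,
    integral_zero, mul_zero, zero_add, defect₁, inner_sub_right]
  rw [integral_sub (integrable_inner_of_bound hb.aestronglyMeasurable (.of_forall hK) hp)
    (integrable_inner_of_bound hb.aestronglyMeasurable (.of_forall hK) (integrable_const _)),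
    integral_inner_const hbi, h0]
  simp

theorem condMean_inner_score₂ (hx : IsRegularPoint M θ η ε x) [CompleteSpace E]
    (hq : Integrable (fun y => h (false, y, x)) (kernel₀ M η x))
    (hp : Integrable (fun y => h (true, y, x)) (kernel₁ M η x)) (a : 𝒰 × 𝒵 → E) :
    condMean M θ η (fun o => inner ℝ (score₂ a o) (h o)) x =
      (M.oddsIntegral θ η x)⁻¹ * inner ℝ (a x) (defect₂ M θ η h x) := by
  have hD := hx.odds_pos
  simp only [condMean, score₂, smul_eq_mul]
  rw [integral_inner hq, integral_inner hp]
  change _ * inner ℝ _ (armMean₀ M η h x) + _ * inner ℝ _ (armMean₁ M η h x) = _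
  rw [defect₂, inner_add_right, inner_smul_right]
  field_simp

theorem condMean_inner_residual (hx : IsRegularPoint M θ η ε x) [CompleteSpace E] (hε : 0 < ε)
    (hq : Integrable (fun y => h (false, y, x)) (kernel₀ M η x))
    (hp : Integrable (fun y => h (true, y, x)) (kernel₁ M η x)) (g : 𝒰 × 𝒵 → E) :
    condMean M θ η (fun o => inner ℝ (residual M θ g o) (h o)) x =
      (M.oddsIntegral θ η x)⁻¹ * inner ℝ (g x) (defect₃ M θ η h x) := by
  have hD := hx.odds_pos
  have hi : Integrable (fun y => (1 - (1 - M.π θ y x.1)⁻¹) • h (false, y, x)) (kernel₀ M η x) := by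
    simp_rw [sub_smul, one_smul]
    exact hq.sub (hx.integrable_inv_smul hε hq)
  have e : ∀ y, inner ℝ ((1 - (1 - M.π θ y x.1)⁻¹) • g x) (h (false, y, x)) =
      inner ℝ (g x) ((1 - (1 - M.π θ y x.1)⁻¹) • h (false, y, x)) := fun y => by
    rw [real_inner_smul_left, inner_smul_right]
  simp only [condMean, residual, Bool.false_eq_true, if_false, if_true, smul_eq_mul, e]
  rw [integral_inner hi, integral_inner hp, defect₃, inner_add_right]
  change _ + _ * inner ℝ _ (armMean₁ M η h x) = _
  rw [inner_smul_right]
  field_simp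

end IsRegularPoint

end ATT

namespace ATT

variable {d : ℕ} {𝒰 𝒵 : Type*} [MeasurableSpace 𝒰] [MeasurableSpace 𝒵]
variable {M : Model d 𝒰 𝒵} {θ : EuclideanSpace ℝ (Fin d)} {η : Nuisance 𝒰 𝒵} {ε : ℝ}
variable {F : Type*} [NormedAddCommGroup F]
variable {E : Type*} [NormedAddCommGroup E] [InnerProductSpace ℝ E]

/-! ### Bounded directions -/

/-- A bounded function of `(y, x)` with conditional mean zero given `x`. -/
structure IsDirection {𝒳 : Type*} [MeasurableSpace 𝒳] (ν : Measure 𝒳) (κ : Kernel 𝒳 ℝ)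
    (c : ℝ → 𝒳 → E) : Prop where
  stronglyMeasurable : StronglyMeasurable fun p : 𝒳 × ℝ => c p.2 p.1
  bounded : ∃ K, ∀ y x, ‖c y x‖ ≤ K
  integral_eq_zero : ∀ᵐ x ∂ν, ∫ y, c y x ∂κ x = 0

theorem stronglyMeasurable_section {𝒳 : Type*} [MeasurableSpace 𝒳] {c : ℝ → 𝒳 → F}
    (hc : StronglyMeasurable fun p : 𝒳 × ℝ => c p.2 p.1) (x : 𝒳) :
    StronglyMeasurable fun y => c y x :=
  hc.comp_measurable (measurable_const.prodMk measurable_id)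

theorem stronglyMeasurable_of_arms {h : Obs 𝒰 𝒵 → F}
    (h0 : StronglyMeasurable fun p : (𝒰 × 𝒵) × ℝ => h (false, p.2, p.1))
    (h1 : StronglyMeasurable fun p : (𝒰 × 𝒵) × ℝ => h (true, p.2, p.1)) :
    StronglyMeasurable h := by
  have hs : MeasurableSet {o : Obs 𝒰 𝒵 | o.1 = true} :=
    measurable_fst (measurableSet_singleton true)
  have hm : Measurable fun o : Obs 𝒰 𝒵 => (o.2.2, o.2.1) := by fun_prop
  have e : h = fun o => if o.1 = true then h (true, o.2.1, o.2.2) else h (false, o.2.1, o.2.2) := by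
    ext ⟨t, y, x⟩
    cases t <;> rfl
  rw [e]
  exact StronglyMeasurable.ite hs (h1.comp_measurable hm) (h0.comp_measurable hm)

theorem stronglyMeasurable_arm {h : Obs 𝒰 𝒵 → F} (hh : StronglyMeasurable h) (t : Bool) :
    StronglyMeasurable fun p : (𝒰 × 𝒵) × ℝ => h (t, p.2, p.1) :=
  hh.comp_measurable (measurable_mkObs t)

theorem stronglyMeasurable_outcomeMean (hη : η.IsDensity M) {c : ℝ → 𝒰 × 𝒵 → E}
    (hc : StronglyMeasurable fun p : (𝒰 × 𝒵) × ℝ => c p.2 p.1) :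
    StronglyMeasurable (outcomeMean M θ η c) :=
  (measurable_oddsIntegral hη).inv.stronglyMeasurable.smul
    (StronglyMeasurable.integral_kernel_prod_right' (κ := kernel₀ M η)
      ((measurable_one_sub_π M θ).inv.stronglyMeasurable.smul hc))

theorem stronglyMeasurable_score₀ (hη : η.IsDensity M) {c : ℝ → 𝒰 × 𝒵 → E}
    (hc : StronglyMeasurable fun p : (𝒰 × 𝒵) × ℝ => c p.2 p.1) :
    StronglyMeasurable (score₀ M θ η c) := by
  have he : StronglyMeasurable fun p : (𝒰 × 𝒵) × ℝ => outcomeMean M θ η c p.1 :=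
    (stronglyMeasurable_outcomeMean hη hc).comp_measurable measurable_fst
  refine stronglyMeasurable_of_arms (hc.sub he) ?_
  exact (((measurable_oddsIntegral (θ := θ) hη).sub_const 1).inv.comp
    measurable_fst).stronglyMeasurable.smul he

theorem stronglyMeasurable_score₁ {b : ℝ → 𝒰 × 𝒵 → F}
    (hb : StronglyMeasurable fun p : (𝒰 × 𝒵) × ℝ => b p.2 p.1) :
    StronglyMeasurable (score₁ b) :=
  stronglyMeasurable_of_arms stronglyMeasurable_const hb

theorem stronglyMeasurable_score₂ {a : 𝒰 × 𝒵 → F} (ha : StronglyMeasurable a) :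
    StronglyMeasurable (score₂ a) :=
  ha.comp_measurable (measurable_snd.comp measurable_snd)

theorem stronglyMeasurable_residual {g : 𝒰 × 𝒵 → E} (hg : StronglyMeasurable g) :
    StronglyMeasurable (residual M θ g) := by
  have hg' : StronglyMeasurable fun p : (𝒰 × 𝒵) × ℝ => g p.1 :=
    hg.comp_measurable measurable_fst
  refine stronglyMeasurable_of_arms ?_ hg'
  exact (measurable_const.sub (measurable_one_sub_π M θ).inv).stronglyMeasurable.smul hg'

/-- The weights (1-π)⁻¹/D are positive with total mass one, so this is an average of values of c. -/
theorem IsRegularPoint.norm_outcomeMean_le {x : 𝒰 × 𝒵} (hx : IsRegularPoint M θ η ε x)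
    (hη : η.IsDensity M) (hε : 0 < ε) {c : ℝ → 𝒰 × 𝒵 → E} {K : ℝ} (hK : ∀ y, ‖c y x‖ ≤ K) :
    ‖outcomeMean M θ η c x‖ ≤ K := by
  have hD := hx.odds_pos
  rw [outcomeMean, norm_smul, Real.norm_of_nonneg (inv_nonneg.2 hD.le), inv_mul_le_iff₀ hD]
  have hb := norm_integral_le_of_norm_le (μ := kernel₀ M η x)
    (f := fun y => (1 - M.π θ y x.1)⁻¹ • c y x) ((hx.integrable_inv hε).mul_const K) (by
      filter_upwards [hx.inv_bounds hε] with y hy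
      rw [norm_smul, Real.norm_of_nonneg (by linarith)]
      exact mul_le_mul_of_nonneg_left (hK y) (by linarith))
  rwa [integral_mul_const, ← oddsIntegral_eq hη] at hb

/-- The factor (D - 1)⁻¹ alone is unbounded, as π may be close to 0. Because c has mean zero,
(1-π)⁻¹ may be replaced by (1-π)⁻¹ - 1, a nonnegative weight of total mass D - 1 that cancels the
factor. -/
theorem IsRegularPoint.norm_inv_smul_outcomeMean_le {x : 𝒰 × 𝒵}
    (hx : IsRegularPoint M θ η ε x) (hη : η.IsDensity M) (hε : 0 < ε)
    {c : ℝ → 𝒰 × 𝒵 → E} {K : ℝ} (hc : StronglyMeasurable fun y => c y x)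
    (hK : ∀ y, ‖c y x‖ ≤ K) (h0 : ∫ y, c y x ∂kernel₀ M η x = 0) :
    ‖(M.oddsIntegral θ η x - 1)⁻¹ • outcomeMean M θ η c x‖ ≤ K := by
  have := hx.prob₀
  have hD := hx.odds_pos
  have hD1 := hx.odds_sub_one_pos
  have hK0 : 0 ≤ K := (norm_nonneg _).trans (hK 0)
  have hci : Integrable (fun y => c y x) (kernel₀ M η x) :=
    .of_bound hc.aestronglyMeasurable K (.of_forall hK)
  have e : ∫ y, (1 - M.π θ y x.1)⁻¹ • c y x ∂kernel₀ M η x =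
      ∫ y, ((1 - M.π θ y x.1)⁻¹ - 1) • c y x ∂kernel₀ M η x := by
    simp_rw [sub_smul, one_smul]
    rw [integral_sub (hx.integrable_inv_smul hε hci) hci, h0, sub_zero]
  have hb := norm_integral_le_of_norm_le (μ := kernel₀ M η x)
    (f := fun y => ((1 - M.π θ y x.1)⁻¹ - 1) • c y x)
    (((hx.integrable_inv hε).sub (integrable_const 1)).mul_const K) (by
      filter_upwards [hx.inv_bounds hε] with y hy
      simp only [Pi.sub_apply]
      rw [norm_smul, Real.norm_of_nonneg (by linarith)]
      exact mul_le_mul_of_nonneg_left (hK y) (by linarith))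
  simp only [Pi.sub_apply] at hb
  rw [integral_mul_const, integral_sub (hx.integrable_inv hε) (integrable_const 1),
    ← oddsIntegral_eq hη] at hb
  simp only [integral_const, probReal_univ, smul_eq_mul, mul_one] at hb
  rw [norm_smul, Real.norm_of_nonneg (inv_nonneg.2 hD1.le), inv_mul_le_iff₀ hD1, outcomeMean, e,
    norm_smul, Real.norm_of_nonneg (inv_nonneg.2 hD.le)]
  refine le_trans ?_ hb
  exact mul_le_of_le_one_left (norm_nonneg _) (inv_le_one_of_one_le₀ hx.one_lt_odds.le)

theorem ae_bounded_score₀ (hη : η.IsDensity M) (hε : 0 < ε)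
    (hreg : ∀ᵐ x ∂M.ν, IsRegularPoint M θ η ε x) {c : ℝ → 𝒰 × 𝒵 → E}
    (hc : IsDirection M.ν (kernel₀ M η) c) :
    ∃ K, ∀ᵐ o ∂M.base, ‖score₀ M θ η c o‖ ≤ K := by
  obtain ⟨K, hK⟩ := hc.bounded
  refine ⟨K + K, ?_⟩
  have : ∀ᵐ x ∂M.ν, ∀ t y, ‖score₀ M θ η c (t, y, x)‖ ≤ K + K := by
    filter_upwards [hreg, hc.integral_eq_zero] with x hx h0 t y
    have hK0 : 0 ≤ K := (norm_nonneg _).trans (hK y x)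
    have h1 := hx.norm_outcomeMean_le hη hε (fun y => hK y x)
    have h2 := hx.norm_inv_smul_outcomeMean_le hη hε
      (stronglyMeasurable_section hc.stronglyMeasurable x) (fun y => hK y x) h0
    cases t
    · exact (norm_sub_le _ _).trans (add_le_add (hK y x) h1)
    · exact h2.trans (by linarith)
  filter_upwards [ae_base_of_ae this] with o ho using ho o.1 o.2.1

theorem ae_bounded_score₁ {κ : Kernel (𝒰 × 𝒵) ℝ} {b : ℝ → 𝒰 × 𝒵 → E}
    (hb : IsDirection M.ν κ b) : ∃ K, ∀ᵐ o ∂M.base, ‖score₁ b o‖ ≤ K := by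
  obtain ⟨K, hK⟩ := hb.bounded
  refine ⟨K, .of_forall ?_⟩
  rintro ⟨t, y, x⟩
  cases t
  · simpa [score₁] using (norm_nonneg _).trans (hK y x)
  · exact hK y x

/-- Overlap bounds (1-π)⁻¹ by ε⁻¹. The bound is for `M.base`, as in the lemmas on scores, so that it
holds under all laws of a submodel at once. -/
theorem ae_bounded_residual (hε : 0 < ε)
    (hπ : ∀ᵐ p ∂(M.ν.prod M.μ₀), 0 < M.π θ p.2 p.1.1 ∧ M.π θ p.2 p.1.1 ≤ 1 - ε)
    {g : 𝒰 × 𝒵 → E} (hg : StronglyMeasurable g) {K : ℝ} (hK : ∀ x, ‖g x‖ ≤ K) :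
    ∃ K, ∀ᵐ o ∂M.base, ‖residual M θ g o‖ ≤ K := by
  refine ⟨K + ε⁻¹ * K, ae_base_of_ae_prod ?_ (.of_forall fun q => ?_) ?_⟩
  · filter_upwards [hπ] with p hp
    have hK0 : 0 ≤ K := (norm_nonneg _).trans (hK p.1)
    have h1 : (1 - M.π θ p.2 p.1.1)⁻¹ ≤ ε⁻¹ := inv_anti₀ hε (by linarith)
    have h2 : 0 ≤ (1 - M.π θ p.2 p.1.1)⁻¹ := inv_nonneg.2 (by linarith)
    simp only [residual, Bool.false_eq_true, if_false]
    rw [sub_smul, one_smul]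
    refine (norm_sub_le _ _).trans (add_le_add (hK _) ?_)
    rw [norm_smul, Real.norm_of_nonneg h2]
    exact mul_le_mul h1 (hK _) (norm_nonneg _) (inv_nonneg.2 hε.le)
  · have hK0 : 0 ≤ K := (norm_nonneg _).trans (hK q.1)
    exact (hK q.1).trans (le_add_of_nonneg_right (mul_nonneg (inv_nonneg.2 hε.le) hK0))
  · exact measurableSet_le (stronglyMeasurable_residual hg).norm.measurable measurable_const

theorem obsLaw_absolutelyContinuous (hη : η.IsDensity M)
    (hreg : ∀ᵐ x ∂M.ν, IsRegularPoint M θ η ε x) : obsLaw M θ η ≪ M.base := by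
  rw [← withDensity_likelihood hη hreg]; exact withDensity_absolutelyContinuous _ _

/-! ### Orthogonality to all bounded directions -/

/-- A bounded multiple of `v`. -/
def shrink (v : E) : E := (1 + ‖v‖)⁻¹ • v

theorem norm_shrink_le (v : E) : ‖shrink v‖ ≤ 1 := by
  have h := norm_nonneg v
  rw [shrink, norm_smul, Real.norm_of_nonneg (by positivity), inv_mul_le_iff₀ (by positivity)]
  linarith

theorem inner_shrink_nonneg (v : E) : 0 ≤ inner ℝ (shrink v) v := by
  rw [shrink, real_inner_smul_left, real_inner_self_eq_norm_sq]; positivity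

/-- The pairing equals ‖v‖²/(1 + ‖v‖). Shrinking allows a defect to be tested against itself by a
bounded function. -/
theorem eq_zero_of_inner_shrink_eq_zero {v : E} (h : inner ℝ (shrink v) v = 0) : v = 0 := by
  have hv := norm_nonneg v
  rw [shrink, real_inner_smul_left, real_inner_self_eq_norm_sq] at h
  rcases mul_eq_zero.1 h with h | h
  · exact absurd h (by positivity)
  · simpa using h

theorem stronglyMeasurable_shrink {α : Type*} [MeasurableSpace α] {s : α → E}
    (hs : StronglyMeasurable s) : StronglyMeasurable fun x => shrink (s x) :=
  ((measurable_const.add hs.norm.measurable).inv).stronglyMeasurable.smul hs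

/-! ### Bounded centred test directions -/

section Centering

variable {𝒳 : Type*} [MeasurableSpace 𝒳]

open scoped Classical in
/-- The bounded direction in which the mean of `s` increases. -/
def centeredShrink (κ : Kernel 𝒳 ℝ) (s : ℝ → 𝒳 → E) (y : ℝ) (x : 𝒳) : E :=
  if κ x Set.univ = 1 then shrink (s y x) - ∫ y', shrink (s y' x) ∂κ x else 0

theorem centeredShrink_of_isProbabilityMeasure (κ : Kernel 𝒳 ℝ) (s : ℝ → 𝒳 → E) (y : ℝ) (x : 𝒳)
    [IsProbabilityMeasure (κ x)] :
    centeredShrink κ s y x = shrink (s y x) - ∫ y', shrink (s y' x) ∂κ x :=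
  if_pos measure_univ

theorem integrable_shrink {μ : Measure ℝ} [IsFiniteMeasure μ] {s : ℝ → E}
    (hs : StronglyMeasurable s) : Integrable (fun y => shrink (s y)) μ :=
  .of_bound (stronglyMeasurable_shrink hs).aestronglyMeasurable 1
    (.of_forall fun _ => norm_shrink_le _)

theorem isDirection_centeredShrink [CompleteSpace E] {ν : Measure 𝒳} {κ : Kernel 𝒳 ℝ}
    [IsSFiniteKernel κ]
    (hκ : ∀ᵐ x ∂ν, IsProbabilityMeasure (κ x)) {s : ℝ → 𝒳 → E}
    (hs : StronglyMeasurable fun p : 𝒳 × ℝ => s p.2 p.1) :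
    IsDirection ν κ (centeredShrink κ s) where
  stronglyMeasurable := by
    classical
    have hs' := stronglyMeasurable_shrink hs
    refine StronglyMeasurable.ite ?_ (hs'.sub ?_) stronglyMeasurable_const
    · exact measurable_fst ((κ.measurable_coe MeasurableSet.univ) (measurableSet_singleton 1))
    · exact (hs'.integral_kernel_prod_right' (κ := κ)).comp_measurable measurable_fst
  bounded := by
    -- One for the shrunk vector and one for its mean. Where κ x is not a probability measure the
    -- default value 0 keeps the bound, which is required at every x.
    refine ⟨2, fun y x => ?_⟩
    unfold centeredShrink
    split_ifs with h
    · have : IsProbabilityMeasure (κ x) := ⟨h⟩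
      have h1 : ‖∫ y', shrink (s y' x) ∂κ x‖ ≤ 1 := by
        simpa using norm_integral_le_of_norm_le_const (μ := κ x)
          (.of_forall fun y' => norm_shrink_le (s y' x))
      exact (norm_sub_le _ _).trans (by linarith [norm_shrink_le (s y x)])
    · simp
  integral_eq_zero := by
    filter_upwards [hκ] with x hx
    simp_rw [centeredShrink_of_isProbabilityMeasure]
    rw [integral_sub (integrable_shrink (stronglyMeasurable_section hs x)) (integrable_const _)]
    simp

/-- The subtracted mean pairs with the integral of s, which is zero; centring makes the direction
admissible without changing the pairing. -/
theorem integral_inner_centeredShrink [CompleteSpace E] {κ : Kernel 𝒳 ℝ} {x : 𝒳}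
    [IsProbabilityMeasure (κ x)] {s : ℝ → 𝒳 → E}
    (hs : StronglyMeasurable fun p : 𝒳 × ℝ => s p.2 p.1)
    (hi : Integrable (fun y => s y x) (κ x)) (h0 : ∫ y, s y x ∂κ x = 0) :
    Integrable (fun y => inner ℝ (shrink (s y x)) (s y x)) (κ x) ∧
    ∫ y, inner ℝ (centeredShrink κ s y x) (s y x) ∂κ x =
      ∫ y, inner ℝ (shrink (s y x)) (s y x) ∂κ x := by
  have h1 : Integrable (fun y => inner ℝ (shrink (s y x)) (s y x)) (κ x) :=
    integrable_inner_of_bound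
      (stronglyMeasurable_shrink (stronglyMeasurable_section hs x)).aestronglyMeasurable
      (.of_forall fun _ => norm_shrink_le _) hi
  refine ⟨h1, ?_⟩
  simp_rw [centeredShrink_of_isProbabilityMeasure, inner_sub_left]
  rw [integral_sub h1 (hi.const_inner _), integral_inner hi, h0]
  simp

theorem ae_eq_zero_of_integral_inner_shrink {μ : Measure ℝ} {s : ℝ → E}
    (hi : Integrable (fun y => inner ℝ (shrink (s y)) (s y)) μ)
    (h : ∫ y, inner ℝ (shrink (s y)) (s y) ∂μ = 0) : ∀ᵐ y ∂μ, s y = 0 := by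
  filter_upwards [(integral_eq_zero_iff_of_nonneg (fun _ => inner_shrink_nonneg _) hi).1 h]
    with y hy using eq_zero_of_inner_shrink_eq_zero hy

end Centering

/-! ### Vanishing defects as orthogonality to bounded directions -/

section Pairing

variable {h : Obs 𝒰 𝒵 → E}

theorem stronglyMeasurable_armMean₀ (hh : StronglyMeasurable h) :
    StronglyMeasurable (armMean₀ M η h) :=
  (stronglyMeasurable_arm hh false).integral_kernel_prod_right' (κ := kernel₀ M η)

theorem stronglyMeasurable_armMean₁ (hh : StronglyMeasurable h) :
    StronglyMeasurable (armMean₁ M η h) :=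
  (stronglyMeasurable_arm hh true).integral_kernel_prod_right' (κ := kernel₁ M η)

theorem stronglyMeasurable_defect₀ (hη : η.IsDensity M) (hh : StronglyMeasurable h) :
    StronglyMeasurable fun p : (𝒰 × 𝒵) × ℝ => defect₀ M θ η h p.2 p.1 := by
  have m0 : StronglyMeasurable fun p : (𝒰 × 𝒵) × ℝ => armMean₀ M η h p.1 :=
    (stronglyMeasurable_armMean₀ hh).comp_measurable measurable_fst
  have m1 : StronglyMeasurable fun p : (𝒰 × 𝒵) × ℝ => armMean₁ M η h p.1 :=
    (stronglyMeasurable_armMean₁ hh).comp_measurable measurable_fst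
  exact ((stronglyMeasurable_arm hh false).sub m1).add
    ((measurable_one_sub_π M θ).inv.stronglyMeasurable.smul
      (((measurable_oddsIntegral hη).inv.comp measurable_fst).stronglyMeasurable.smul (m1.sub m0)))

theorem stronglyMeasurable_defect₁ (hh : StronglyMeasurable h) :
    StronglyMeasurable fun p : (𝒰 × 𝒵) × ℝ => defect₁ M η h p.2 p.1 :=
  (stronglyMeasurable_arm hh true).sub
    ((stronglyMeasurable_armMean₁ (M := M) (η := η) hh).comp_measurable measurable_fst)

theorem stronglyMeasurable_defect₂ (hη : η.IsDensity M) (hh : StronglyMeasurable h) :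
    StronglyMeasurable (defect₂ M θ η h) :=
  (stronglyMeasurable_armMean₀ hh).add
    (((measurable_oddsIntegral hη).sub_const 1).stronglyMeasurable.smul
      (stronglyMeasurable_armMean₁ hh))

theorem stronglyMeasurable_defect₃ (hη : η.IsDensity M) (hh : StronglyMeasurable h) :
    StronglyMeasurable (defect₃ M θ η h) :=
  (StronglyMeasurable.integral_kernel_prod_right' (κ := kernel₀ M η)
    ((measurable_const.sub (measurable_one_sub_π M θ).inv).stronglyMeasurable.smul
      (stronglyMeasurable_arm hh false))).add
    (((measurable_oddsIntegral hη).sub_const 1).stronglyMeasurable.smul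
      (stronglyMeasurable_armMean₁ hh))

theorem integrable_inner_obsLaw (hη : η.IsDensity M)
    (hreg : ∀ᵐ x ∂M.ν, IsRegularPoint M θ η ε x) (hi : Integrable h (obsLaw M θ η))
    {ψ : Obs 𝒰 𝒵 → E} (hψ : StronglyMeasurable ψ) (hb : ∃ K, ∀ᵐ o ∂M.base, ‖ψ o‖ ≤ K) :
    Integrable (fun o => inner ℝ (ψ o) (h o)) (obsLaw M θ η) := by
  obtain ⟨K, hK⟩ := hb
  exact integrable_inner_of_bound hψ.aestronglyMeasurable
    ((obsLaw_absolutelyContinuous hη hreg).ae_le hK) hi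

variable [CompleteSpace E]

/-- For the converse the direction is the centred shrinking of the defect. Its conditional pairing
with h is a positive weight times the mean of a nonnegative function, so a zero integral forces that
function, and with it the defect, to vanish. The analogues for the other three families follow the
same pattern. -/
theorem defect₀_eq_zero_iff (hη : η.IsDensity M) (hε : 0 < ε)
    (hreg : ∀ᵐ x ∂M.ν, IsRegularPoint M θ η ε x) (hh : StronglyMeasurable h)
    (hi : Integrable h (obsLaw M θ η)) :
    (∀ᵐ x ∂covLaw M η, ∀ᵐ y ∂kernel₀ M η x, defect₀ M θ η h y x = 0) ↔
      ∀ c, IsDirection M.ν (kernel₀ M η) c →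
        ∫ o, inner ℝ (score₀ M θ η c o) (h o) ∂obsLaw M θ η = 0 := by
  have hac := covLaw_absolutelyContinuous (M := M) (η := η)
  have key : ∀ c, IsDirection M.ν (kernel₀ M η) c → ∀ᵐ x ∂covLaw M η,
      condMean M θ η (fun o => inner ℝ (score₀ M θ η c o) (h o)) x =
      (M.oddsIntegral θ η x)⁻¹ * ∫ y, inner ℝ (c y x) (defect₀ M θ η h y x) ∂kernel₀ M η x := by
    intro c hc
    obtain ⟨K, hK⟩ := hc.bounded
    filter_upwards [hac.ae_le hreg, ae_integrable_of_integrable_obsLaw hη hreg hi,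
      hac.ae_le hc.integral_eq_zero] with x hx hxi h0
    exact hx.condMean_inner_score₀ hε hxi.1 hxi.2
      (stronglyMeasurable_section hc.stronglyMeasurable x) (fun y => hK y x) h0
  have int : ∀ c, IsDirection M.ν (kernel₀ M η) c →
      Integrable (condMean M θ η fun o => inner ℝ (score₀ M θ η c o) (h o)) (covLaw M η) ∧
      ∫ o, inner ℝ (score₀ M θ η c o) (h o) ∂obsLaw M θ η =
      ∫ x, condMean M θ η (fun o => inner ℝ (score₀ M θ η c o) (h o)) x ∂covLaw M η :=
    fun c hc => integrable_condMean_and_integral_obsLaw hη hreg (integrable_inner_obsLaw hη hreg hi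
      (stronglyMeasurable_score₀ hη hc.stronglyMeasurable) (ae_bounded_score₀ hη hε hreg hc))
  constructor
  · intro hd c hc
    rw [(int c hc).2, integral_eq_zero_of_ae]
    filter_upwards [key c hc, hd] with x hx hdx
    rw [hx, integral_eq_zero_of_ae, mul_zero, Pi.zero_apply]
    filter_upwards [hdx] with y hy
    simp [hy]
  · intro H
    have hm := stronglyMeasurable_defect₀ (θ := θ) hη hh
    have hc := isDirection_centeredShrink (ν := M.ν) (κ := kernel₀ M η)
      (hreg.mono fun x hx => hx.prob₀) hm
    have hk : ∀ᵐ x ∂covLaw M η,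
        Integrable (fun y => inner ℝ (shrink (defect₀ M θ η h y x)) (defect₀ M θ η h y x))
          (kernel₀ M η x) ∧
        0 < (M.oddsIntegral θ η x)⁻¹ ∧ condMean M θ η (fun o => inner ℝ (score₀ M θ η
          (centeredShrink (kernel₀ M η) (defect₀ M θ η h)) o) (h o)) x =
        (M.oddsIntegral θ η x)⁻¹ *
          ∫ y, inner ℝ (shrink (defect₀ M θ η h y x)) (defect₀ M θ η h y x) ∂kernel₀ M η x := by
      filter_upwards [key _ hc, hac.ae_le hreg, ae_integrable_of_integrable_obsLaw hη hreg hi]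
        with x hx hxr hxi
      have := hxr.prob₀
      have h2 := integral_inner_centeredShrink hm (hxr.integrable_defect₀ hε hxi.1)
        (hxr.integral_defect₀ hη hε hxi.1)
      refine ⟨h2.1, inv_pos.2 hxr.odds_pos, ?_⟩
      rw [hx, h2.2]
    have hz := H _ hc
    rw [(int _ hc).2, integral_eq_zero_iff_of_nonneg_ae ?_ (int _ hc).1] at hz
    · filter_upwards [hz, hk] with x h1 h2
      rw [h2.2.2] at h1
      exact ae_eq_zero_of_integral_inner_shrink h2.1
        ((mul_eq_zero.1 h1).resolve_left h2.2.1.ne')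
    · filter_upwards [hk] with x h2
      rw [h2.2.2]
      exact mul_nonneg h2.2.1.le (integral_nonneg fun _ => inner_shrink_nonneg _)

theorem defect₁_eq_zero_iff (hη : η.IsDensity M)
    (hreg : ∀ᵐ x ∂M.ν, IsRegularPoint M θ η ε x) (hh : StronglyMeasurable h)
    (hi : Integrable h (obsLaw M θ η)) :
    (∀ᵐ x ∂covLaw M η, ∀ᵐ y ∂kernel₁ M η x, defect₁ M η h y x = 0) ↔
      ∀ b, IsDirection M.ν (kernel₁ M η) b →
        ∫ o, inner ℝ (score₁ b o) (h o) ∂obsLaw M θ η = 0 := by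
  have hac := covLaw_absolutelyContinuous (M := M) (η := η)
  have key : ∀ b, IsDirection M.ν (kernel₁ M η) b → ∀ᵐ x ∂covLaw M η,
      condMean M θ η (fun o => inner ℝ (score₁ b o) (h o)) x =
      (1 - (M.oddsIntegral θ η x)⁻¹) *
        ∫ y, inner ℝ (b y x) (defect₁ M η h y x) ∂kernel₁ M η x := by
    intro c hc
    obtain ⟨K, hK⟩ := hc.bounded
    filter_upwards [hac.ae_le hreg, ae_integrable_of_integrable_obsLaw hη hreg hi,
      hac.ae_le hc.integral_eq_zero] with x hx hxi h0
    exact hx.condMean_inner_score₁ hxi.2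
      (stronglyMeasurable_section hc.stronglyMeasurable x) (fun y => hK y x) h0
  have int : ∀ b, IsDirection M.ν (kernel₁ M η) b →
      Integrable (condMean M θ η fun o => inner ℝ (score₁ b o) (h o)) (covLaw M η) ∧
      ∫ o, inner ℝ (score₁ b o) (h o) ∂obsLaw M θ η =
      ∫ x, condMean M θ η (fun o => inner ℝ (score₁ b o) (h o)) x ∂covLaw M η :=
    fun b hb => integrable_condMean_and_integral_obsLaw hη hreg (integrable_inner_obsLaw hη hreg hi
      (stronglyMeasurable_score₁ hb.stronglyMeasurable) (ae_bounded_score₁ hb))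
  constructor
  · intro hd c hc
    rw [(int c hc).2, integral_eq_zero_of_ae]
    filter_upwards [key c hc, hd] with x hx hdx
    rw [hx, integral_eq_zero_of_ae, mul_zero, Pi.zero_apply]
    filter_upwards [hdx] with y hy
    simp [hy]
  · intro H
    have hm := stronglyMeasurable_defect₁ (M := M) (η := η) hh
    have hc := isDirection_centeredShrink (ν := M.ν) (κ := kernel₁ M η)
      (hreg.mono fun x hx => hx.prob₁) hm
    have hk : ∀ᵐ x ∂covLaw M η,
        Integrable (fun y => inner ℝ (shrink (defect₁ M η h y x)) (defect₁ M η h y x))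
          (kernel₁ M η x) ∧
        0 < 1 - (M.oddsIntegral θ η x)⁻¹ ∧ condMean M θ η (fun o => inner ℝ (score₁
          (centeredShrink (kernel₁ M η) (defect₁ M η h)) o) (h o)) x =
        (1 - (M.oddsIntegral θ η x)⁻¹) *
          ∫ y, inner ℝ (shrink (defect₁ M η h y x)) (defect₁ M η h y x) ∂kernel₁ M η x := by
      filter_upwards [key _ hc, hac.ae_le hreg, ae_integrable_of_integrable_obsLaw hη hreg hi]
        with x hx hxr hxi
      have := hxr.prob₁
      have h2 := integral_inner_centeredShrink (x := x) hm (hxi.2.sub (integrable_const _)) (by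
        unfold defect₁
        rw [integral_sub hxi.2 (integrable_const _)]
        simp [armMean₁])
      refine ⟨h2.1, sub_pos.2 (inv_lt_one_of_one_lt₀ hxr.one_lt_odds), ?_⟩
      rw [hx, h2.2]
    have hz := H _ hc
    rw [(int _ hc).2, integral_eq_zero_iff_of_nonneg_ae ?_ (int _ hc).1] at hz
    · filter_upwards [hz, hk] with x h1 h2
      rw [h2.2.2] at h1
      exact ae_eq_zero_of_integral_inner_shrink h2.1
        ((mul_eq_zero.1 h1).resolve_left h2.2.1.ne')
    · filter_upwards [hk] with x h2
      rw [h2.2.2]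
      exact mul_nonneg h2.2.1.le (integral_nonneg fun _ => inner_shrink_nonneg _)

theorem defect₂_eq_zero_iff (hη : η.IsDensity M)
    (hreg : ∀ᵐ x ∂M.ν, IsRegularPoint M θ η ε x) (hh : StronglyMeasurable h)
    (hi : Integrable h (obsLaw M θ η)) (h0 : ∫ o, h o ∂obsLaw M θ η = 0) :
    (∀ᵐ x ∂covLaw M η, defect₂ M θ η h x = 0) ↔
      ∀ a, StronglyMeasurable a → (∃ K, ∀ x, ‖a x‖ ≤ K) → ∫ x, a x ∂covLaw M η = 0 →
        ∫ o, inner ℝ (score₂ a o) (h o) ∂obsLaw M θ η = 0 := by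
  have hac := covLaw_absolutelyContinuous (M := M) (η := η)
  have key : ∀ a : 𝒰 × 𝒵 → E, ∀ᵐ x ∂covLaw M η,
      condMean M θ η (fun o => inner ℝ (score₂ a o) (h o)) x =
      (M.oddsIntegral θ η x)⁻¹ * inner ℝ (a x) (defect₂ M θ η h x) := by
    intro a
    filter_upwards [hac.ae_le hreg, ae_integrable_of_integrable_obsLaw hη hreg hi] with x hx hxi
    exact hx.condMean_inner_score₂ hxi.1 hxi.2 a
  have int : ∀ a, StronglyMeasurable a → (∃ K, ∀ x, ‖a x‖ ≤ K) →
      Integrable (fun o => inner ℝ (score₂ a o) (h o)) (obsLaw M θ η) :=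
    fun a ha ⟨K, hK⟩ => integrable_inner_obsLaw hη hreg hi
      (stronglyMeasurable_score₂ ha) ⟨K, .of_forall fun o => hK _⟩
  constructor
  · intro hd a ha hb _
    rw [(integrable_condMean_and_integral_obsLaw hη hreg (int a ha hb)).2, integral_eq_zero_of_ae]
    filter_upwards [key a, hd] with x hx hdx
    simp [hx, hdx]
  · intro H
    have hcov := isProbabilityMeasure_covLaw hη
    set u : 𝒰 × 𝒵 → E := fun x => shrink (defect₂ M θ η h x) with hu
    have hum : StronglyMeasurable u := stronglyMeasurable_shrink (stronglyMeasurable_defect₂ hη hh)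
    have hub : ∀ x, ‖u x‖ ≤ 1 := fun x => norm_shrink_le _
    have hui : Integrable u (covLaw M η) :=
      .of_bound hum.aestronglyMeasurable 1 (.of_forall hub)
    set k := ∫ x, u x ∂covLaw M η
    have hz := H (fun x => u x - k) (hum.sub stronglyMeasurable_const)
      ⟨1 + ‖k‖, fun x => (norm_sub_le _ _).trans (by gcongr; exact hub x)⟩ (by
        rw [integral_sub hui (integrable_const _)]; simp [k])
    -- Directions for g need only one scalar constraint, mean zero over all x; the constant k that
    -- enforces it is invisible to h, which has mean zero.
    have e : ∫ o, inner ℝ (score₂ (fun x => u x - k) o) (h o) ∂obsLaw M θ η =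
        ∫ o, inner ℝ (score₂ u o) (h o) ∂obsLaw M θ η := by
      have : ∀ o, inner ℝ (score₂ (fun x => u x - k) o) (h o) =
          inner ℝ (score₂ u o) (h o) - inner ℝ k (h o) := fun o => by
        rw [← inner_sub_left]; rfl
      simp_rw [this]
      rw [integral_sub (int u hum ⟨1, hub⟩) (hi.const_inner _), integral_inner hi, h0]
      simp
    have hI := integrable_condMean_and_integral_obsLaw hη hreg (int u hum ⟨1, hub⟩)
    rw [e, hI.2, integral_eq_zero_iff_of_nonneg_ae ?_ hI.1] at hz
    · filter_upwards [hz, key u, hac.ae_le hreg] with x h1 h2 hxr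
      rw [h2] at h1
      exact eq_zero_of_inner_shrink_eq_zero
        ((mul_eq_zero.1 h1).resolve_left (inv_pos.2 hxr.odds_pos).ne')
    · filter_upwards [key u, hac.ae_le hreg] with x h2 hxr
      rw [h2]
      exact mul_nonneg (inv_pos.2 hxr.odds_pos).le (inner_shrink_nonneg _)

/-- Here every bounded g is admissible, so the shrunk defect serves as a test function without
centring. -/
theorem defect₃_eq_zero_iff (hη : η.IsDensity M) (hε : 0 < ε)
    (hreg : ∀ᵐ x ∂M.ν, IsRegularPoint M θ η ε x) (hh : StronglyMeasurable h)
    (hi : Integrable h (obsLaw M θ η))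
    (hπ : ∀ᵐ p ∂(M.ν.prod M.μ₀), 0 < M.π θ p.2 p.1.1 ∧ M.π θ p.2 p.1.1 ≤ 1 - ε) :
    (∀ᵐ x ∂covLaw M η, defect₃ M θ η h x = 0) ↔
      ∀ g, StronglyMeasurable g → (∃ K, ∀ x, ‖g x‖ ≤ K) →
        ∫ o, inner ℝ (residual M θ g o) (h o) ∂obsLaw M θ η = 0 := by
  have hac := covLaw_absolutelyContinuous (M := M) (η := η)
  have key : ∀ a : 𝒰 × 𝒵 → E, ∀ᵐ x ∂covLaw M η,
      condMean M θ η (fun o => inner ℝ (residual M θ a o) (h o)) x =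
      (M.oddsIntegral θ η x)⁻¹ * inner ℝ (a x) (defect₃ M θ η h x) := by
    intro a
    filter_upwards [hac.ae_le hreg, ae_integrable_of_integrable_obsLaw hη hreg hi] with x hx hxi
    exact hx.condMean_inner_residual hε hxi.1 hxi.2 a
  have int : ∀ a, StronglyMeasurable a → (∃ K, ∀ x, ‖a x‖ ≤ K) →
      Integrable (fun o => inner ℝ (residual M θ a o) (h o)) (obsLaw M θ η) :=
    fun a ha ⟨K, hK⟩ => integrable_inner_obsLaw hη hreg hi
      (stronglyMeasurable_residual ha) (ae_bounded_residual hε hπ ha hK)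
  constructor
  · intro hd a ha hb
    rw [(integrable_condMean_and_integral_obsLaw hη hreg (int a ha hb)).2, integral_eq_zero_of_ae]
    filter_upwards [key a, hd] with x hx hdx
    simp [hx, hdx]
  · intro H
    set u : 𝒰 × 𝒵 → E := fun x => shrink (defect₃ M θ η h x) with hu
    have hum : StronglyMeasurable u := stronglyMeasurable_shrink (stronglyMeasurable_defect₃ hη hh)
    have hub : ∀ x, ‖u x‖ ≤ 1 := fun x => norm_shrink_le _
    have hz := H u hum ⟨1, hub⟩
    have hI := integrable_condMean_and_integral_obsLaw hη hreg (int u hum ⟨1, hub⟩)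
    rw [hI.2, integral_eq_zero_iff_of_nonneg_ae ?_ hI.1] at hz
    · filter_upwards [hz, key u, hac.ae_le hreg] with x h1 h2 hxr
      rw [h2] at h1
      exact eq_zero_of_inner_shrink_eq_zero
        ((mul_eq_zero.1 h1).resolve_left (inv_pos.2 hxr.odds_pos).ne')
    · filter_upwards [key u, hac.ae_le hreg] with x h2 hxr
      rw [h2]
      exact mul_nonneg (inv_pos.2 hxr.odds_pos).le (inner_shrink_nonneg _)

end Pairing

end ATT

namespace ATT

variable {d : ℕ} {𝒰 𝒵 : Type*} [MeasurableSpace 𝒰] [MeasurableSpace 𝒵]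
variable {M : Model d 𝒰 𝒵} {θ : EuclideanSpace ℝ (Fin d)} {η : Nuisance 𝒰 𝒵} {ε : ℝ}
variable {F : Type*} [NormedAddCommGroup F]
variable {E : Type*} [NormedAddCommGroup E] [InnerProductSpace ℝ E]

/-! ### Functions with three vanishing defects -/

section Pointwise

variable {x : 𝒰 × 𝒵} {h : Obs 𝒰 𝒵 → E}

theorem armMean₀_congr {q : ℝ → E} (hq : ∀ᵐ y ∂kernel₀ M η x, h (false, y, x) = q y) :
    armMean₀ M η h x = ∫ y, q y ∂kernel₀ M η x := integral_congr_ae hq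

theorem armMean₁_congr {p : ℝ → E} (hp : ∀ᵐ y ∂kernel₁ M η x, h (true, y, x) = p y) :
    armMean₁ M η h x = ∫ y, p y ∂kernel₁ M η x := integral_congr_ae hp

theorem defect₃_congr {q : ℝ → E} (hq : ∀ᵐ y ∂kernel₀ M η x, h (false, y, x) = q y) :
    defect₃ M θ η h x = ∫ y, (1 - (1 - M.π θ y x.1)⁻¹) • q y ∂kernel₀ M η x +
      (M.oddsIntegral θ η x - 1) • armMean₁ M η h x := by
  rw [defect₃]
  congr 1
  refine integral_congr_ae ?_
  filter_upwards [hq] with y hy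
  rw [hy]

namespace IsRegularPoint

theorem integral_one_sub_inv_smul (hx : IsRegularPoint M θ η ε x) (hε : 0 < ε) {q : ℝ → E}
    (hq : Integrable q (kernel₀ M η x)) :
    ∫ y, (1 - (1 - M.π θ y x.1)⁻¹) • q y ∂kernel₀ M η x =
      ∫ y, q y ∂kernel₀ M η x - ∫ y, (1 - M.π θ y x.1)⁻¹ • q y ∂kernel₀ M η x := by
  simp_rw [sub_smul, one_smul]
  exact integral_sub hq (hx.integrable_inv_smul hε hq)

/-- The vanishing of `defect₂` says `armMean₀` = -(D - 1) `armMean₁`, so the difference of the two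
means is D times `armMean₁`, and D cancels in `defect₀`. The outcome is a residual with g =
`armMean₁`. -/
theorem armMean₁_eq_of_defects (hx : IsRegularPoint M θ η ε x)
    (h0 : ∀ᵐ y ∂kernel₀ M η x, defect₀ M θ η h y x = 0) (h2 : defect₂ M θ η h x = 0) :
    ∀ᵐ y ∂kernel₀ M η x, h (false, y, x) =
      (1 - (1 - M.π θ y x.1)⁻¹) • armMean₁ M η h x := by
  have hD := hx.odds_pos
  filter_upwards [h0] with y hy
  have e : armMean₁ M η h x - armMean₀ M η h x = M.oddsIntegral θ η x • armMean₁ M η h x := by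
    rw [eq_neg_of_add_eq_zero_left h2]; module
  rw [defect₀, e, inv_smul_smul₀ hD.ne'] at hy
  rw [← sub_eq_zero, ← hy]
  module

theorem defects_of_score₁ {b : ℝ → 𝒰 × 𝒵 → E} (h0 : ∫ y, b y x ∂kernel₁ M η x = 0)
    (hq : ∀ᵐ y ∂kernel₀ M η x, h (false, y, x) = score₁ b (false, y, x))
    (hp : ∀ᵐ y ∂kernel₁ M η x, h (true, y, x) = score₁ b (true, y, x)) :
    (∀ᵐ y ∂kernel₀ M η x, defect₀ M θ η h y x = 0) ∧ defect₂ M θ η h x = 0 ∧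
      defect₃ M θ η h x = 0 := by
  simp only [score₁, Bool.false_eq_true, if_false, if_true] at hq hp
  have m0 := armMean₀_congr hq
  have m1 := armMean₁_congr hp
  rw [h0] at m1
  rw [integral_zero] at m0
  refine ⟨?_, ?_, ?_⟩
  · filter_upwards [hq] with y hy
    simp [defect₀, hy, m0, m1]
  · simp [defect₂, m0, m1]
  · simp [defect₃_congr hq, m1]

variable [CompleteSpace E]

theorem integrable_one_sub_inv (hx : IsRegularPoint M θ η ε x) (hε : 0 < ε) :
    Integrable (fun y => 1 - (1 - M.π θ y x.1)⁻¹) (kernel₀ M η x) := by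
  have := hx.prob₀
  exact (integrable_const 1).sub (hx.integrable_inv hε)

theorem integral_one_sub_inv (hx : IsRegularPoint M θ η ε x) (hη : η.IsDensity M) (hε : 0 < ε) :
    ∫ y, (1 - (1 - M.π θ y x.1)⁻¹) ∂kernel₀ M η x = 1 - M.oddsIntegral θ η x := by
  have := hx.prob₀
  rw [integral_sub (integrable_const 1) (hx.integrable_inv hε), ← oddsIntegral_eq hη]
  simp

/-- With e the `outcomeMean` of c, the arm means are -e and (D - 1)⁻¹ e. In `defect₃` the
(1-π)⁻¹-weighted integrals of c and of the constant e both equal D e and cancel. -/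
theorem defects_of_score₀ (hx : IsRegularPoint M θ η ε x) (hη : η.IsDensity M) (hε : 0 < ε)
    {c : ℝ → 𝒰 × 𝒵 → E} (hc : Integrable (fun y => c y x) (kernel₀ M η x))
    (h0 : ∫ y, c y x ∂kernel₀ M η x = 0)
    (hq : ∀ᵐ y ∂kernel₀ M η x, h (false, y, x) = score₀ M θ η c (false, y, x))
    (hp : ∀ᵐ y ∂kernel₁ M η x, h (true, y, x) = score₀ M θ η c (true, y, x)) :
    (∀ᵐ y ∂kernel₁ M η x, defect₁ M η h y x = 0) ∧ defect₂ M θ η h x = 0 ∧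
      defect₃ M θ η h x = 0 := by
  have := hx.prob₀
  have := hx.prob₁
  have hD := hx.odds_pos
  have hD1 := hx.odds_sub_one_pos
  simp only [score₀, Bool.false_eq_true, if_false, if_true] at hq hp
  have m0 := armMean₀_congr hq
  have m1 := armMean₁_congr hp
  rw [integral_sub hc (integrable_const _), h0] at m0
  simp only [integral_const, probReal_univ, one_smul, zero_sub] at m0 m1
  have m1' : (M.oddsIntegral θ η x - 1) • armMean₁ M η h x = outcomeMean M θ η c x := by
    rw [m1, smul_inv_smul₀ hD1.ne']
  refine ⟨?_, ?_, ?_⟩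
  · filter_upwards [hp] with y hy
    rw [defect₁, hy, m1, sub_self]
  · rw [defect₂, m1', m0, neg_add_cancel]
  · have hce : Integrable (fun y => c y x - outcomeMean M θ η c x) (kernel₀ M η x) :=
      hc.sub (integrable_const _)
    rw [defect₃_congr hq, m1', hx.integral_one_sub_inv_smul hε hce,
      integral_sub hc (integrable_const _), h0]
    simp_rw [smul_sub]
    rw [integral_sub (hx.integrable_inv_smul hε hc) (hx.integrable_inv_smul hε
      (integrable_const _)), integral_inv_smul_const hη]
    have : ∫ y, (1 - M.π θ y x.1)⁻¹ • c y x ∂kernel₀ M η x =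
        M.oddsIntegral θ η x • outcomeMean M θ η c x := by
      rw [outcomeMean, smul_inv_smul₀ hD.ne']
    rw [this]
    simp

theorem defects_of_score₂ (hx : IsRegularPoint M θ η ε x) (hη : η.IsDensity M) (hε : 0 < ε)
    {a : 𝒰 × 𝒵 → E}
    (hq : ∀ᵐ y ∂kernel₀ M η x, h (false, y, x) = score₂ a (false, y, x))
    (hp : ∀ᵐ y ∂kernel₁ M η x, h (true, y, x) = score₂ a (true, y, x)) :
    (∀ᵐ y ∂kernel₀ M η x, defect₀ M θ η h y x = 0) ∧
      (∀ᵐ y ∂kernel₁ M η x, defect₁ M η h y x = 0) ∧ defect₃ M θ η h x = 0 := by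
  have := hx.prob₀
  have := hx.prob₁
  simp only [score₂] at hq hp
  have m0 := armMean₀_congr hq
  have m1 := armMean₁_congr hp
  simp only [integral_const, probReal_univ, one_smul] at m0 m1
  refine ⟨?_, ?_, ?_⟩
  · filter_upwards [hq] with y hy
    simp [defect₀, hy, m0, m1]
  · filter_upwards [hp] with y hy
    simp [defect₁, hy, m1]
  · rw [defect₃_congr hq, m1, integral_smul_const, hx.integral_one_sub_inv hη hε]
    module

theorem defects_of_residual (hx : IsRegularPoint M θ η ε x) (hη : η.IsDensity M) (hε : 0 < ε)
    {g : 𝒰 × 𝒵 → E}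
    (hq : ∀ᵐ y ∂kernel₀ M η x, h (false, y, x) = residual M θ g (false, y, x))
    (hp : ∀ᵐ y ∂kernel₁ M η x, h (true, y, x) = residual M θ g (true, y, x)) :
    (∀ᵐ y ∂kernel₀ M η x, defect₀ M θ η h y x = 0) ∧
      (∀ᵐ y ∂kernel₁ M η x, defect₁ M η h y x = 0) ∧ defect₂ M θ η h x = 0 := by
  have := hx.prob₁
  have hD := hx.odds_pos
  simp only [residual, Bool.false_eq_true, if_false, if_true] at hq hp
  have m0 := armMean₀_congr hq
  have m1 := armMean₁_congr hp
  rw [integral_smul_const, hx.integral_one_sub_inv hη hε] at m0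
  simp only [integral_const, probReal_univ, one_smul] at m1
  refine ⟨?_, ?_, ?_⟩
  · filter_upwards [hq] with y hy
    have : g x - (1 - M.oddsIntegral θ η x) • g x = M.oddsIntegral θ η x • g x := by module
    rw [defect₀, hy, m0, m1, this, inv_smul_smul₀ hD.ne']
    module
  · filter_upwards [hp] with y hy
    simp [defect₁, hy, m1]
  · rw [defect₂, m0, m1]
    module

/-- Subtracting `defect₃` from `defect₂` shows that h(0, ·) has zero (1-π)⁻¹-weighted mean. So
centring h(0, ·) produces a direction whose `outcomeMean` is -`armMean₀`, exactly the term that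
restores h(0, ·). The arm t = 1 is constant in y by `defect₁`, with the value forced by `defect₂`.
-/
theorem eq_score₀_of_defects (hx : IsRegularPoint M θ η ε x) (hη : η.IsDensity M) (hε : 0 < ε)
    (hq : Integrable (fun y => h (false, y, x)) (kernel₀ M η x))
    (h1 : ∀ᵐ y ∂kernel₁ M η x, defect₁ M η h y x = 0) (h2 : defect₂ M θ η h x = 0)
    (h3 : defect₃ M θ η h x = 0) {c : ℝ → 𝒰 × 𝒵 → E}
    (hc : ∀ y, c y x = h (false, y, x) - armMean₀ M η h x) :
    ∫ y, c y x ∂kernel₀ M η x = 0 ∧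
      (∀ᵐ y ∂kernel₀ M η x, h (false, y, x) = score₀ M θ η c (false, y, x)) ∧
      (∀ᵐ y ∂kernel₁ M η x, h (true, y, x) = score₀ M θ η c (true, y, x)) := by
  have := hx.prob₀
  have hD := hx.odds_pos
  have hD1 := hx.odds_sub_one_pos
  have e1 : ∫ y, (1 - M.π θ y x.1)⁻¹ • h (false, y, x) ∂kernel₀ M η x = 0 := by
    rw [defect₃, hx.integral_one_sub_inv_smul hε hq] at h3
    rw [defect₂] at h2
    change armMean₀ M η h x - _ + _ = 0 at h3
    have : ∀ u v w : E, u - v + w = 0 → u + w = 0 → v = 0 := fun u v w a b => by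
      rw [sub_add_eq_add_sub, b, zero_sub, neg_eq_zero] at a; exact a
    exact this _ _ _ h3 h2
  have e2 : outcomeMean M θ η c x = -armMean₀ M η h x := by
    simp_rw [outcomeMean, hc, smul_sub]
    rw [integral_sub (hx.integrable_inv_smul hε hq) (hx.integrable_inv_smul hε
      (integrable_const _)), e1, integral_inv_smul_const hη, zero_sub, smul_neg,
      inv_smul_smul₀ hD.ne']
  refine ⟨?_, ?_, ?_⟩
  · simp_rw [hc]
    rw [integral_sub hq (integrable_const _)]
    simp [armMean₀]
  · refine .of_forall fun y => ?_
    simp [score₀, hc, e2]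
  · filter_upwards [h1] with y hy
    rw [defect₁, sub_eq_zero] at hy
    simp only [score₀, if_true]
    rw [hy, e2, ← eq_neg_of_add_eq_zero_right h2, inv_smul_smul₀ hD1.ne']

/-- Substituting h(0, ·) = (1 - (1-π)⁻¹) `armMean₁` into `defect₃` leaves `armMean₁` times the
integral of a square plus D - 1, a positive number. The same fact characterises scores for f₁ and
gives totality of the four families. -/
theorem eq_zero_of_defects (hx : IsRegularPoint M θ η ε x)
    (h0 : ∀ᵐ y ∂kernel₀ M η x, defect₀ M θ η h y x = 0) (h2 : defect₂ M θ η h x = 0)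
    (h3 : defect₃ M θ η h x = 0) :
    armMean₁ M η h x = 0 ∧ ∀ᵐ y ∂kernel₀ M η x, h (false, y, x) = 0 := by
  have hD1 := hx.odds_sub_one_pos
  have hq := hx.armMean₁_eq_of_defects h0 h2
  have e := defect₃_congr (θ := θ) hq
  simp_rw [h3, smul_smul] at e
  rw [integral_smul_const, ← add_smul] at e
  have hpos : 0 < ∫ y, (1 - (1 - M.π θ y x.1)⁻¹) * (1 - (1 - M.π θ y x.1)⁻¹) ∂kernel₀ M η x +
      (M.oddsIntegral θ η x - 1) :=
    add_pos_of_nonneg_of_pos (integral_nonneg fun y => mul_self_nonneg _) hD1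
  have m1 := (smul_eq_zero.1 e.symm).resolve_left hpos.ne'
  refine ⟨m1, ?_⟩
  filter_upwards [hq] with y hy
  rw [hy, m1, smul_zero]

/-- By `defect₀`, h(0, ·) is `armMean₁` minus (1-π)⁻¹ k for a vector k. In `defect₃` the `armMean₁`
terms cancel and a scalar multiple of k remains. -/
theorem eq_score₂_of_defects (hx : IsRegularPoint M θ η ε x) (hη : η.IsDensity M) (hε : 0 < ε)
    (h0 : ∀ᵐ y ∂kernel₀ M η x, defect₀ M θ η h y x = 0)
    (h3 : defect₃ M θ η h x = 0) :
    ∀ᵐ y ∂kernel₀ M η x, h (false, y, x) = armMean₁ M η h x := by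
  have := hx.prob₀
  have hD1 := hx.odds_sub_one_pos
  set k := (M.oddsIntegral θ η x)⁻¹ • (armMean₁ M η h x - armMean₀ M η h x) with hk
  have hq : ∀ᵐ y ∂kernel₀ M η x,
      h (false, y, x) = armMean₁ M η h x - (1 - M.π θ y x.1)⁻¹ • k := by
    filter_upwards [h0] with y hy
    rw [defect₀, ← hk] at hy
    rw [← sub_eq_zero, ← hy]
    module
  have e := defect₃_congr (θ := θ) hq
  have hi : Integrable (fun y => (1 - (1 - M.π θ y x.1)⁻¹) * (1 - M.π θ y x.1)⁻¹)
      (kernel₀ M η x) := by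
    have := hx.integrable_inv_smul hε (hx.integrable_one_sub_inv hε)
    simpa only [smul_eq_mul, mul_comm] using this
  simp_rw [h3, smul_sub, smul_smul] at e
  rw [integral_sub ((hx.integrable_one_sub_inv hε).smul_const _) (hi.smul_const _),
    integral_smul_const, integral_smul_const, hx.integral_one_sub_inv hη hε] at e
  -- Since (1-π)⁻¹ > 1 and 1 - (1-π)⁻¹ < 0, the product lies below the second factor, whose mean is
  -- 1 - D < 0.
  have hneg : ∫ y, (1 - (1 - M.π θ y x.1)⁻¹) * (1 - M.π θ y x.1)⁻¹ ∂kernel₀ M η x < 0 := by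
    have : ∫ y, (1 - (1 - M.π θ y x.1)⁻¹) * (1 - M.π θ y x.1)⁻¹ ∂kernel₀ M η x ≤
        ∫ y, (1 - (1 - M.π θ y x.1)⁻¹) ∂kernel₀ M η x := by
      refine integral_mono_ae hi (hx.integrable_one_sub_inv hε) ?_
      filter_upwards [hx.inv_bounds hε] with y hy
      nlinarith [hy.1]
    rw [hx.integral_one_sub_inv hη hε] at this
    linarith
  set I := ∫ y, (1 - (1 - M.π θ y x.1)⁻¹) * (1 - M.π θ y x.1)⁻¹ ∂kernel₀ M η x with hI
  have e' : I • k = 0 := by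
    have : (1 - M.oddsIntegral θ η x) • armMean₁ M η h x - I • k +
      (M.oddsIntegral θ η x - 1) • armMean₁ M η h x = -(I • k) := by module
    rw [this] at e
    exact neg_eq_zero.1 e.symm
  have hk0 := (smul_eq_zero.1 e').resolve_left hneg.ne
  filter_upwards [hq] with y hy
  rw [hy, hk0, smul_zero, sub_zero]

end IsRegularPoint

end Pointwise

/-! ### Square integrability of conditional means -/

section Square

variable [CompleteSpace E]

variable {𝒳 : Type*} [MeasurableSpace 𝒳] {m : Measure 𝒳} {κ : Kernel 𝒳 ℝ}
  [IsSFiniteKernel κ]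

theorem fst_compProd_of_ae [SFinite m] (hκ : ∀ᵐ x ∂m, IsProbabilityMeasure (κ x)) :
    (m ⊗ₘ κ).map Prod.fst = m := by
  refine Measure.ext fun A hA => ?_
  rw [Measure.map_apply measurable_fst hA, ← Set.prod_univ, Measure.compProd_apply_prod hA .univ]
  have : ∫⁻ x in A, κ x Set.univ ∂m = ∫⁻ x in A, 1 ∂m :=
    lintegral_congr_ae (ae_restrict_of_ae (hκ.mono fun x hx => hx.measure_univ))
  rw [this, setLIntegral_one]

/-- On the product space the fibre mean is the conditional expectation given the first coordinate,
which preserves square integrability. -/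
theorem memLp_integral_kernel [IsFiniteMeasure m] (hκ : ∀ᵐ x ∂m, IsProbabilityMeasure (κ x))
    {c : ℝ → 𝒳 → E} (hc : StronglyMeasurable fun p : 𝒳 × ℝ => c p.2 p.1)
    (hL : MemLp (fun p : 𝒳 × ℝ => c p.2 p.1) 2 (m ⊗ₘ κ)) :
    MemLp (fun p : 𝒳 × ℝ => ∫ y, c y p.1 ∂κ p.1) 2 (m ⊗ₘ κ) := by
  have hf := fst_compProd_of_ae hκ
  have : IsFiniteMeasure (m ⊗ₘ κ) := ⟨by
    have h : (m ⊗ₘ κ).map Prod.fst Set.univ = m Set.univ := by rw [hf]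
    rw [Measure.map_apply measurable_fst .univ, Set.preimage_univ] at h
    rw [h]; exact measure_lt_top _ _⟩
  refine (memLp_congr_ae (condExp_ae_eq_integral_kernel measurable_fst measurable_snd ?_ hc
    (hL.integrable one_le_two))).1 (hL.condExp one_le_two)
  rw [hf]
  exact Measure.map_id

end Square

/-! ### Scores and residuals characterised by three vanishing defects -/

section Representation

variable (M : Model d 𝒰 𝒵) (θ : EuclideanSpace ℝ (Fin d)) (η : Nuisance 𝒰 𝒵)

/-- `h` is a score for `f₀`, in a square integrable direction. -/
def IsScore₀ (h : Obs 𝒰 𝒵 → E) : Prop :=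
  ∃ c : ℝ → 𝒰 × 𝒵 → E, StronglyMeasurable (fun p : (𝒰 × 𝒵) × ℝ => c p.2 p.1) ∧
    MemLp (fun p : (𝒰 × 𝒵) × ℝ => c p.2 p.1) 2 (covLaw₀ M θ η ⊗ₘ kernel₀ M η) ∧
    (∀ᵐ x ∂covLaw M η, ∫ y, c y x ∂kernel₀ M η x = 0) ∧ h =ᵐ[obsLaw M θ η] score₀ M θ η c

/-- `h` is a score for `f₁`, in a square integrable direction. -/
def IsScore₁ (h : Obs 𝒰 𝒵 → E) : Prop :=
  ∃ b : ℝ → 𝒰 × 𝒵 → E, StronglyMeasurable (fun p : (𝒰 × 𝒵) × ℝ => b p.2 p.1) ∧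
    MemLp (fun p : (𝒰 × 𝒵) × ℝ => b p.2 p.1) 2 (covLaw₁ M θ η ⊗ₘ kernel₁ M η) ∧
    (∀ᵐ x ∂covLaw M η, ∫ y, b y x ∂kernel₁ M η x = 0) ∧ h =ᵐ[obsLaw M θ η] score₁ b

/-- `h` is a function of the covariates. -/
def IsScore₂ (h : Obs 𝒰 𝒵 → E) : Prop :=
  ∃ a : 𝒰 × 𝒵 → E, StronglyMeasurable a ∧ h =ᵐ[obsLaw M θ η] score₂ a

/-- `h` is `(t - π) / (1 - π)` times a function of the covariates. -/
def IsResidual (h : Obs 𝒰 𝒵 → E) : Prop :=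
  ∃ g : 𝒰 × 𝒵 → E, StronglyMeasurable g ∧ h =ᵐ[obsLaw M θ η] residual M θ g

variable {M θ η}

theorem ae_obsLaw_eq_iff (hη : η.IsDensity M) (hreg : ∀ᵐ x ∂M.ν, IsRegularPoint M θ η ε x)
    {h : Obs 𝒰 𝒵 → F} (hh : StronglyMeasurable h) {ψ : Obs 𝒰 𝒵 → F} (hψ : StronglyMeasurable ψ) :
    h =ᵐ[obsLaw M θ η] ψ ↔ ∀ᵐ x ∂covLaw M η,
      (∀ᵐ y ∂kernel₀ M η x, h (false, y, x) = ψ (false, y, x)) ∧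
        ∀ᵐ y ∂kernel₁ M η x, h (true, y, x) = ψ (true, y, x) :=
  ⟨fun he => ae_of_ae_obsLaw hη hreg (p := fun o => h o = ψ o) he,
    fun H => ae_obsLaw_of_ae hη hreg (p := fun o => h o = ψ o) (hh.measurableSet_eq_fun hψ) H⟩

theorem memLp_arm {t : Bool} {h : Obs 𝒰 𝒵 → F} (hL : MemLp h 2 (obsLaw M θ η)) :
    MemLp (fun p => h (mkObs t p)) 2 (if t then covLaw₁ M θ η ⊗ₘ kernel₁ M η
      else covLaw₀ M θ η ⊗ₘ kernel₀ M η) := by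
  have hle : ((if t then covLaw₁ M θ η ⊗ₘ kernel₁ M η
      else covLaw₀ M θ η ⊗ₘ kernel₀ M η).map (mkObs t)) ≤ obsLaw M θ η := by
    cases t
    · exact Measure.le_add_right le_rfl
    · exact Measure.le_add_left le_rfl
  exact (hL.mono_measure hle).comp_of_map (measurable_mkObs t).aemeasurable

variable {h : Obs 𝒰 𝒵 → E}

theorem isFiniteMeasure_covLaw₀ (hη : η.IsDensity M)
    (hreg : ∀ᵐ x ∂M.ν, IsRegularPoint M θ η ε x) : IsFiniteMeasure (covLaw₀ M θ η) := by
  have := isProbabilityMeasure_covLaw hη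
  refine ⟨?_⟩
  rw [covLaw₀, withDensity_apply _ .univ, Measure.restrict_univ]
  calc ∫⁻ x, ENNReal.ofReal (M.oddsIntegral θ η x)⁻¹ ∂covLaw M η ≤ ∫⁻ _, 1 ∂covLaw M η := by
        refine lintegral_mono_ae ?_
        filter_upwards [ae_inv_odds_pos hreg] with x hx
        exact ENNReal.ofReal_le_one.2 (by linarith)
    _ < ⊤ := by simp

variable [CompleteSpace E]

/-- The direction is recovered as h(0, ·) minus its fibre mean; both terms are square integrable on
the arm, the second by `memLp_integral_kernel`. -/
theorem isScore₀_iff (hη : η.IsDensity M) (hε : 0 < ε)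
    (hreg : ∀ᵐ x ∂M.ν, IsRegularPoint M θ η ε x)
    (hh : StronglyMeasurable h) (hL : MemLp h 2 (obsLaw M θ η)) :
    IsScore₀ M θ η h ↔ (∀ᵐ x ∂covLaw M η, ∀ᵐ y ∂kernel₁ M η x, defect₁ M η h y x = 0) ∧
      (∀ᵐ x ∂covLaw M η, defect₂ M θ η h x = 0) ∧ ∀ᵐ x ∂covLaw M η, defect₃ M θ η h x = 0 := by
  have hac : ∀ᵐ x ∂covLaw M η, IsRegularPoint M θ η ε x :=
    covLaw_absolutelyContinuous.ae_le hreg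
  have hp := isProbabilityMeasure_obsLaw hη hreg
  have hf := isFiniteMeasure_covLaw₀ hη hreg
  have hκ : ∀ᵐ x ∂covLaw₀ M θ η, IsProbabilityMeasure (kernel₀ M η x) :=
    (ae_covLaw₀_iff hη hreg).2 (hac.mono fun x hx => hx.prob₀)
  rw [← eventually_and, ← eventually_and]
  constructor
  · rintro ⟨c, hc, hcL, hc0, he⟩
    rw [ae_obsLaw_eq_iff hη hreg hh (stronglyMeasurable_score₀ hη hc)] at he
    have hfm : IsFiniteMeasure (covLaw₀ M θ η ⊗ₘ kernel₀ M η) := ⟨by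
      have h : (covLaw₀ M θ η ⊗ₘ kernel₀ M η).map Prod.fst Set.univ = covLaw₀ M θ η Set.univ := by
        rw [fst_compProd_of_ae hκ]
      rw [Measure.map_apply measurable_fst .univ, Set.preimage_univ] at h
      rw [h]; exact measure_lt_top _ _⟩
    have hi := ((Measure.integrable_compProd_iff hcL.1).1 (hcL.integrable one_le_two)).1
    rw [ae_covLaw₀_iff hη hreg] at hi
    filter_upwards [hac, hc0, he, hi] with x hx h0 hex hix
    exact hx.defects_of_score₀ hη hε hix h0 hex.1 hex.2
  · intro H
    have hq : MemLp (fun p : (𝒰 × 𝒵) × ℝ => h (false, p.2, p.1)) 2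
      (covLaw₀ M θ η ⊗ₘ kernel₀ M η) := memLp_arm (t := false) hL
    have hqm := stronglyMeasurable_arm hh false
    have hm := stronglyMeasurable_armMean₀ (M := M) (η := η) hh
    have hc : StronglyMeasurable fun p : (𝒰 × 𝒵) × ℝ =>
        h (false, p.2, p.1) - armMean₀ M η h p.1 :=
      hqm.sub (hm.comp_measurable measurable_fst)
    have key := (hac.and (H.and (ae_integrable_of_integrable_obsLaw hη hreg
      (hL.integrable one_le_two)))).mono fun x hx =>
        hx.1.eq_score₀_of_defects hη hε hx.2.2.1 hx.2.1.1 hx.2.1.2.1 hx.2.1.2.2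
          (c := fun y x => h (false, y, x) - armMean₀ M η h x) fun y => rfl
    refine ⟨fun y x => h (false, y, x) - armMean₀ M η h x, hc, ?_, key.mono fun x hx => hx.1, ?_⟩
    · exact hq.sub (memLp_integral_kernel hκ (c := fun y x => h (false, y, x)) hqm hq)
    · rw [ae_obsLaw_eq_iff hη hreg hh (stronglyMeasurable_score₀ hη hc)]
      exact key.mono fun x hx => hx.2

theorem isScore₁_iff (hη : η.IsDensity M)
    (hreg : ∀ᵐ x ∂M.ν, IsRegularPoint M θ η ε x)
    (hh : StronglyMeasurable h) (hL : MemLp h 2 (obsLaw M θ η)) :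
    IsScore₁ M θ η h ↔ (∀ᵐ x ∂covLaw M η, ∀ᵐ y ∂kernel₀ M η x, defect₀ M θ η h y x = 0) ∧
      (∀ᵐ x ∂covLaw M η, defect₂ M θ η h x = 0) ∧ ∀ᵐ x ∂covLaw M η, defect₃ M θ η h x = 0 := by
  have hac : ∀ᵐ x ∂covLaw M η, IsRegularPoint M θ η ε x :=
    covLaw_absolutelyContinuous.ae_le hreg
  rw [← eventually_and, ← eventually_and]
  constructor
  · rintro ⟨b, hb, -, hb0, he⟩
    rw [ae_obsLaw_eq_iff hη hreg hh (stronglyMeasurable_score₁ hb)] at he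
    filter_upwards [hac, hb0, he] with x hx h0 hex
    exact IsRegularPoint.defects_of_score₁ h0 hex.1 hex.2
  · intro H
    have hbm := stronglyMeasurable_arm hh true
    have key : ∀ᵐ x ∂covLaw M η, armMean₁ M η h x = 0 ∧
        ∀ᵐ y ∂kernel₀ M η x, h (false, y, x) = 0 := by
      filter_upwards [hac, H] with x hx hHx
      exact hx.eq_zero_of_defects hHx.1 hHx.2.1 hHx.2.2
    refine ⟨fun y x => h (true, y, x), hbm, memLp_arm (t := true) hL,
      key.mono fun x hx => hx.1, ?_⟩
    rw [ae_obsLaw_eq_iff hη hreg hh (stronglyMeasurable_score₁ hbm)]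
    filter_upwards [key] with x hx
    exact ⟨hx.2, .of_forall fun y => rfl⟩

theorem isScore₂_iff (hη : η.IsDensity M) (hε : 0 < ε)
    (hreg : ∀ᵐ x ∂M.ν, IsRegularPoint M θ η ε x) (hh : StronglyMeasurable h) :
    IsScore₂ M θ η h ↔ (∀ᵐ x ∂covLaw M η, ∀ᵐ y ∂kernel₀ M η x, defect₀ M θ η h y x = 0) ∧
      (∀ᵐ x ∂covLaw M η, ∀ᵐ y ∂kernel₁ M η x, defect₁ M η h y x = 0) ∧
      ∀ᵐ x ∂covLaw M η, defect₃ M θ η h x = 0 := by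
  have hac : ∀ᵐ x ∂covLaw M η, IsRegularPoint M θ η ε x :=
    covLaw_absolutelyContinuous.ae_le hreg
  rw [← eventually_and, ← eventually_and]
  constructor
  · rintro ⟨a, ha, he⟩
    rw [ae_obsLaw_eq_iff hη hreg hh (stronglyMeasurable_score₂ ha)] at he
    filter_upwards [hac, he] with x hx hex
    exact hx.defects_of_score₂ hη hε hex.1 hex.2
  · intro H
    have hm := stronglyMeasurable_armMean₁ (M := M) (η := η) hh
    refine ⟨armMean₁ M η h, hm, ?_⟩
    rw [ae_obsLaw_eq_iff hη hreg hh (stronglyMeasurable_score₂ hm)]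
    filter_upwards [hac, H] with x hx hHx
    exact ⟨hx.eq_score₂_of_defects hη hε hHx.1 hHx.2.2,
      hHx.2.1.mono fun y hy => sub_eq_zero.1 hy⟩

/-- As for functions of the covariates alone, the witness is `armMean₁`: on the arm t = 1 the
residual is g itself. -/
theorem isResidual_iff (hη : η.IsDensity M) (hε : 0 < ε)
    (hreg : ∀ᵐ x ∂M.ν, IsRegularPoint M θ η ε x) (hh : StronglyMeasurable h) :
    IsResidual M θ η h ↔ (∀ᵐ x ∂covLaw M η, ∀ᵐ y ∂kernel₀ M η x, defect₀ M θ η h y x = 0) ∧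
      (∀ᵐ x ∂covLaw M η, ∀ᵐ y ∂kernel₁ M η x, defect₁ M η h y x = 0) ∧
      ∀ᵐ x ∂covLaw M η, defect₂ M θ η h x = 0 := by
  have hac : ∀ᵐ x ∂covLaw M η, IsRegularPoint M θ η ε x :=
    covLaw_absolutelyContinuous.ae_le hreg
  rw [← eventually_and, ← eventually_and]
  constructor
  · rintro ⟨g, hg, he⟩
    rw [ae_obsLaw_eq_iff hη hreg hh (stronglyMeasurable_residual hg)] at he
    filter_upwards [hac, he] with x hx hex
    exact hx.defects_of_residual hη hε hex.1 hex.2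
  · intro H
    have hm := stronglyMeasurable_armMean₁ (M := M) (η := η) hh
    refine ⟨armMean₁ M η h, hm, ?_⟩
    rw [ae_obsLaw_eq_iff hη hreg hh (stronglyMeasurable_residual hm)]
    filter_upwards [hac, H] with x hx hHx
    exact ⟨hx.armMean₁_eq_of_defects hHx.1 hHx.2.2,
      hHx.2.1.mono fun y hy => sub_eq_zero.1 hy⟩

theorem ae_eq_zero_of_defects (hη : η.IsDensity M)
    (hreg : ∀ᵐ x ∂M.ν, IsRegularPoint M θ η ε x) (hh : StronglyMeasurable h)
    (h0 : ∀ᵐ x ∂covLaw M η, ∀ᵐ y ∂kernel₀ M η x, defect₀ M θ η h y x = 0)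
    (h1 : ∀ᵐ x ∂covLaw M η, ∀ᵐ y ∂kernel₁ M η x, defect₁ M η h y x = 0)
    (h2 : ∀ᵐ x ∂covLaw M η, defect₂ M θ η h x = 0)
    (h3 : ∀ᵐ x ∂covLaw M η, defect₃ M θ η h x = 0) : h =ᵐ[obsLaw M θ η] 0 := by
  rw [ae_obsLaw_eq_iff hη hreg hh stronglyMeasurable_zero]
  filter_upwards [covLaw_absolutelyContinuous.ae_le hreg, h0, h1, h2, h3] with x hx a0 a1 a2 a3
  obtain ⟨m1, hq⟩ := hx.eq_zero_of_defects a0 a2 a3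
  refine ⟨hq, a1.mono fun y hy => ?_⟩
  rw [defect₁, m1, sub_zero] at hy
  exact hy

end Representation

end ATT

namespace ATT

/-! ### The explicit subspaces in terms of scores -/

variable {d : ℕ} {Ω 𝒰 𝒵 : Type*} [MeasurableSpace Ω] [MeasurableSpace 𝒰] [MeasurableSpace 𝒵]
variable {M : Model d 𝒰 𝒵} {D : PotentialOutcomes Ω 𝒰 𝒵} {P : Measure Ω}
  {θ : EuclideanSpace ℝ (Fin d)} {η : Nuisance 𝒰 𝒵} {ε : ℝ}

theorem measurable_iff_stronglyMeasurable_swap {c : ℝ → 𝒰 × 𝒵 → EuclideanSpace ℝ (Fin d)} :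
    Measurable (fun p : ℝ × (𝒰 × 𝒵) => c p.1 p.2) ↔
      StronglyMeasurable fun p : (𝒰 × 𝒵) × ℝ => c p.2 p.1 :=
  ⟨fun h => (h.comp measurable_swap).stronglyMeasurable, fun h => h.measurable.comp measurable_swap⟩

theorem W_of_false {ω : Ω} (h : D.T ω = false) : D.W ω = (false, D.Y₀ ω, D.X ω) := by
  simp [PotentialOutcomes.W, h, ind]

theorem W_of_true {ω : Ω} (h : D.T ω = true) : D.W ω = (true, D.Y₁ ω, D.X ω) := by
  simp [PotentialOutcomes.W, h, ind]

theorem ae_given_iff [IsProbabilityMeasure P] {t : Bool} {p : Ω → Prop} :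
    (∀ᵐ ω ∂D.given P t, p ω) ↔ ∀ᵐ ω ∂P.restrict (D.T ⁻¹' {t}), p ω := by
  rw [PotentialOutcomes.given, ProbabilityTheory.cond, Measure.ae_ennreal_smul_measure_iff]
  simp

theorem memLp_given_iff [IsProbabilityMeasure P] {t : Bool} (h0 : P (D.T ⁻¹' {t}) ≠ 0)
    {E : Type*} [NormedAddCommGroup E] {u : Ω → E} :
    MemLp u 2 (D.given P t) ↔ MemLp u 2 (P.restrict (D.T ⁻¹' {t})) := by
  constructor
  · intro h
    rw [← smul_given]
    exact h.smul_measure (measure_ne_top _ _)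
  · intro h
    rw [PotentialOutcomes.given, ProbabilityTheory.cond]
    exact h.smul_measure (ENNReal.inv_ne_top.2 h0)

theorem ae_eq_map_W_iff {h ψ : Obs 𝒰 𝒵 → EuclideanSpace ℝ (Fin d)} (hh : StronglyMeasurable h)
    (hψ : StronglyMeasurable ψ) :
    (fun ω => h (D.W ω)) =ᵐ[P] (fun ω => ψ (D.W ω)) ↔ h =ᵐ[P.map D.W] ψ :=
  (ae_map_iff (p := fun o => h o = ψ o) D.measurable_W.aemeasurable
    (hh.measurableSet_eq_fun hψ)).symm

namespace FollowsModel

theorem ae_X (h : FollowsModel M D P θ η) {p : 𝒰 × 𝒵 → Prop} (hp : ∀ᵐ x ∂covLaw M η, p x) :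
    ∀ᵐ ω ∂P, p (D.X ω) :=
  ae_of_ae_map D.measurable_X.aemeasurable (h.map_X ▸ hp)

/-- The law of X on each arm has the same null sets as the law of X, so an arm of probability zero
would make the latter vanish. -/
theorem treatment_ne_zero (h : FollowsModel M D P θ η) [IsProbabilityMeasure P] (hε : 0 < ε)
    (hπ : ∀ᵐ p ∂(M.ν.prod M.μ₀), 0 < M.π θ p.2 p.1.1 ∧ M.π θ p.2 p.1.1 ≤ 1 - ε) (t : Bool) :
    P (D.T ⁻¹' {t}) ≠ 0 := by
  have hreg := ae_isRegularPoint h.isDensity hε hπ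
  have hcov := isProbabilityMeasure_covLaw h.isDensity
  intro h0
  have hR : P.restrict (D.T ⁻¹' {t}) = 0 := Measure.restrict_eq_zero.2 h0
  have hF : ∀ᵐ x ∂covLaw M η, False := by
    cases t
    · rw [← ae_covLaw₀_iff h.isDensity hreg, ← h.map_X_restrict_false hε hπ, hR]
      simp
    · rw [← ae_covLaw₁_iff h.isDensity hreg, ← h.map_X_restrict_true hε hπ, hR]
      simp
  rw [ae_iff] at hF
  simp at hF

theorem condExp_given_false_iff (h : FollowsModel M D P θ η) [IsProbabilityMeasure P] (hε : 0 < ε)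
    (hπ : ∀ᵐ p ∂(M.ν.prod M.μ₀), 0 < M.π θ p.2 p.1.1 ∧ M.π θ p.2 p.1.1 ≤ 1 - ε)
    {c : ℝ → 𝒰 × 𝒵 → EuclideanSpace ℝ (Fin d)}
    (hc : StronglyMeasurable fun p : (𝒰 × 𝒵) × ℝ => c p.2 p.1)
    (hL : MemLp (fun ω => c (D.Y₀ ω) (D.X ω)) 2 (D.given P false)) :
    (D.given P false)[fun ω => c (D.Y₀ ω) (D.X ω) | D.sigmaX] =ᵐ[D.given P false] 0 ↔
      ∀ᵐ x ∂covLaw M η, ∫ y, c y x ∂kernel₀ M η x = 0 := by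
  have hreg := ae_isRegularPoint h.isDensity hε hπ
  have e := condExp_ae_eq_integral_kernel D.measurable_X D.measurable_Y₀ h.map_given_false hc
    (hL.integrable one_le_two)
  have hI : StronglyMeasurable fun x => ∫ y, c y x ∂kernel₀ M η x :=
    hc.integral_kernel_prod_right'
  rw [← ae_covLaw₀_iff h.isDensity hreg, ← h.map_X_restrict_false hε hπ,
    ae_map_iff D.measurable_X.aemeasurable
      (hI.measurableSet_eq_fun stronglyMeasurable_const), ← ae_given_iff]
  exact ⟨fun h1 => e.symm.trans h1, fun h1 => e.trans h1⟩

theorem condExp_given_true_iff (h : FollowsModel M D P θ η) [IsProbabilityMeasure P] (hε : 0 < ε)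
    (hπ : ∀ᵐ p ∂(M.ν.prod M.μ₀), 0 < M.π θ p.2 p.1.1 ∧ M.π θ p.2 p.1.1 ≤ 1 - ε)
    {b : ℝ → 𝒰 × 𝒵 → EuclideanSpace ℝ (Fin d)}
    (hb : StronglyMeasurable fun p : (𝒰 × 𝒵) × ℝ => b p.2 p.1)
    (hL : MemLp (fun ω => b (D.Y₁ ω) (D.X ω)) 2 (D.given P true)) :
    (D.given P true)[fun ω => b (D.Y₁ ω) (D.X ω) | D.sigmaX] =ᵐ[D.given P true] 0 ↔
      ∀ᵐ x ∂covLaw M η, ∫ y, b y x ∂kernel₁ M η x = 0 := by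
  have hreg := ae_isRegularPoint h.isDensity hε hπ
  have e := condExp_ae_eq_integral_kernel D.measurable_X D.measurable_Y₁ h.map_given_true hb
    (hL.integrable one_le_two)
  have hI : StronglyMeasurable fun x => ∫ y, b y x ∂kernel₁ M η x :=
    hb.integral_kernel_prod_right'
  rw [← ae_covLaw₁_iff h.isDensity hreg, ← h.map_X_restrict_true hε hπ,
    ae_map_iff D.measurable_X.aemeasurable
      (hI.measurableSet_eq_fun stronglyMeasurable_const), ← ae_given_iff]
  exact ⟨fun h1 => e.symm.trans h1, fun h1 => e.trans h1⟩

theorem memLp_given_false_iff (h : FollowsModel M D P θ η) [IsProbabilityMeasure P] (hε : 0 < ε)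
    (hπ : ∀ᵐ p ∂(M.ν.prod M.μ₀), 0 < M.π θ p.2 p.1.1 ∧ M.π θ p.2 p.1.1 ≤ 1 - ε)
    {c : ℝ → 𝒰 × 𝒵 → EuclideanSpace ℝ (Fin d)}
    (hc : StronglyMeasurable fun p : (𝒰 × 𝒵) × ℝ => c p.2 p.1) :
    MemLp (fun ω => c (D.Y₀ ω) (D.X ω)) 2 (D.given P false) ↔
      MemLp (fun p : (𝒰 × 𝒵) × ℝ => c p.2 p.1) 2 (covLaw₀ M θ η ⊗ₘ kernel₀ M η) := by
  rw [memLp_given_iff (h.treatment_ne_zero hε hπ false), ← h.map_X_restrict_false hε hπ,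
    ← map_restrict_eq_compProd h.map_given_false,
    memLp_map_measure_iff hc.aestronglyMeasurable
      (D.measurable_X.prodMk D.measurable_Y₀).aemeasurable]
  rfl

theorem memLp_given_true_iff (h : FollowsModel M D P θ η) [IsProbabilityMeasure P] (hε : 0 < ε)
    (hπ : ∀ᵐ p ∂(M.ν.prod M.μ₀), 0 < M.π θ p.2 p.1.1 ∧ M.π θ p.2 p.1.1 ≤ 1 - ε)
    {b : ℝ → 𝒰 × 𝒵 → EuclideanSpace ℝ (Fin d)}
    (hb : StronglyMeasurable fun p : (𝒰 × 𝒵) × ℝ => b p.2 p.1) :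
    MemLp (fun ω => b (D.Y₁ ω) (D.X ω)) 2 (D.given P true) ↔
      MemLp (fun p : (𝒰 × 𝒵) × ℝ => b p.2 p.1) 2 (covLaw₁ M θ η ⊗ₘ kernel₁ M η) := by
  rw [memLp_given_iff (h.treatment_ne_zero hε hπ true), ← h.map_X_restrict_true hε hπ,
    ← map_restrict_eq_compProd h.map_given_true,
    memLp_map_measure_iff hb.aestronglyMeasurable
      (D.measurable_X.prodMk D.measurable_Y₁).aemeasurable]
  rfl

/-- The second moment of c is only assumed given T = 0. As (1-π)⁻¹ ≤ ε⁻¹, the law of (X, Y₀) is at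
most ε⁻¹ times its part on T = 0, so the unconditional E₀(c ∣ x) is a genuine conditional
expectation. -/
theorem integrable_of_memLp (h : FollowsModel M D P θ η) [IsProbabilityMeasure P] (hε : 0 < ε)
    (hπ : ∀ᵐ p ∂(M.ν.prod M.μ₀), 0 < M.π θ p.2 p.1.1 ∧ M.π θ p.2 p.1.1 ≤ 1 - ε)
    {c : ℝ → 𝒰 × 𝒵 → EuclideanSpace ℝ (Fin d)}
    (hL : MemLp (fun p : (𝒰 × 𝒵) × ℝ => c p.2 p.1) 2 (covLaw₀ M θ η ⊗ₘ kernel₀ M η)) :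
    Integrable (fun ω => c (D.Y₀ ω) (D.X ω)) P := by
  have hZ : Measurable fun ω => (D.X ω, D.Y₀ ω) := D.measurable_X.prodMk D.measurable_Y₀
  have hle : P.map (fun ω => (D.X ω, D.Y₀ ω)) ≤
      ENNReal.ofReal ε⁻¹ • (covLaw₀ M θ η ⊗ₘ kernel₀ M η) := by
    have hac : ∀ᵐ p ∂(covLaw₀ M θ η ⊗ₘ kernel₀ M η), M.π θ p.2 p.1.1 ≤ 1 - ε := by
      rw [← h.map_X_restrict_false hε hπ, ← map_restrict_eq_compProd h.map_given_false,
        h.map_restrict_false hε hπ]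
      filter_upwards [(withDensity_absolutelyContinuous _ _).ae_le (h.ac_Y₀.ae_le hπ)] with p hp
        using hp.2
    rw [h.map_Y₀ hε hπ, h.map_X_restrict_false hε hπ, ← withDensity_const]
    refine withDensity_mono ?_
    filter_upwards [hac] with p hp
    exact ENNReal.ofReal_le_ofReal (inv_anti₀ hε (by linarith))
  have := ((hL.smul_measure (c := ENNReal.ofReal ε⁻¹) ENNReal.ofReal_ne_top).mono_measure
    hle).comp_of_map hZ.aemeasurable
  exact this.integrable one_le_two

/-- Given x alone, Y₀ has the law `kernel₀` reweighted by (1-π)⁻¹/D, by `map_Y₀_eq_compProd`. -/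
theorem condExp_eq_outcomeMean (h : FollowsModel M D P θ η) [IsProbabilityMeasure P] (hε : 0 < ε)
    (hπ : ∀ᵐ p ∂(M.ν.prod M.μ₀), 0 < M.π θ p.2 p.1.1 ∧ M.π θ p.2 p.1.1 ≤ 1 - ε)
    {c : ℝ → 𝒰 × 𝒵 → EuclideanSpace ℝ (Fin d)}
    (hc : StronglyMeasurable fun p : (𝒰 × 𝒵) × ℝ => c p.2 p.1)
    (hi : Integrable (fun ω => c (D.Y₀ ω) (D.X ω)) P) :
    P[fun ω => c (D.Y₀ ω) (D.X ω) | D.sigmaX] =ᵐ[P] fun ω => outcomeMean M θ η c (D.X ω) := by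
  have hreg := ae_isRegularPoint h.isDensity hε hπ
  have hm : Measurable fun p : (𝒰 × 𝒵) × ℝ =>
      (M.oddsIntegral θ η p.1)⁻¹ * ((1 - M.π θ p.2 p.1.1)⁻¹ * η.f₀ p.1 p.2) :=
    ((measurable_oddsIntegral h.isDensity).comp measurable_fst).inv.mul
      ((measurable_one_sub_π M θ).inv.mul h.isDensity.f₀.measurable)
  refine (condExp_ae_eq_integral_kernel D.measurable_X D.measurable_Y₀
    (h.map_Y₀_eq_compProd hε hπ) hc hi).trans ?_
  filter_upwards [h.ae_X (covLaw_absolutelyContinuous.ae_le hreg)] with ω hx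
  have hac : ∀ᵐ y ∂M.μ₀, ENNReal.ofReal (η.f₀ (D.X ω) y) ≠ 0 →
      1 < (1 - M.π θ y (D.X ω).1)⁻¹ ∧ (1 - M.π θ y (D.X ω).1)⁻¹ ≤ ε⁻¹ := by
    have := hx.inv_bounds hε
    rwa [condKernel_apply h.isDensity.f₀.measurable,
      ae_withDensity_iff (measurable_section h.isDensity.f₀.measurable _).ennreal_ofReal] at this
  rw [condKernel_apply (f := fun x y => (M.oddsIntegral θ η x)⁻¹ *
      ((1 - M.π θ y x.1)⁻¹ * η.f₀ x y)) hm,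
    integral_withDensity_eq_integral_toReal_smul (measurable_section
      (f := fun x y => (M.oddsIntegral θ η x)⁻¹ * ((1 - M.π θ y x.1)⁻¹ * η.f₀ x y)) hm
      _).ennreal_ofReal (by simp), outcomeMean,
    integral_condKernel h.isDensity.f₀.measurable h.isDensity.f₀.nonneg, ← integral_smul]
  refine integral_congr_ae ?_
  filter_upwards [hac] with y hy
  have hf := h.isDensity.f₀.nonneg (D.X ω) y
  rcases hf.eq_or_lt with h0 | h0
  · simp [← h0]
  · have hy := hy (by simpa using h0)
    rw [ENNReal.toReal_ofReal (mul_nonneg (inv_nonneg.2 hx.odds_pos.le)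
      (mul_nonneg (by linarith) hf)), smul_smul, smul_smul]
    congr 1
    ring

/-- With w = 1 - 1/D, the coefficient (t - w)/w is -1 for t = 0 and (D - 1)⁻¹ for t = 1. -/
theorem lambda₀_repr (h : FollowsModel M D P θ η) [IsProbabilityMeasure P] (hε : 0 < ε)
    (hπ : ∀ᵐ p ∂(M.ν.prod M.μ₀), 0 < M.π θ p.2 p.1.1 ∧ M.π θ p.2 p.1.1 ≤ 1 - ε)
    {c : ℝ → 𝒰 × 𝒵 → EuclideanSpace ℝ (Fin d)}
    (hc : StronglyMeasurable fun p : (𝒰 × 𝒵) × ℝ => c p.2 p.1)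
    (hL : MemLp (fun p : (𝒰 × 𝒵) × ℝ => c p.2 p.1) 2 (covLaw₀ M θ η ⊗ₘ kernel₀ M η)) :
    (fun ω => (1 - ind (D.T ω)) • c (D.Y₀ ω) (D.X ω) + ((ind (D.T ω) - D.w P ω) / D.w P ω) •
      (P[fun ω' => c (D.Y₀ ω') (D.X ω') | D.sigmaX]) ω) =ᵐ[P]
    fun ω => score₀ M θ η c (D.W ω) := by
  have hreg := ae_isRegularPoint h.isDensity hε hπ
  filter_upwards [h.w_ae_eq hε hπ, h.condExp_eq_outcomeMean hε hπ hc
    (h.integrable_of_memLp hε hπ hL), h.ae_X (covLaw_absolutelyContinuous.ae_le hreg)]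
    with ω hw he hx
  have hD := hx.odds_pos
  have hD1 := hx.odds_sub_one_pos
  have hw0 : 0 < D.w P ω := by
    rw [hw]; exact sub_pos.2 (inv_lt_one_of_one_lt₀ hx.one_lt_odds)
  rw [he]
  cases hT : D.T ω
  · rw [W_of_false hT]
    simp only [score₀, ind, Bool.false_eq_true, if_false, sub_zero, one_smul, zero_sub]
    rw [neg_div, div_self hw0.ne', neg_one_smul, ← sub_eq_add_neg]
  · rw [W_of_true hT]
    simp only [score₀, ind, if_true, sub_self, zero_smul, zero_add]
    congr 1
    rw [hw]
    field_simp
    ring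

theorem mem_lambda₀_iff (h : FollowsModel M D P θ η) [IsProbabilityMeasure P] (hε : 0 < ε)
    (hπ : ∀ᵐ p ∂(M.ν.prod M.μ₀), 0 < M.π θ p.2 p.1.1 ∧ M.π θ p.2 p.1.1 ≤ 1 - ε)
    (f : HSpace d D P) : f ∈ lambda₀ d D P ↔ IsScore₀ M θ η f.1 := by
  have hf : StronglyMeasurable f.1 := Lp.stronglyMeasurable _
  unfold lambda₀ IsScore₀
  simp only [Set.mem_ofPred_eq]
  refine exists_congr fun c => ?_
  rw [measurable_iff_stronglyMeasurable_swap]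
  refine and_congr_right fun hc => ?_
  rw [h.memLp_given_false_iff hε hπ hc]
  refine and_congr_right fun hL => ?_
  rw [h.condExp_given_false_iff hε hπ hc ((h.memLp_given_false_iff hε hπ hc).2 hL)]
  refine and_congr_right fun _ => ?_
  have e := h.lambda₀_repr hε hπ hc hL
  rw [← h.map_W hε hπ, ← ae_eq_map_W_iff hf (stronglyMeasurable_score₀ h.isDensity hc)]
  exact ⟨fun h1 => h1.trans e, fun h1 => h1.trans e.symm⟩

theorem mem_lambda₁_iff (h : FollowsModel M D P θ η) [IsProbabilityMeasure P] (hε : 0 < ε)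
    (hπ : ∀ᵐ p ∂(M.ν.prod M.μ₀), 0 < M.π θ p.2 p.1.1 ∧ M.π θ p.2 p.1.1 ≤ 1 - ε)
    (f : HSpace d D P) : f ∈ lambda₁ d D P ↔ IsScore₁ M θ η f.1 := by
  have hf : StronglyMeasurable f.1 := Lp.stronglyMeasurable _
  unfold lambda₁ IsScore₁
  simp only [Set.mem_ofPred_eq]
  refine exists_congr fun b => ?_
  rw [measurable_iff_stronglyMeasurable_swap]
  refine and_congr_right fun hb => ?_
  rw [h.memLp_given_true_iff hε hπ hb]
  refine and_congr_right fun hL => ?_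
  rw [h.condExp_given_true_iff hε hπ hb ((h.memLp_given_true_iff hε hπ hb).2 hL)]
  refine and_congr_right fun _ => ?_
  have e : ∀ ω, ind (D.T ω) • b (D.Y₁ ω) (D.X ω) = score₁ b (D.W ω) := by
    intro ω
    cases hT : D.T ω
    · rw [W_of_false hT]; simp [ind, score₁]
    · rw [W_of_true hT]; simp [ind, score₁]
  simp_rw [e]
  rw [← h.map_W hε hπ, ← ae_eq_map_W_iff hf (stronglyMeasurable_score₁ hb)]

theorem mem_lambda₂_iff (h : FollowsModel M D P θ η) [IsProbabilityMeasure P] (hε : 0 < ε)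
    (hπ : ∀ᵐ p ∂(M.ν.prod M.μ₀), 0 < M.π θ p.2 p.1.1 ∧ M.π θ p.2 p.1.1 ≤ 1 - ε)
    (f : HSpace d D P) : f ∈ lambda₂ d D P ↔ IsScore₂ M θ η f.1 := by
  have hf : StronglyMeasurable f.1 := Lp.stronglyMeasurable _
  have hmean : ∫ o, f.1 o ∂P.map D.W = 0 := f.2
  rw [integral_map D.measurable_W.aemeasurable hf.aestronglyMeasurable] at hmean
  unfold lambda₂ IsScore₂
  simp only [Set.mem_ofPred_eq]
  refine exists_congr fun a => ?_
  rw [stronglyMeasurable_iff_measurable]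
  refine and_congr_right fun ha => ?_
  have e : ∀ ω, a (D.X ω) = score₂ a (D.W ω) := fun ω => rfl
  rw [← h.map_W hε hπ, ← ae_eq_map_W_iff hf (stronglyMeasurable_score₂ ha.stronglyMeasurable)]
  -- The mean zero condition on a is automatic, since members of ℋ have mean zero.
  refine and_iff_right_of_imp fun h1 => ?_
  rw [← hmean]
  exact (integral_congr_ae h1).symm

theorem mem_lambdaPerp_iff (h : FollowsModel M D P θ η) [IsProbabilityMeasure P] (hε : 0 < ε)
    (hπ : ∀ᵐ p ∂(M.ν.prod M.μ₀), 0 < M.π θ p.2 p.1.1 ∧ M.π θ p.2 p.1.1 ≤ 1 - ε)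
    (f : HSpace d D P) : f ∈ lambdaPerp M D P θ ↔ IsResidual M θ η f.1 := by
  have hf : StronglyMeasurable f.1 := Lp.stronglyMeasurable _
  unfold lambdaPerp IsResidual
  simp only [Set.mem_ofPred_eq]
  refine exists_congr fun g => ?_
  rw [stronglyMeasurable_iff_measurable]
  refine and_congr_right fun hg => ?_
  have e : (fun ω => ((ind (D.T ω) - M.π θ (D.Y₀ ω) (D.X ω).1) /
      (1 - M.π θ (D.Y₀ ω) (D.X ω).1)) • g (D.X ω)) =ᵐ[P] fun ω => residual M θ g (D.W ω) := by
    filter_upwards [h.ae_π_bounds hπ] with ω hω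
    have h1 : 0 < 1 - M.π θ (D.Y₀ ω) (D.X ω).1 := by linarith
    cases hT : D.T ω
    · rw [W_of_false hT]
      simp only [ind, residual, Bool.false_eq_true, if_false]
      congr 1
      field_simp
      ring
    · rw [W_of_true hT]
      simp only [ind, residual, if_true]
      rw [div_self h1.ne', one_smul]
  rw [← h.map_W hε hπ,
    ← ae_eq_map_W_iff hf (stronglyMeasurable_residual hg.stronglyMeasurable)]
  exact ⟨fun h1 => h1.trans e, fun h1 => h1.trans e.symm⟩

end FollowsModel

end ATT

namespace ATT

/-! ### Orthogonal decompositions of a Hilbert space -/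

section Hilbert

variable {ι H : Type*} [NormedAddCommGroup H] [InnerProductSpace ℝ H]

/-- The vectors that are orthogonal to all members of a family but the `i`-th. -/
def orthogonalToOthers (G : ι → Submodule ℝ H) (i : ι) : Submodule ℝ H :=
  ⨅ (j) (_ : j ≠ i), (G j)ᗮ

variable {G : ι → Submodule ℝ H}

theorem mem_orthogonalToOthers {i : ι} {h : H} :
    h ∈ orthogonalToOthers G i ↔ ∀ j, j ≠ i → h ∈ (G j)ᗮ := by
  simp [orthogonalToOthers, Submodule.mem_iInf]

theorem isClosed_orthogonalToOthers (i : ι) :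
    IsClosed (orthogonalToOthers G i : Set H) := by
  simp only [orthogonalToOthers, Submodule.coe_iInf]
  exact isClosed_iInter fun j => isClosed_iInter fun _ => Submodule.isClosed_orthogonal _

theorem le_orthogonalToOthers (horth : ∀ i j, i ≠ j → G i ⟂ G j)
    (i : ι) : G i ≤ orthogonalToOthers G i := fun _ hh =>
  mem_orthogonalToOthers.2 fun _ hj => (horth _ _ hj.symm) hh

variable [CompleteSpace H]

instance (i : ι) : CompleteSpace (orthogonalToOthers G i) :=
  (isClosed_orthogonalToOthers i).completeSpace_coe

/-- A vector orthogonal to the others and to the closure of G i is orthogonal to the whole family,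
hence zero; so the closed subspace fills the larger one. -/
theorem topologicalClosure_eq_orthogonalToOthers (horth : ∀ i j, i ≠ j → G i ⟂ G j)
    (htot : ∀ h, (∀ i, h ∈ (G i)ᗮ) → h = 0) (i : ι) :
    (G i).topologicalClosure = orthogonalToOthers G i := by
  have hle : (G i).topologicalClosure ≤ orthogonalToOthers G i :=
    Submodule.topologicalClosure_minimal _ (le_orthogonalToOthers horth i)
      (isClosed_orthogonalToOthers i)
  have hc : CompleteSpace (G i).topologicalClosure :=
    (Submodule.isClosed_topologicalClosure _).completeSpace_coe
  have h := Submodule.sup_orthogonal_inf_of_hasOrthogonalProjection hle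
  have hb : (G i).topologicalClosureᗮ ⊓ orthogonalToOthers G i = ⊥ := by
    rw [eq_bot_iff]
    rintro x ⟨h1, h2⟩
    rw [Submodule.mem_bot]
    refine htot x fun j => ?_
    by_cases hj : j = i
    · subst hj
      exact Submodule.orthogonal_le (Submodule.le_topologicalClosure _) h1
    · exact mem_orthogonalToOthers.1 h2 j hj
  rw [hb, sup_bot_eq] at h
  exact h

/-- The first space is orthogonal to G j by definition, hence to its closure, which is the second
space. -/
theorem isOrtho_orthogonalToOthers (horth : ∀ i j, i ≠ j → G i ⟂ G j)
    (htot : ∀ h, (∀ i, h ∈ (G i)ᗮ) → h = 0) {i j : ι} (hij : i ≠ j) :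
    orthogonalToOthers G i ⟂ orthogonalToOthers G j := by
  rw [Submodule.isOrtho_comm, Submodule.isOrtho_iff_le,
    ← topologicalClosure_eq_orthogonalToOthers horth htot j]
  refine Submodule.topologicalClosure_minimal _ ?_ (Submodule.isClosed_orthogonal _)
  rw [← Submodule.isOrtho_iff_le, Submodule.isOrtho_comm, Submodule.isOrtho_iff_le]
  exact fun x hx => mem_orthogonalToOthers.1 hx j hij.symm

theorem orthogonalFamily_orthogonalToOthers (horth : ∀ i j, i ≠ j → G i ⟂ G j)
    (htot : ∀ h, (∀ i, h ∈ (G i)ᗮ) → h = 0) :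
    OrthogonalFamily ℝ (fun i => orthogonalToOthers G i)
      (fun i => (orthogonalToOthers G i).subtypeₗᵢ) :=
  OrthogonalFamily.of_pairwise fun _ _ hij => isOrtho_orthogonalToOthers horth htot hij

/-- What remains after subtracting all projections is orthogonal to each G j: the j-th projection
accounts for the component along it, the others are orthogonal to it. Totality makes the remainder
zero. -/
theorem sum_starProjection_orthogonalToOthers (horth : ∀ i j, i ≠ j → G i ⟂ G j)
    (htot : ∀ h, (∀ i, h ∈ (G i)ᗮ) → h = 0) [Fintype ι] (h : H) :
    ∑ i, (orthogonalToOthers G i).starProjection h = h := by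
  symm
  rw [← sub_eq_zero]
  refine htot _ fun j => Submodule.orthogonal_le (le_orthogonalToOthers horth j) ?_
  classical
  rw [← Finset.add_sum_erase _ _ (Finset.mem_univ j), ← sub_sub]
  refine Submodule.sub_mem _ (Submodule.sub_starProjection_mem_orthogonal h)
    (Submodule.sum_mem _ fun i hi => ?_)
  exact (isOrtho_orthogonalToOthers horth htot (Finset.ne_of_mem_erase hi))
    (Submodule.starProjection_apply_mem _ h)

theorem iSup_orthogonalToOthers (horth : ∀ i j, i ≠ j → G i ⟂ G j)
    (htot : ∀ h, (∀ i, h ∈ (G i)ᗮ) → h = 0) [Fintype ι] : ⨆ i, orthogonalToOthers G i = ⊤ := by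
  rw [eq_top_iff]
  intro h _
  rw [← sum_starProjection_orthogonalToOthers horth htot h]
  exact Submodule.sum_mem _ fun i _ => Submodule.mem_iSup_of_mem i
    (Submodule.starProjection_apply_mem _ h)

theorem isInternal_orthogonalToOthers (horth : ∀ i j, i ≠ j → G i ⟂ G j)
    (htot : ∀ h, (∀ i, h ∈ (G i)ᗮ) → h = 0) [Fintype ι] [DecidableEq ι] :
    DirectSum.IsInternal (orthogonalToOthers G) := by
  rw [(orthogonalFamily_orthogonalToOthers horth htot).isInternal_iff_of_isComplete]
  · rw [iSup_orthogonalToOthers horth htot, Submodule.top_orthogonal_eq_bot]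
  · rw [iSup_orthogonalToOthers horth htot]
    exact isComplete_univ

theorem orthogonal_orthogonalToOthers (horth : ∀ i j, i ≠ j → G i ⟂ G j)
    (htot : ∀ h, (∀ i, h ∈ (G i)ᗮ) → h = 0) (i : ι) : (orthogonalToOthers G i)ᗮ = (G i)ᗮ := by
  rw [← topologicalClosure_eq_orthogonalToOthers horth htot i, Submodule.orthogonal_closure]

theorem sup_orthogonalToOthers {G : Fin 4 → Submodule ℝ H}
    (horth : ∀ i j, i ≠ j → G i ⟂ G j) (htot : ∀ h, (∀ i, h ∈ (G i)ᗮ) → h = 0) :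
    orthogonalToOthers G 0 ⊔ orthogonalToOthers G 1 ⊔ orthogonalToOthers G 2 =
      (orthogonalToOthers G 3)ᗮ := by
  refine le_antisymm (sup_le (sup_le ?_ ?_) ?_) fun h hh => ?_
  · exact isOrtho_orthogonalToOthers horth htot (by decide)
  · exact isOrtho_orthogonalToOthers horth htot (by decide)
  · exact isOrtho_orthogonalToOthers horth htot (by decide)
  · have hs := sum_starProjection_orthogonalToOthers horth htot h
    rw [Fin.sum_univ_four, (Submodule.starProjection_apply_eq_zero_iff _).2 hh, add_zero] at hs
    rw [← hs]
    exact Submodule.add_mem_sup (Submodule.add_mem_sup (Submodule.starProjection_apply_mem _ _)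
      (Submodule.starProjection_apply_mem _ _)) (Submodule.starProjection_apply_mem _ _)

end Hilbert

/-! ### Completeness of the space of mean zero functions -/

section MeanZero

variable {d : ℕ} {𝒰 𝒵 : Type*} [MeasurableSpace 𝒰] [MeasurableSpace 𝒵]
  {Q : Measure (Obs 𝒰 𝒵)} [IsFiniteMeasure Q]

/-- Mean zero is orthogonality to every constant vector, which has finite norm because Q is finite.
-/
theorem isClosed_meanZero :
    IsClosed (meanZero d Q : Set (Lp (EuclideanSpace ℝ (Fin d)) 2 Q)) := by
  have e : (meanZero d Q : Set (Lp (EuclideanSpace ℝ (Fin d)) 2 Q)) =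
      ⋂ v : EuclideanSpace ℝ (Fin d), {h | inner ℝ (indicatorConstLp 2 MeasurableSet.univ
        (measure_ne_top Q Set.univ) v) h = 0} := by
    ext h
    simp only [Set.mem_iInter, Set.mem_ofPred_eq, L2.inner_indicatorConstLp_eq_inner_setIntegral,
      setIntegral_univ]
    change ∫ o, h o ∂Q = 0 ↔ _
    exact ⟨fun h0 v => by rw [h0, inner_zero_right], fun h0 => inner_self_eq_zero.1 (h0 _)⟩
  rw [e]
  exact isClosed_iInter fun v => isClosed_eq (continuous_const.inner continuous_id)
    continuous_const

instance : CompleteSpace (meanZero d Q) := isClosed_meanZero.completeSpace_coe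

theorem inner_meanZero (f h : meanZero d Q) : inner ℝ f h = ∫ o, inner ℝ (f.1 o) (h.1 o) ∂Q := by
  rw [Submodule.coe_inner, L2.inner_def]

/-- The elements of `ℋ` that are almost everywhere equal to a function of a linear class. -/
def meanZeroOf (Q : Measure (Obs 𝒰 𝒵)) [IsFiniteMeasure Q]
    (C : Set (Obs 𝒰 𝒵 → EuclideanSpace ℝ (Fin d))) (h0 : 0 ∈ C)
    (hadd : ∀ ψ ∈ C, ∀ φ ∈ C, ∃ χ ∈ C, χ =ᵐ[Q] ψ + φ)
    (hsmul : ∀ k : ℝ, ∀ ψ ∈ C, ∃ χ ∈ C, χ =ᵐ[Q] k • ψ) : Submodule ℝ (meanZero d Q) where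
  carrier := {h | ∃ ψ ∈ C, h.1 =ᵐ[Q] ψ}
  zero_mem' := ⟨0, h0, Lp.coeFn_zero _ _ _⟩
  add_mem' := by
    rintro a b ⟨ψ, hψ, ha⟩ ⟨φ, hφ, hb⟩
    obtain ⟨χ, hχ, e⟩ := hadd ψ hψ φ hφ
    exact ⟨χ, hχ, (Lp.coeFn_add a.1 b.1).trans ((ha.add hb).trans e.symm)⟩
  smul_mem' := by
    rintro k a ⟨ψ, hψ, ha⟩
    obtain ⟨χ, hχ, e⟩ := hsmul k ψ hψ
    exact ⟨χ, hχ, (Lp.coeFn_smul k a.1).trans ((ha.const_smul k).trans e.symm)⟩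

/-- Replaces classes in ℋ by honest functions of C, each of which defines an element of ℋ. -/
theorem mem_orthogonal_iff_of_mem_iff {C : Set (Obs 𝒰 𝒵 → EuclideanSpace ℝ (Fin d))}
    {G : Submodule ℝ (meanZero d Q)} (hG : ∀ f, f ∈ G ↔ ∃ ψ ∈ C, f.1 =ᵐ[Q] ψ)
    (hC : ∀ ψ ∈ C, MemLp ψ 2 Q ∧ ∫ o, ψ o ∂Q = 0) (h : meanZero d Q) :
    h ∈ Gᗮ ↔ ∀ ψ ∈ C, ∫ o, inner ℝ (ψ o) (h.1 o) ∂Q = 0 := by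
  rw [Submodule.mem_orthogonal]
  constructor
  · intro H ψ hψ
    obtain ⟨hL, hm⟩ := hC ψ hψ
    have e := hL.coeFn_toLp
    have := H ⟨hL.toLp ψ, (integral_congr_ae e).trans hm⟩ ((hG _).2 ⟨ψ, hψ, e⟩)
    rw [inner_meanZero] at this
    rw [← this]
    refine integral_congr_ae ?_
    filter_upwards [e] with o ho
    rw [ho]
  · intro H f hf
    obtain ⟨ψ, hψ, e⟩ := (hG f).1 hf
    rw [inner_meanZero, ← H ψ hψ]
    refine integral_congr_ae ?_
    filter_upwards [e] with o ho
    rw [ho]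

end MeanZero

end ATT

namespace ATT

variable {d : ℕ} {𝒰 𝒵 : Type*} [MeasurableSpace 𝒰] [MeasurableSpace 𝒵]
variable {M : Model d 𝒰 𝒵} {θ : EuclideanSpace ℝ (Fin d)} {η η' : Nuisance 𝒰 𝒵} {ε : ℝ}
variable {E F : Type*} [NormedAddCommGroup E] [InnerProductSpace ℝ E] [NormedAddCommGroup F]

/-! ### Scores have mean zero whenever the nuisance parts that they depend on are the same -/

theorem integrable_of_ae_bounded (hη : η.IsDensity M)
    (hreg : ∀ᵐ x ∂M.ν, IsRegularPoint M θ η ε x) {ψ : Obs 𝒰 𝒵 → F} (hψ : StronglyMeasurable ψ)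
    (hb : ∃ K, ∀ᵐ o ∂M.base, ‖ψ o‖ ≤ K) : Integrable ψ (obsLaw M θ η) := by
  have := isProbabilityMeasure_obsLaw hη hreg
  obtain ⟨K, hK⟩ := hb
  exact .of_bound hψ.aestronglyMeasurable K ((obsLaw_absolutelyContinuous hη hreg).ae_le hK)

theorem memLp_of_ae_bounded (hη : η.IsDensity M)
    (hreg : ∀ᵐ x ∂M.ν, IsRegularPoint M θ η ε x) {ψ : Obs 𝒰 𝒵 → F} (hψ : StronglyMeasurable ψ)
    (hb : ∃ K, ∀ᵐ o ∂M.base, ‖ψ o‖ ≤ K) : MemLp ψ 2 (obsLaw M θ η) := by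
  have := isProbabilityMeasure_obsLaw hη hreg
  obtain ⟨K, hK⟩ := hb
  exact .of_bound hψ.aestronglyMeasurable K ((obsLaw_absolutelyContinuous hη hreg).ae_le hK)

theorem IsDirection.integrable {x : 𝒰 × 𝒵} {ν : Measure (𝒰 × 𝒵)} {κ : Kernel (𝒰 × 𝒵) ℝ}
    [IsFiniteMeasure (κ x)] {c : ℝ → 𝒰 × 𝒵 → E} (hc : IsDirection ν κ c) :
    Integrable (fun y => c y x) (κ x) := by
  obtain ⟨K, hK⟩ := hc.bounded
  exact .of_bound (stronglyMeasurable_section hc.stronglyMeasurable x).aestronglyMeasurable K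
      (.of_forall fun y => hK y x)

theorem isDirection_zero {ν : Measure (𝒰 × 𝒵)} {κ : Kernel (𝒰 × 𝒵) ℝ} :
    IsDirection ν κ (0 : ℝ → 𝒰 × 𝒵 → E) :=
  ⟨stronglyMeasurable_const, ⟨0, by simp⟩, by simp⟩

theorem IsDirection.add {ν : Measure (𝒰 × 𝒵)} {κ : Kernel (𝒰 × 𝒵) ℝ}
    (hκ : ∀ᵐ x ∂ν, IsProbabilityMeasure (κ x)) {c c' : ℝ → 𝒰 × 𝒵 → E}
    (hc : IsDirection ν κ c) (hc' : IsDirection ν κ c') :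
    IsDirection ν κ (c + c') := by
  obtain ⟨K, hK⟩ := hc.bounded
  obtain ⟨K', hK'⟩ := hc'.bounded
  refine ⟨hc.stronglyMeasurable.add hc'.stronglyMeasurable, ⟨K + K', fun y x =>
    (norm_add_le _ _).trans (add_le_add (hK y x) (hK' y x))⟩, ?_⟩
  filter_upwards [hκ, hc.integral_eq_zero, hc'.integral_eq_zero] with x hx h h'
  simp only [Pi.add_apply]
  rw [integral_add hc.integrable hc'.integrable, h, h', add_zero]

theorem IsDirection.smul {ν : Measure (𝒰 × 𝒵)} {κ : Kernel (𝒰 × 𝒵) ℝ} (k : ℝ)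
    {c : ℝ → 𝒰 × 𝒵 → E} (hc : IsDirection ν κ c) : IsDirection ν κ (k • c) := by
  obtain ⟨K, hK⟩ := hc.bounded
  refine ⟨hc.stronglyMeasurable.const_smul k, ⟨‖k‖ * K, fun y x => ?_⟩, ?_⟩
  · simp only [Pi.smul_apply, norm_smul]
    exact mul_le_mul_of_nonneg_left (hK y x) (norm_nonneg _)
  · filter_upwards [hc.integral_eq_zero] with x h
    simp only [Pi.smul_apply]
    rw [integral_smul, h, smul_zero]

theorem outcomeMean_smul (k : ℝ) (c : ℝ → 𝒰 × 𝒵 → E) (x : 𝒰 × 𝒵) :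
    outcomeMean M θ η (k • c) x = k • outcomeMean M θ η c x := by
  simp only [outcomeMean, Pi.smul_apply, smul_comm _ k]
  rw [integral_smul, smul_comm]

theorem IsRegularPoint.outcomeMean_add {x : 𝒰 × 𝒵} (hx : IsRegularPoint M θ η ε x) (hε : 0 < ε)
    {c c' : ℝ → 𝒰 × 𝒵 → E} (hc : Integrable (fun y => c y x) (kernel₀ M η x))
    (hc' : Integrable (fun y => c' y x) (kernel₀ M η x)) :
    outcomeMean M θ η (c + c') x = outcomeMean M θ η c x + outcomeMean M θ η c' x := by
  simp only [outcomeMean, Pi.add_apply, smul_add]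
  rw [integral_add (hx.integrable_inv_smul hε hc) (hx.integrable_inv_smul hε hc'), smul_add]

theorem integral_score₁ (hη' : η'.IsDensity M)
    (hreg' : ∀ᵐ x ∂M.ν, IsRegularPoint M θ η' ε x)
    (hf : η'.f₁ = η.f₁) {b : ℝ → 𝒰 × 𝒵 → E} (hb : IsDirection M.ν (kernel₁ M η) b) :
    ∫ o, score₁ b o ∂obsLaw M θ η' = 0 := by
  have hi := integrable_of_ae_bounded hη' hreg'
    (stronglyMeasurable_score₁ hb.stronglyMeasurable) (ae_bounded_score₁ hb)
  rw [(integrable_condMean_and_integral_obsLaw hη' hreg' hi).2, integral_eq_zero_of_ae]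
  have eK : kernel₁ M η' = kernel₁ M η := by rw [kernel₁, hf]
  filter_upwards [covLaw_absolutelyContinuous.ae_le hb.integral_eq_zero] with x h0
  simp [condMean, score₁, eK, h0]

variable [CompleteSpace E]

/-- The law may differ from the one at which the score was formed, in f₁ and g. Given x, the mean of
the score involves f₀ and θ only, and the two arms contribute -e/D and e/D, with e the `outcomeMean`
of c. -/
theorem integral_score₀ (hη : η.IsDensity M) (hη' : η'.IsDensity M) (hε : 0 < ε)
    (hreg : ∀ᵐ x ∂M.ν, IsRegularPoint M θ η ε x) (hreg' : ∀ᵐ x ∂M.ν, IsRegularPoint M θ η' ε x)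
    (hf : η'.f₀ = η.f₀) {c : ℝ → 𝒰 × 𝒵 → E} (hc : IsDirection M.ν (kernel₀ M η) c) :
    ∫ o, score₀ M θ η c o ∂obsLaw M θ η' = 0 := by
  have hi := integrable_of_ae_bounded hη' hreg'
    (stronglyMeasurable_score₀ (θ := θ) hη hc.stronglyMeasurable)
    (ae_bounded_score₀ hη hε hreg hc)
  obtain ⟨K, hK⟩ := hc.bounded
  rw [(integrable_condMean_and_integral_obsLaw hη' hreg' hi).2, integral_eq_zero_of_ae]
  have hac : ∀ᵐ x ∂covLaw M η', IsRegularPoint M θ η ε x ∧ IsRegularPoint M θ η' ε x ∧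
      ∫ y, c y x ∂kernel₀ M η x = 0 :=
    covLaw_absolutelyContinuous.ae_le (hreg.and (hreg'.and hc.integral_eq_zero))
  filter_upwards [hac] with x ⟨hx, hx', h0⟩
  have := hx.prob₀
  have := hx'.prob₁
  have hD := hx.odds_pos
  have hD1 := hx.odds_sub_one_pos
  have eD : M.oddsIntegral θ η' x = M.oddsIntegral θ η x := by simp [Model.oddsIntegral, hf]
  have eK : kernel₀ M η' = kernel₀ M η := by rw [kernel₀, hf]
  have hci : Integrable (fun y => c y x) (kernel₀ M η x) :=
    .of_bound (stronglyMeasurable_section hc.stronglyMeasurable x).aestronglyMeasurable K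
      (.of_forall fun y => hK y x)
  simp only [condMean, score₀, Bool.false_eq_true, if_false, if_true, eD, eK]
  rw [integral_sub hci (integrable_const _), h0]
  simp only [integral_const, probReal_univ, one_smul, zero_sub, smul_neg, smul_smul,
    Pi.zero_apply]
  rw [neg_add_eq_zero]
  congr 1
  field_simp

theorem integral_score₂ (hη' : η'.IsDensity M)
    (hreg' : ∀ᵐ x ∂M.ν, IsRegularPoint M θ η' ε x)
    {a : 𝒰 × 𝒵 → E} (ha : StronglyMeasurable a) (hb : ∃ K, ∀ x, ‖a x‖ ≤ K) :
    ∫ o, score₂ a o ∂obsLaw M θ η' = ∫ x, a x ∂covLaw M η' := by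
  obtain ⟨K, hK⟩ := hb
  have hi := integrable_of_ae_bounded hη' hreg' (stronglyMeasurable_score₂ ha)
    ⟨K, .of_forall fun o => hK _⟩
  rw [(integrable_condMean_and_integral_obsLaw hη' hreg' hi).2]
  refine integral_congr_ae ?_
  filter_upwards [covLaw_absolutelyContinuous.ae_le hreg'] with x hx
  have := hx.prob₀
  have := hx.prob₁
  simp only [condMean, score₂, integral_const, probReal_univ, one_smul]
  module

/-- Holds for every choice of nuisance parts: given x, the arms contribute (1 - D)/D and 1 - 1/D
times g(x). This is why the last family is orthogonal to all nuisance scores. -/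
theorem integral_residual (hη' : η'.IsDensity M) (hε : 0 < ε)
    (hπ : ∀ᵐ p ∂(M.ν.prod M.μ₀), 0 < M.π θ p.2 p.1.1 ∧ M.π θ p.2 p.1.1 ≤ 1 - ε)
    {g : 𝒰 × 𝒵 → E} (hg : StronglyMeasurable g) (hb : ∃ K, ∀ x, ‖g x‖ ≤ K) :
    ∫ o, residual M θ g o ∂obsLaw M θ η' = 0 := by
  have hreg' := ae_isRegularPoint hη' hε hπ
  obtain ⟨K, hK⟩ := hb
  have hi := integrable_of_ae_bounded hη' hreg' (stronglyMeasurable_residual (M := M) (θ := θ) hg)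
    (ae_bounded_residual hε hπ hg hK)
  rw [(integrable_condMean_and_integral_obsLaw hη' hreg' hi).2, integral_eq_zero_of_ae]
  filter_upwards [covLaw_absolutelyContinuous.ae_le hreg'] with x hx
  have := hx.prob₁
  have hD := hx.odds_pos
  simp only [condMean, residual, Bool.false_eq_true, if_false, if_true, integral_const,
    probReal_univ, one_smul, Pi.zero_apply]
  rw [integral_smul_const, hx.integral_one_sub_inv hη' hε, smul_smul, ← add_smul]
  have : (M.oddsIntegral θ η' x)⁻¹ * (1 - M.oddsIntegral θ η' x) +
      (1 - (M.oddsIntegral θ η' x)⁻¹) = 0 := by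
    field_simp
    ring
  rw [this, zero_smul]

/-! ### The spaces of bounded scores -/

section Classes

variable (M θ η)

/-- Bounded scores for `f₀`. -/
def boundedScores₀ : Set (Obs 𝒰 𝒵 → E) :=
  {ψ | ∃ c, IsDirection M.ν (kernel₀ M η) c ∧ ψ = score₀ M θ η c}

/-- Bounded scores for `f₁`. -/
def boundedScores₁ : Set (Obs 𝒰 𝒵 → E) :=
  {ψ | ∃ b, IsDirection M.ν (kernel₁ M η) b ∧ ψ = score₁ b}

/-- Bounded scores for `g`. -/
def boundedScores₂ : Set (Obs 𝒰 𝒵 → E) :=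
  {ψ | ∃ a, StronglyMeasurable a ∧ (∃ K, ∀ x, ‖a x‖ ≤ K) ∧ ∫ x, a x ∂covLaw M η = 0 ∧
    ψ = score₂ a}

/-- Bounded functions of the form `(t - π) / (1 - π) g(x)`. -/
def boundedResiduals : Set (Obs 𝒰 𝒵 → E) :=
  {ψ | ∃ g, StronglyMeasurable g ∧ (∃ K, ∀ x, ‖g x‖ ≤ K) ∧ ψ = residual M θ g}

end Classes

section Submodules

variable (hη : η.IsDensity M) (hε : 0 < ε)
  (hπ : ∀ᵐ p ∂(M.ν.prod M.μ₀), 0 < M.π θ p.2 p.1.1 ∧ M.π θ p.2 p.1.1 ≤ 1 - ε)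
  (Q : Measure (Obs 𝒰 𝒵)) [IsFiniteMeasure Q] (hQ : Q = obsLaw M θ η)

/-- The elements of `ℋ` that are bounded scores for `f₀`. -/
def boundedSpace₀ : Submodule ℝ (meanZero d Q) :=
  meanZeroOf Q (boundedScores₀ M θ η)
    ⟨0, isDirection_zero, by ext o i; rcases o with ⟨_ | _, y, x⟩ <;> simp [score₀, outcomeMean]⟩
    (by
      have hreg := ae_isRegularPoint hη hε hπ
      rintro _ ⟨c, hc, rfl⟩ _ ⟨c', hc', rfl⟩
      refine ⟨_, ⟨c + c', hc.add (hreg.mono fun x hx => hx.prob₀) hc', rfl⟩, ?_⟩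
      rw [hQ]
      refine (obsLaw_absolutelyContinuous hη hreg).ae_le ?_
      filter_upwards [ae_base_of_ae hreg] with o hx
      rcases o with ⟨t, y, x⟩
      have := hx.prob₀
      have e := hx.outcomeMean_add hε hc.integrable hc'.integrable
      cases t
      · simp only [score₀, Pi.add_apply, Bool.false_eq_true, if_false, e]
        abel
      · simp only [score₀, Pi.add_apply, if_true, e, smul_add])
    (by
      rintro k _ ⟨c, hc, rfl⟩
      refine ⟨_, ⟨k • c, hc.smul k, rfl⟩, .of_forall fun o => ?_⟩
      rcases o with ⟨t, y, x⟩
      cases t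
      · simp only [score₀, Pi.smul_apply, Bool.false_eq_true, if_false, outcomeMean_smul, smul_sub]
      · simp only [score₀, Pi.smul_apply, if_true, outcomeMean_smul]
        rw [smul_comm])

/-- The elements of `ℋ` that are bounded scores for `f₁`. -/
def boundedSpace₁ : Submodule ℝ (meanZero d Q) :=
  meanZeroOf Q (boundedScores₁ M η)
    ⟨0, isDirection_zero, by ext o i; rcases o with ⟨_ | _, y, x⟩ <;> simp [score₁]⟩
    (by
      have hreg := ae_isRegularPoint hη hε hπ
      rintro _ ⟨c, hc, rfl⟩ _ ⟨c', hc', rfl⟩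
      refine ⟨_, ⟨c + c', hc.add (hreg.mono fun x hx => hx.prob₁) hc', rfl⟩, .of_forall ?_⟩
      rintro ⟨_ | _, y, x⟩ <;> simp [score₁])
    (by
      rintro k _ ⟨c, hc, rfl⟩
      refine ⟨_, ⟨k • c, hc.smul k, rfl⟩, .of_forall ?_⟩
      rintro ⟨_ | _, y, x⟩ <;> simp [score₁])

/-- The elements of `ℋ` that are bounded scores for `g`. -/
def boundedSpace₂ : Submodule ℝ (meanZero d Q) :=
  meanZeroOf Q (boundedScores₂ M η)
    ⟨0, stronglyMeasurable_const, ⟨0, by simp⟩, by simp, rfl⟩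
    (by
      have := isProbabilityMeasure_covLaw hη
      rintro _ ⟨a, ha, ⟨K, hK⟩, h0, rfl⟩ _ ⟨a', ha', ⟨K', hK'⟩, h0', rfl⟩
      refine ⟨_, ⟨a + a', ha.add ha', ⟨K + K', fun x =>
        (norm_add_le _ _).trans (add_le_add (hK x) (hK' x))⟩, ?_, rfl⟩, .of_forall fun o => rfl⟩
      simp only [Pi.add_apply]
      rw [integral_add (.of_bound ha.aestronglyMeasurable K (.of_forall hK))
        (.of_bound ha'.aestronglyMeasurable K' (.of_forall hK')), h0, h0', add_zero])
    (by
      rintro k _ ⟨a, ha, ⟨K, hK⟩, h0, rfl⟩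
      refine ⟨_, ⟨k • a, ha.const_smul k, ⟨‖k‖ * K, fun x => ?_⟩, ?_, rfl⟩,
        .of_forall fun o => rfl⟩
      · simp only [Pi.smul_apply, norm_smul]
        exact mul_le_mul_of_nonneg_left (hK x) (norm_nonneg _)
      · simp only [Pi.smul_apply]
        rw [integral_smul, h0, smul_zero])

variable (M θ) in
/-- The elements of `ℋ` that are `(t - π) / (1 - π) g(x)` with bounded `g`. -/
def boundedSpace₃ : Submodule ℝ (meanZero d Q) :=
  meanZeroOf Q (boundedResiduals M θ)
    ⟨0, stronglyMeasurable_const, ⟨0, by simp⟩, by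
      ext o i; rcases o with ⟨_ | _, y, x⟩ <;> simp [residual]⟩
    (by
      rintro _ ⟨a, ha, ⟨K, hK⟩, rfl⟩ _ ⟨a', ha', ⟨K', hK'⟩, rfl⟩
      refine ⟨_, ⟨a + a', ha.add ha', ⟨K + K', fun x =>
        (norm_add_le _ _).trans (add_le_add (hK x) (hK' x))⟩, rfl⟩, .of_forall ?_⟩
      rintro ⟨_ | _, y, x⟩ <;> simp [residual])
    (by
      rintro k _ ⟨a, ha, ⟨K, hK⟩, rfl⟩
      refine ⟨_, ⟨k • a, ha.const_smul k, ⟨‖k‖ * K, fun x => ?_⟩, rfl⟩, .of_forall ?_⟩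
      · simp only [Pi.smul_apply, norm_smul]
        exact mul_le_mul_of_nonneg_left (hK x) (norm_nonneg _)
      · rintro ⟨_ | _, y, x⟩
        · simp only [residual, Pi.smul_apply, Bool.false_eq_true, if_false]
          rw [smul_comm]
        · simp [residual])

end Submodules

end ATT

namespace ATT

variable {d : ℕ} {𝒰 𝒵 : Type*} [MeasurableSpace 𝒰] [MeasurableSpace 𝒵]
variable {M : Model d 𝒰 𝒵} {θ : EuclideanSpace ℝ (Fin d)} {η η' : Nuisance 𝒰 𝒵} {ε : ℝ}

/-! ### The spaces of bounded scores, as subspaces of the Hilbert space -/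

section BoundedScores

variable {E : Type*} [NormedAddCommGroup E] [InnerProductSpace ℝ E]

theorem memLp_compProd_of_bounded {m : Measure (𝒰 × 𝒵)} [IsFiniteMeasure m]
    {κ : Kernel (𝒰 × 𝒵) ℝ} [IsSFiniteKernel κ] (hκ : ∀ᵐ x ∂m, IsProbabilityMeasure (κ x))
    {ν : Measure (𝒰 × 𝒵)} {c : ℝ → 𝒰 × 𝒵 → E} (hc : IsDirection ν κ c) :
    MemLp (fun p : (𝒰 × 𝒵) × ℝ => c p.2 p.1) 2 (m ⊗ₘ κ) := by
  have hfm : IsFiniteMeasure (m ⊗ₘ κ) := ⟨by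
    have h : (m ⊗ₘ κ).map Prod.fst Set.univ = m Set.univ := by rw [fst_compProd_of_ae hκ]
    rw [Measure.map_apply measurable_fst .univ, Set.preimage_univ] at h
    rw [h]; exact measure_lt_top _ _⟩
  obtain ⟨K, hK⟩ := hc.bounded
  exact .of_bound hc.stronglyMeasurable.aestronglyMeasurable K (.of_forall fun p => hK _ _)

theorem isFiniteMeasure_covLaw₁ (hη : η.IsDensity M)
    (hreg : ∀ᵐ x ∂M.ν, IsRegularPoint M θ η ε x) : IsFiniteMeasure (covLaw₁ M θ η) := by
  have := isProbabilityMeasure_covLaw hη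
  refine ⟨?_⟩
  rw [covLaw₁, withDensity_apply _ .univ, Measure.restrict_univ]
  calc ∫⁻ x, ENNReal.ofReal (1 - (M.oddsIntegral θ η x)⁻¹) ∂covLaw M η
      ≤ ∫⁻ _, 1 ∂covLaw M η := by
        refine lintegral_mono_ae ?_
        filter_upwards [ae_inv_odds_pos hreg] with x hx
        exact ENNReal.ofReal_le_one.2 (by linarith)
    _ < ⊤ := by simp

theorem isScore₀_of_mem (hη : η.IsDensity M) (hreg : ∀ᵐ x ∂M.ν, IsRegularPoint M θ η ε x)
    {h ψ : Obs 𝒰 𝒵 → E} (hψ : ψ ∈ boundedScores₀ M θ η) (he : h =ᵐ[obsLaw M θ η] ψ) :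
    IsScore₀ M θ η h := by
  obtain ⟨c, hc, rfl⟩ := hψ
  have hac := covLaw_absolutelyContinuous (M := M) (η := η)
  have := isFiniteMeasure_covLaw₀ hη hreg
  exact ⟨c, hc.stronglyMeasurable, memLp_compProd_of_bounded ((ae_covLaw₀_iff hη hreg).2
    (hac.ae_le (hreg.mono fun x hx => hx.prob₀))) hc, hac.ae_le hc.integral_eq_zero, he⟩

theorem isScore₁_of_mem (hη : η.IsDensity M) (hreg : ∀ᵐ x ∂M.ν, IsRegularPoint M θ η ε x)
    {h ψ : Obs 𝒰 𝒵 → E} (hψ : ψ ∈ boundedScores₁ M η) (he : h =ᵐ[obsLaw M θ η] ψ) :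
    IsScore₁ M θ η h := by
  obtain ⟨b, hb, rfl⟩ := hψ
  have hac := covLaw_absolutelyContinuous (M := M) (η := η)
  have := isFiniteMeasure_covLaw₁ hη hreg
  exact ⟨b, hb.stronglyMeasurable, memLp_compProd_of_bounded ((ae_covLaw₁_iff hη hreg).2
    (hac.ae_le (hreg.mono fun x hx => hx.prob₁))) hb, hac.ae_le hb.integral_eq_zero, he⟩

end BoundedScores

/-! ### Orthogonality and totality of the four bounded families -/

section Spaces

variable (hη : η.IsDensity M) (hε : 0 < ε)
  (hπ : ∀ᵐ p ∂(M.ν.prod M.μ₀), 0 < M.π θ p.2 p.1.1 ∧ M.π θ p.2 p.1.1 ≤ 1 - ε)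
  {Q : Measure (Obs 𝒰 𝒵)} [IsFiniteMeasure Q] (hQ : Q = obsLaw M θ η)

/-- The subspaces of `ℋ` of bounded scores for the three nuisance parts, and of bounded multiples
of the residual. -/
def boundedSpace : Fin 4 → Submodule ℝ (meanZero d Q) :=
  ![boundedSpace₀ hη hε hπ Q hQ, boundedSpace₁ hη hε hπ Q, boundedSpace₂ hη Q, boundedSpace₃ M θ Q]

variable {hη hε hπ hQ}

theorem mem_orthogonal_boundedSpace₀_iff (h : meanZero d Q) :
    h ∈ (boundedSpace hη hε hπ hQ 0)ᗮ ↔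
      ∀ᵐ x ∂covLaw M η, ∀ᵐ y ∂kernel₀ M η x, defect₀ M θ η h.1 y x = 0 := by
  have hreg := ae_isRegularPoint hη hε hπ
  have hL := Lp.memLp h.1
  refine (mem_orthogonal_iff_of_mem_iff (C := boundedScores₀ M θ η) (fun _ => Iff.rfl) ?_
    h).trans ?_
  · rintro _ ⟨c, hc, rfl⟩
    rw [hQ]
    exact ⟨memLp_of_ae_bounded hη hreg (stronglyMeasurable_score₀ hη hc.stronglyMeasurable)
      (ae_bounded_score₀ hη hε hreg hc), integral_score₀ hη hη hε hreg hreg rfl hc⟩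
  · rw [defect₀_eq_zero_iff hη hε hreg (Lp.stronglyMeasurable h.1)
      (hQ ▸ hL.integrable one_le_two), ← hQ]
    exact ⟨fun H c hc => H _ ⟨c, hc, rfl⟩, by rintro H _ ⟨c, hc, rfl⟩; exact H c hc⟩

theorem mem_orthogonal_boundedSpace₁_iff (h : meanZero d Q) :
    h ∈ (boundedSpace hη hε hπ hQ 1)ᗮ ↔
      ∀ᵐ x ∂covLaw M η, ∀ᵐ y ∂kernel₁ M η x, defect₁ M η h.1 y x = 0 := by
  have hreg := ae_isRegularPoint hη hε hπ
  have hL := Lp.memLp h.1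
  refine (mem_orthogonal_iff_of_mem_iff (C := boundedScores₁ M η) (fun _ => Iff.rfl) ?_
    h).trans ?_
  · rintro _ ⟨c, hc, rfl⟩
    rw [hQ]
    exact ⟨memLp_of_ae_bounded hη hreg (stronglyMeasurable_score₁ hc.stronglyMeasurable)
      (ae_bounded_score₁ hc), integral_score₁ hη hreg rfl hc⟩
  · rw [defect₁_eq_zero_iff hη hreg (Lp.stronglyMeasurable h.1)
      (hQ ▸ hL.integrable one_le_two), ← hQ]
    exact ⟨fun H c hc => H _ ⟨c, hc, rfl⟩, by rintro H _ ⟨c, hc, rfl⟩; exact H c hc⟩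

theorem mem_orthogonal_boundedSpace₂_iff (h : meanZero d Q) :
    h ∈ (boundedSpace hη hε hπ hQ 2)ᗮ ↔ ∀ᵐ x ∂covLaw M η, defect₂ M θ η h.1 x = 0 := by
  have hreg := ae_isRegularPoint hη hε hπ
  have hL := Lp.memLp h.1
  refine (mem_orthogonal_iff_of_mem_iff (C := boundedScores₂ M η) (fun _ => Iff.rfl) ?_
    h).trans ?_
  · rintro _ ⟨a, ha, ⟨K, hK⟩, h0, rfl⟩
    rw [hQ]
    exact ⟨memLp_of_ae_bounded hη hreg (stronglyMeasurable_score₂ ha)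
      ⟨K, .of_forall fun o => hK _⟩, (integral_score₂ hη hreg ha ⟨K, hK⟩).trans h0⟩
  · rw [defect₂_eq_zero_iff hη hreg (Lp.stronglyMeasurable h.1)
      (hQ ▸ hL.integrable one_le_two) (hQ ▸ h.2), ← hQ]
    exact ⟨fun H a ha hK h0 => H _ ⟨a, ha, hK, h0, rfl⟩,
      by rintro H _ ⟨a, ha, hK, h0, rfl⟩; exact H a ha hK h0⟩

theorem mem_orthogonal_boundedSpace₃_iff (h : meanZero d Q) :
    h ∈ (boundedSpace hη hε hπ hQ 3)ᗮ ↔ ∀ᵐ x ∂covLaw M η, defect₃ M θ η h.1 x = 0 := by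
  have hreg := ae_isRegularPoint hη hε hπ
  have hL := Lp.memLp h.1
  refine (mem_orthogonal_iff_of_mem_iff (C := boundedResiduals M θ) (fun _ => Iff.rfl) ?_
    h).trans ?_
  · rintro _ ⟨g, hg, ⟨K, hK⟩, rfl⟩
    rw [hQ]
    exact ⟨memLp_of_ae_bounded hη hreg (stronglyMeasurable_residual hg)
      (ae_bounded_residual hε hπ hg hK), integral_residual hη hε hπ hg ⟨K, hK⟩⟩
  · rw [defect₃_eq_zero_iff hη hε hreg (Lp.stronglyMeasurable h.1)
      (hQ ▸ hL.integrable one_le_two) hπ, ← hQ]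
    exact ⟨fun H g hg hK => H _ ⟨g, hg, hK, rfl⟩,
      by rintro H _ ⟨g, hg, hK, rfl⟩; exact H g hg hK⟩

theorem mem_orthogonalToOthers_iff_isScore₀ (h : meanZero d Q) :
    h ∈ orthogonalToOthers (boundedSpace hη hε hπ hQ) 0 ↔ IsScore₀ M θ η h.1 := by
  rw [isScore₀_iff hη hε (ae_isRegularPoint hη hε hπ) (Lp.stronglyMeasurable h.1)
    (hQ ▸ Lp.memLp h.1), mem_orthogonalToOthers, Fin.forall_fin_succ, Fin.forall_fin_succ,
    Fin.forall_fin_succ, Fin.forall_fin_one]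
  simp only [← mem_orthogonal_boundedSpace₁_iff (hη := hη) (hε := hε) (hπ := hπ) (hQ := hQ),
    ← mem_orthogonal_boundedSpace₂_iff (hη := hη) (hε := hε) (hπ := hπ) (hQ := hQ),
    ← mem_orthogonal_boundedSpace₃_iff (hη := hη) (hε := hε) (hπ := hπ) (hQ := hQ)]
  simp

theorem mem_orthogonalToOthers_iff_isScore₁ (h : meanZero d Q) :
    h ∈ orthogonalToOthers (boundedSpace hη hε hπ hQ) 1 ↔ IsScore₁ M θ η h.1 := by
  rw [isScore₁_iff hη (ae_isRegularPoint hη hε hπ) (Lp.stronglyMeasurable h.1)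
    (hQ ▸ Lp.memLp h.1), mem_orthogonalToOthers, Fin.forall_fin_succ, Fin.forall_fin_succ,
    Fin.forall_fin_succ, Fin.forall_fin_one]
  simp only [← mem_orthogonal_boundedSpace₀_iff (hη := hη) (hε := hε) (hπ := hπ) (hQ := hQ),
    ← mem_orthogonal_boundedSpace₂_iff (hη := hη) (hε := hε) (hπ := hπ) (hQ := hQ),
    ← mem_orthogonal_boundedSpace₃_iff (hη := hη) (hε := hε) (hπ := hπ) (hQ := hQ)]
  simp

theorem mem_orthogonalToOthers_iff_isScore₂ (h : meanZero d Q) :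
    h ∈ orthogonalToOthers (boundedSpace hη hε hπ hQ) 2 ↔ IsScore₂ M θ η h.1 := by
  rw [isScore₂_iff hη hε (ae_isRegularPoint hη hε hπ) (Lp.stronglyMeasurable h.1),
    mem_orthogonalToOthers, Fin.forall_fin_succ, Fin.forall_fin_succ,
    Fin.forall_fin_succ, Fin.forall_fin_one]
  simp only [← mem_orthogonal_boundedSpace₀_iff (hη := hη) (hε := hε) (hπ := hπ) (hQ := hQ),
    ← mem_orthogonal_boundedSpace₁_iff (hη := hη) (hε := hε) (hπ := hπ) (hQ := hQ),
    ← mem_orthogonal_boundedSpace₃_iff (hη := hη) (hε := hε) (hπ := hπ) (hQ := hQ)]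
  simp

theorem mem_orthogonalToOthers_iff_isResidual (h : meanZero d Q) :
    h ∈ orthogonalToOthers (boundedSpace hη hε hπ hQ) 3 ↔ IsResidual M θ η h.1 := by
  rw [isResidual_iff hη hε (ae_isRegularPoint hη hε hπ) (Lp.stronglyMeasurable h.1),
    mem_orthogonalToOthers, Fin.forall_fin_succ, Fin.forall_fin_succ,
    Fin.forall_fin_succ, Fin.forall_fin_one]
  simp only [← mem_orthogonal_boundedSpace₀_iff (hη := hη) (hε := hε) (hπ := hπ) (hQ := hQ),
    ← mem_orthogonal_boundedSpace₁_iff (hη := hη) (hε := hε) (hπ := hπ) (hQ := hQ),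
    ← mem_orthogonal_boundedSpace₂_iff (hη := hη) (hε := hε) (hπ := hπ) (hQ := hQ)]
  simp

/-- A bounded score is a score of the same type, so its other three defects vanish. Pairwise
orthogonality of the four families is read off from this. -/
theorem boundedSpace_le_orthogonalToOthers (i : Fin 4) :
    boundedSpace hη hε hπ hQ i ≤ orthogonalToOthers (boundedSpace hη hε hπ hQ) i := by
  have hreg := ae_isRegularPoint hη hε hπ
  intro h hh
  fin_cases i
  · obtain ⟨ψ, hψ, he⟩ := hh
    exact (mem_orthogonalToOthers_iff_isScore₀ h).2 (isScore₀_of_mem hη hreg hψ (hQ ▸ he))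
  · obtain ⟨ψ, hψ, he⟩ := hh
    exact (mem_orthogonalToOthers_iff_isScore₁ h).2 (isScore₁_of_mem hη hreg hψ (hQ ▸ he))
  · obtain ⟨_, ⟨a, ha, -, -, rfl⟩, he⟩ := hh
    exact (mem_orthogonalToOthers_iff_isScore₂ h).2 ⟨a, ha, hQ ▸ he⟩
  · obtain ⟨_, ⟨g, hg, -, rfl⟩, he⟩ := hh
    exact (mem_orthogonalToOthers_iff_isResidual h).2 ⟨g, hg, hQ ▸ he⟩

theorem isOrtho_boundedSpace {i j : Fin 4} (hij : i ≠ j) :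
    boundedSpace hη hε hπ hQ i ⟂ boundedSpace hη hε hπ hQ j := by
  rw [Submodule.isOrtho_iff_le]
  exact fun h hh => mem_orthogonalToOthers.1 (boundedSpace_le_orthogonalToOthers i hh) j hij.symm

theorem eq_zero_of_mem_orthogonal_boundedSpace {h : meanZero d Q}
    (hh : ∀ i, h ∈ (boundedSpace hη hε hπ hQ i)ᗮ) : h = 0 := by
  have := ae_eq_zero_of_defects hη (ae_isRegularPoint hη hε hπ) (Lp.stronglyMeasurable h.1)
    ((mem_orthogonal_boundedSpace₀_iff h).1 (hh 0)) ((mem_orthogonal_boundedSpace₁_iff h).1 (hh 1))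
    ((mem_orthogonal_boundedSpace₂_iff h).1 (hh 2)) ((mem_orthogonal_boundedSpace₃_iff h).1 (hh 3))
  rw [← hQ] at this
  exact Subtype.ext ((Lp.eq_zero_iff_ae_eq_zero).2 this)

end Spaces

end ATT

namespace ATT

/-! ### Scores of families that are differentiable in quadratic mean -/

section QuadraticMean

variable {α : Type*} [MeasurableSpace α] {μ : Measure α} {r : ℕ}

theorem memLp_sqrt {p : α → ℝ} (h0 : ∀ᵐ o ∂μ, 0 ≤ p o) (hi : Integrable p μ) :
    MemLp (fun o => √(p o)) 2 μ := by
  rw [memLp_two_iff_integrable_sq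
    (Real.continuous_sqrt.comp_aestronglyMeasurable hi.aestronglyMeasurable)]
  refine hi.congr ?_
  filter_upwards [h0] with o ho
  rw [Real.sq_sqrt ho]

theorem norm_sq_toLp_sqrt {p : α → ℝ} (h0 : ∀ᵐ o ∂μ, 0 ≤ p o)
    (h : MemLp (fun o => √(p o)) 2 μ) : ‖h.toLp‖ ^ 2 = ∫ o, p o ∂μ := by
  rw [← real_inner_self_eq_norm_sq, L2.inner_def]
  refine integral_congr_ae ?_
  filter_upwards [h0, h.coeFn_toLp] with o ho e
  rw [e, real_inner_self_eq_norm_sq, Real.norm_eq_abs, sq_abs, Real.sq_sqrt ho]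

/-- Along a line through 0 the root densities form a differentiable curve in L² whose squared norm
is the constant C; the derivative of the squared norm is the integral in question. Square
integrability of S is not assumed but deduced. -/
theorem integral_score_eq_zero {p : EuclideanSpace ℝ (Fin r) → α → ℝ}
    {S : α → EuclideanSpace ℝ (Fin r)} {C : ℝ}
    (hSm : Measurable S)
    (hp : ∀ᶠ γ in 𝓝 0, (∀ᵐ o ∂μ, 0 ≤ p γ o) ∧ Integrable (p γ) μ ∧ ∫ o, p γ o ∂μ = C)
    (hS : Tendsto (fun γ : EuclideanSpace ℝ (Fin r) =>
      eLpNorm (fun o => √(p γ o) - √(p 0 o) - 1 / 2 * inner ℝ γ (S o) * √(p 0 o)) 2 μ / ‖γ‖ₑ)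
      (𝓝[≠] 0) (𝓝 0)) (v : EuclideanSpace ℝ (Fin r)) :
    ∫ o, inner ℝ v (S o) * p 0 o ∂μ = 0 := by
  by_cases hv : v = 0
  · simp [hv]
  have hline : Tendsto (fun t : ℝ => t • v) (𝓝 0) (𝓝 0) := by
    have : Continuous fun t : ℝ => t • v := by fun_prop
    simpa using this.tendsto 0
  have hline' : Tendsto (fun t : ℝ => t • v) (𝓝[≠] 0) (𝓝[≠] 0) := by
    refine tendsto_nhdsWithin_iff.2 ⟨hline.mono_left nhdsWithin_le_nhds, ?_⟩
    filter_upwards [self_mem_nhdsWithin] with t ht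
    exact smul_ne_zero ht hv
  have hpt := hline.eventually hp
  have h0 := hp.self_of_nhds
  have m0 := memLp_sqrt h0.1 h0.2.1
  set R : ℝ → α → ℝ := fun t o =>
    √(p (t • v) o) - √(p 0 o) - 1 / 2 * inner ℝ (t • v) (S o) * √(p 0 o) with hR
  have hRt : Tendsto (fun t => eLpNorm (R t) 2 μ / ‖t • v‖ₑ) (𝓝[≠] 0) (𝓝 0) := hS.comp hline'
  set u : α → ℝ := fun o => 1 / 2 * inner ℝ v (S o) * √(p 0 o) with hu
  have hRu : ∀ t o, R t o = √(p (t • v) o) - √(p 0 o) - t * u o := fun t o => by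
    simp only [hR, hu, inner_smul_left, RCLike.conj_to_real]; ring
  -- A remainder of infinite norm would make the quotient infinite, whereas the quotient tends to 0.
  have hRm : ∀ᶠ t in 𝓝[≠] (0 : ℝ), MemLp (R t) 2 μ := by
    filter_upwards [hRt.eventually_lt_const one_pos, self_mem_nhdsWithin,
      hpt.filter_mono nhdsWithin_le_nhds] with t ht htne hpt
    refine ⟨((memLp_sqrt hpt.1 hpt.2.1).1.sub m0.1).sub
      ((Measurable.aestronglyMeasurable ?_).mul m0.1), ?_⟩
    · exact (measurable_const.inner hSm).const_mul _
    · by_contra htop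
      rw [not_lt_top_iff.1 htop, ENNReal.top_div_of_ne_top (by simp)] at ht
      exact not_top_lt ht
  -- A single t ≠ 0 suffices: t u is the difference of two root densities minus a remainder, all
  -- square integrable.
  have hum : MemLp u 2 μ := by
    obtain ⟨t, ⟨htm, hpt⟩, htne⟩ := ((hRm.and (hpt.filter_mono nhdsWithin_le_nhds)).and
      self_mem_nhdsWithin).exists
    have := (((memLp_sqrt hpt.1 hpt.2.1).sub m0).sub htm).const_mul t⁻¹
    refine (memLp_congr_ae (.of_forall fun o => ?_)).1 this
    have htne : t ≠ 0 := htne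
    simp only [Pi.sub_apply, hRu]
    field_simp
    ring
  classical
  -- The value 0 is taken only away from a neighbourhood of t = 0 and does not affect the derivative
  -- there.
  let a : ℝ → Lp ℝ 2 μ := fun t =>
    if h : MemLp (fun o => √(p (t • v) o)) 2 μ then h.toLp else 0
  have ha : ∀ᶠ t in 𝓝 (0 : ℝ), ∃ h : MemLp (fun o => √(p (t • v) o)) 2 μ, a t = h.toLp :=
    hpt.mono fun t ht => ⟨memLp_sqrt ht.1 ht.2.1, dif_pos _⟩
  have m0' : MemLp (fun o => √(p ((0 : ℝ) • v) o)) 2 μ := by simpa only [zero_smul] using m0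
  have ha0 : a 0 = m0'.toLp := dif_pos m0'
  have hderiv : HasDerivAt a hum.toLp 0 := by
    rw [hasDerivAt_iff_tendsto]
    have key : Tendsto (fun t : ℝ => ‖t - 0‖⁻¹ * ‖a t - a 0 - (t - 0) • hum.toLp‖)
        (𝓝[≠] 0) (𝓝 0) := by
      have h1 := ((ENNReal.tendsto_toReal ENNReal.zero_ne_top).comp hRt).const_mul ‖v‖
      simp only [ENNReal.toReal_zero, mul_zero] at h1
      refine h1.congr' ?_
      filter_upwards [ha.filter_mono nhdsWithin_le_nhds, hRm, self_mem_nhdsWithin]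
        with t ⟨ht, hat⟩ hRt htne
      have htne : t ≠ 0 := htne
      have e : a t - a 0 - (t - 0) • hum.toLp = hRt.toLp := by
        rw [hat, ha0, sub_zero, ← MemLp.toLp_sub, ← MemLp.toLp_const_smul, ← MemLp.toLp_sub]
        refine MemLp.toLp_congr _ _ (.of_forall fun o => ?_)
        simp only [Pi.sub_apply, Pi.smul_apply, hRu, zero_smul, smul_eq_mul]
      rw [e, Lp.norm_toLp, sub_zero]
      simp only [Function.comp_apply, ENNReal.toReal_div, toReal_enorm, norm_smul]
      have := norm_ne_zero_iff.2 hv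
      have := norm_ne_zero_iff.2 htne
      field_simp
    have h2 : ContinuousWithinAt
        (fun t : ℝ => ‖t - 0‖⁻¹ * ‖a t - a 0 - (t - 0) • hum.toLp‖) {0}ᶜ 0 := by
      simpa [ContinuousWithinAt] using key
    simpa [ContinuousAt] using continuousWithinAt_compl_self.1 h2
  have hconst : (fun t => ‖a t‖ ^ 2) =ᶠ[𝓝 0] fun _ => C := by
    filter_upwards [ha, hpt] with t ⟨ht, hat⟩ hpt
    rw [hat, norm_sq_toLp_sqrt hpt.1, hpt.2.2]
  have h1 := hderiv.norm_sq
  have h2 := h1.unique ((hasDerivAt_const (0 : ℝ) C).congr_of_eventuallyEq hconst)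
  rw [ha0, L2.inner_def, ← integral_const_mul] at h2
  rw [← h2]
  refine integral_congr_ae ?_
  filter_upwards [m0'.coeFn_toLp, hum.coeFn_toLp, h0.1] with o e1 e2 hpo
  rw [e1, e2, zero_smul]
  simp only [hu, RCLike.inner_apply, conj_trivial]
  linear_combination (-inner ℝ v (S o)) * Real.sq_sqrt hpo

end QuadraticMean

end ATT

namespace ATT

/-! ### Scores of submodels are orthogonal to functions with constant mean -/

variable {d r : ℕ} {𝒰 𝒵 : Type*} [MeasurableSpace 𝒰] [MeasurableSpace 𝒵]
variable {M : Model d 𝒰 𝒵} {θ : EuclideanSpace ℝ (Fin d)} {η : Nuisance 𝒰 𝒵} {ε : ℝ}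

theorem ae_likelihood_nonneg (hη : η.IsDensity M) (hreg : ∀ᵐ x ∂M.ν, IsRegularPoint M θ η ε x) :
    ∀ᵐ o ∂M.base, 0 ≤ M.likelihood θ η o := by
  filter_upwards [ae_base_of_ae hreg] with o ho using likelihood_nonneg hη ho _ _

theorem integral_obsLaw (hη : η.IsDensity M) (hreg : ∀ᵐ x ∂M.ν, IsRegularPoint M θ η ε x)
    (ψ : Obs 𝒰 𝒵 → ℝ) :
    ∫ o, ψ o ∂obsLaw M θ η = ∫ o, M.likelihood θ η o * ψ o ∂M.base := by
  rw [← withDensity_likelihood hη hreg, integral_withDensity_eq_integral_toReal_smul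
    (measurable_likelihood hη).ennreal_ofReal (.of_forall fun _ => ENNReal.ofReal_lt_top)]
  refine integral_congr_ae ?_
  filter_upwards [ae_likelihood_nonneg hη hreg] with o ho
  rw [ENNReal.toReal_ofReal ho, smul_eq_mul]

theorem integrable_obsLaw_iff (hη : η.IsDensity M)
    (hreg : ∀ᵐ x ∂M.ν, IsRegularPoint M θ η ε x) {ψ : Obs 𝒰 𝒵 → ℝ} :
    Integrable ψ (obsLaw M θ η) ↔ Integrable (fun o => M.likelihood θ η o * ψ o) M.base := by
  rw [← withDensity_likelihood hη hreg, integrable_withDensity_iff_integrable_smul'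
    (measurable_likelihood hη).ennreal_ofReal (.of_forall fun _ => ENNReal.ofReal_lt_top)]
  refine integrable_congr ?_
  filter_upwards [ae_likelihood_nonneg hη hreg] with o ho
  rw [ENNReal.toReal_ofReal ho, smul_eq_mul]

/-- A bounded nonnegative function whose mean does not change along a submodel is orthogonal to
the score. -/
theorem IsSubmodel.integral_mul_score {ηγ : EuclideanSpace ℝ (Fin r) → Nuisance 𝒰 𝒵}
    {S : Obs 𝒰 𝒵 → EuclideanSpace ℝ (Fin r)} (hsub : IsSubmodel M θ η ηγ S)
    (hreg : ∀ η' : Nuisance 𝒰 𝒵, η'.IsDensity M → ∀ᵐ x ∂M.ν, IsRegularPoint M θ η' ε x)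
    {φ : Obs 𝒰 𝒵 → ℝ} (hφ : Measurable φ) {K C : ℝ} (hφ0 : ∀ᵐ o ∂M.base, 0 ≤ φ o ∧ φ o ≤ K)
    (hφC : ∀ᶠ γ in 𝓝 0, ∫ o, φ o ∂obsLaw M θ (ηγ γ) = C) (v : EuclideanSpace ℝ (Fin r)) :
    ∫ o, φ o * inner ℝ v (S o) ∂obsLaw M θ η = 0 := by
  have hη : η.IsDensity M := hsub.at_zero ▸ hsub.isDensity.self_of_nhds
  have hac : M.base.withDensity (fun o => ENNReal.ofReal (φ o)) ≪ M.base :=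
    withDensity_absolutelyContinuous _ _
  have hle : M.base.withDensity (fun o => ENNReal.ofReal (φ o)) ≤ ENNReal.ofReal K • M.base := by
    rw [← withDensity_const]
    exact withDensity_mono (hφ0.mono fun o ho => ENNReal.ofReal_le_ofReal ho.2)
  have hint : ∀ u : Obs 𝒰 𝒵 → ℝ, ∫ o, u o ∂M.base.withDensity (fun o => ENNReal.ofReal (φ o)) =
      ∫ o, φ o * u o ∂M.base := fun u => by
    rw [integral_withDensity_eq_integral_toReal_smul hφ.ennreal_ofReal
      (.of_forall fun _ => ENNReal.ofReal_lt_top)]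
    refine integral_congr_ae ?_
    filter_upwards [hφ0] with o ho
    rw [ENNReal.toReal_ofReal ho.1, smul_eq_mul]
  -- With the weight φ built into the measure, the total mass of the likelihood is the mean of φ,
  -- which is constant along the submodel.
  have key := integral_score_eq_zero (μ := M.base.withDensity fun o => ENNReal.ofReal (φ o))
    (p := fun γ => M.likelihood θ (ηγ γ)) (S := S) (C := C) hsub.measurable_score ?_ ?_ v
  · rw [hint, hsub.at_zero] at key
    rw [integral_obsLaw hη (hreg η hη), ← key]
    exact integral_congr_ae (.of_forall fun o => by ring)
  · filter_upwards [hsub.isDensity, hφC] with γ hγ hC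
    have hp := isProbabilityMeasure_obsLaw hγ (hreg _ hγ)
    have h1 : Integrable (M.likelihood θ (ηγ γ)) M.base := by
      simpa using (integrable_obsLaw_iff hγ (hreg _ hγ)).1 (integrable_const (1 : ℝ))
    refine ⟨hac.ae_le (ae_likelihood_nonneg hγ (hreg _ hγ)),
      (h1.smul_measure ENNReal.ofReal_ne_top).mono_measure hle, ?_⟩
    rw [hint, ← hC, integral_obsLaw hγ (hreg _ hγ)]
    exact integral_congr_ae (.of_forall fun o => mul_comm _ _)
  -- The weighted measure is at most K times `M.base`, so L² norms grow by a factor of at most √K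
  -- and the remainder stays negligible.
  · have h1 := ENNReal.Tendsto.const_mul (a := ENNReal.ofReal K ^ (1 / 2 : ℝ≥0∞).toReal) hsub.score
      (.inr (by simp))
    rw [mul_zero] at h1
    refine tendsto_of_tendsto_of_tendsto_of_le_of_le tendsto_const_nhds h1
      (fun _ => zero_le) fun γ => ?_
    simp only [hsub.at_zero]
    rw [← mul_div_assoc]
    refine ENNReal.div_le_div_right ((eLpNorm_mono_measure _ hle).trans ?_) _
    exact eLpNorm_smul_measure_le _ _ _ _

/-- Coordinatewise reduction to `IsSubmodel.integral_mul_score`: adding the bound K makes a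
coordinate of ψ nonnegative, and the extra term K times that coordinate of h integrates to zero. -/
theorem IsSubmodel.integral_inner_score {ηγ : EuclideanSpace ℝ (Fin r) → Nuisance 𝒰 𝒵}
    {S : Obs 𝒰 𝒵 → EuclideanSpace ℝ (Fin r)} (hsub : IsSubmodel M θ η ηγ S)
    (hreg : ∀ η' : Nuisance 𝒰 𝒵, η'.IsDensity M → ∀ᵐ x ∂M.ν, IsRegularPoint M θ η' ε x)
    {B : EuclideanSpace ℝ (Fin r) →ₗ[ℝ] EuclideanSpace ℝ (Fin d)}
    {h : Obs 𝒰 𝒵 → EuclideanSpace ℝ (Fin d)} (hB : h =ᵐ[obsLaw M θ η] fun o => B (S o))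
    (hi : Integrable h (obsLaw M θ η)) (h0 : ∫ o, h o ∂obsLaw M θ η = 0)
    {ψ : Obs 𝒰 𝒵 → EuclideanSpace ℝ (Fin d)} (hψ : StronglyMeasurable ψ)
    (hb : ∃ K, ∀ᵐ o ∂M.base, ‖ψ o‖ ≤ K)
    (hψ0 : ∀ γ, (ηγ γ).IsDensity M → ∫ o, ψ o ∂obsLaw M θ (ηγ γ) = 0) :
    ∫ o, inner ℝ (ψ o) (h o) ∂obsLaw M θ η = 0 := by
  have hη : η.IsDensity M := hsub.at_zero ▸ hsub.isDensity.self_of_nhds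
  have hp := isProbabilityMeasure_obsLaw hη (hreg _ hη)
  obtain ⟨K, hK⟩ := hb
  have hac := obsLaw_absolutelyContinuous hη (hreg _ hη)
  have hψk : ∀ k, ∀ᵐ o ∂M.base, |ψ o k| ≤ K := fun k => by
    filter_upwards [hK] with o ho
    exact (PiLp.norm_apply_le (ψ o) k).trans ho
  have hψm : ∀ k, Measurable fun o => ψ o k := fun k =>
    (EuclideanSpace.proj (𝕜 := ℝ) k).continuous.measurable.comp hψ.measurable
  have hik : ∀ k, Integrable (fun o => h o k) (obsLaw M θ η) := fun k =>
    (EuclideanSpace.proj (𝕜 := ℝ) k).integrable_comp hi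
  have hprod : ∀ k, Integrable (fun o => ψ o k * h o k) (obsLaw M θ η) := fun k =>
    (hik k).bdd_mul (hψm k).aestronglyMeasurable (hac.ae_le (hψk k))
  have e : ∀ o, inner ℝ (ψ o) (h o) = ∑ k, ψ o k * h o k := fun o => by
    simp [PiLp.inner_apply, mul_comm]
  simp_rw [e]
  rw [integral_finsetSum _ fun k _ => hprod k]
  refine Finset.sum_eq_zero fun k _ => ?_
  -- The adjoint of B applied to a basis vector is the direction in which the score equals the k-th
  -- coordinate of B S.
  have key := hsub.integral_mul_score hreg (φ := fun o => ψ o k + K) ((hψm k).add_const K)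
    (K := K + K) (C := K) ?_ ?_ (LinearMap.adjoint B (EuclideanSpace.single k 1))
  · have h0k : ∫ o, h o k ∂obsLaw M θ η = 0 := by
      have := (EuclideanSpace.proj (𝕜 := ℝ) k).integral_comp_comm hi
      rw [h0] at this
      simpa using this
    have e2 : ∫ o, (ψ o k * h o k + K * h o k) ∂obsLaw M θ η = 0 := by
      rw [← key]
      refine integral_congr_ae ?_
      filter_upwards [hB] with o ho
      rw [ho, LinearMap.adjoint_inner_left, EuclideanSpace.inner_single_left]
      simp only [map_one, one_mul]
      ring
    rwa [integral_add (hprod k) ((hik k).const_mul K), integral_const_mul, h0k, mul_zero,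
      add_zero] at e2
  · filter_upwards [hψk k] with o ho
    have := abs_le.1 ho
    constructor <;> linarith
  · filter_upwards [hsub.isDensity] with γ hγ
    have hp' := isProbabilityMeasure_obsLaw hγ (hreg _ hγ)
    have hψi := integrable_of_ae_bounded hγ (hreg _ hγ) hψ ⟨K, hK⟩
    have := (EuclideanSpace.proj (𝕜 := ℝ) k).integral_comp_comm hψi
    rw [hψ0 γ hγ] at this
    have e3 : ∫ o, ψ o k ∂obsLaw M θ (ηγ γ) = 0 := by simpa using this
    have hik : Integrable (fun o => ψ o k) (obsLaw M θ (ηγ γ)) :=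
      (EuclideanSpace.proj (𝕜 := ℝ) k).integrable_comp hψi
    rw [integral_add hik (integrable_const _), e3]
    simp

end ATT

namespace ATT

/-! ### The tangent spaces of submodels are orthogonal to the other bounded scores -/

variable {d r : ℕ} {𝒰 𝒵 : Type*} [MeasurableSpace 𝒰] [MeasurableSpace 𝒵]
variable {M : Model d 𝒰 𝒵} {θ : EuclideanSpace ℝ (Fin d)} {η : Nuisance 𝒰 𝒵} {ε : ℝ}
variable {hη : η.IsDensity M} {hε : 0 < ε}
  {hπ : ∀ᵐ p ∂(M.ν.prod M.μ₀), 0 < M.π θ p.2 p.1.1 ∧ M.π θ p.2 p.1.1 ≤ 1 - ε}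
  {Q : Measure (Obs 𝒰 𝒵)} [IsFiniteMeasure Q] {hQ : Q = obsLaw M θ η}

namespace IsSubmodel

variable {ηγ : EuclideanSpace ℝ (Fin r) → Nuisance 𝒰 𝒵}
  {S : Obs 𝒰 𝒵 → EuclideanSpace ℝ (Fin r)}
  {B : EuclideanSpace ℝ (Fin r) →ₗ[ℝ] EuclideanSpace ℝ (Fin d)} {h : meanZero d Q}

/-- Fixing f₀ along the submodel keeps the mean of every bounded score for f₀ at zero, by
`integral_score₀`. The next two theorems do the same for f₁ and g; the last one needs no part to be
fixed. -/
theorem mem_orthogonal_boundedSpace₀ (hsub : IsSubmodel M θ η ηγ S)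
    (hB : h.1 =ᵐ[Q] fun o => B (S o)) (hf : ∀ γ, (ηγ γ).f₀ = η.f₀) :
    h ∈ (boundedSpace hη hε hπ hQ 0)ᗮ := by
  have hreg := fun η' (hη' : Nuisance.IsDensity M η') => ae_isRegularPoint hη' hε hπ
  have hi : Integrable h.1 (obsLaw M θ η) := hQ ▸ (Lp.memLp h.1).integrable one_le_two
  have h0 : ∫ o, h.1 o ∂obsLaw M θ η = 0 := hQ ▸ h.2
  have hB' : h.1 =ᵐ[obsLaw M θ η] fun o => B (S o) := hQ ▸ hB
  have hm := Lp.stronglyMeasurable h.1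
  rw [mem_orthogonal_boundedSpace₀_iff,
    defect₀_eq_zero_iff hη hε (hreg η hη) hm hi]
  exact fun c hc => hsub.integral_inner_score hreg hB' hi h0
    (stronglyMeasurable_score₀ hη hc.stronglyMeasurable) (ae_bounded_score₀ hη hε (hreg η hη) hc)
    fun γ hγ => integral_score₀ hη hγ hε (hreg η hη) (hreg _ hγ) (hf γ) hc

theorem mem_orthogonal_boundedSpace₁ (hsub : IsSubmodel M θ η ηγ S)
    (hB : h.1 =ᵐ[Q] fun o => B (S o)) (hf : ∀ γ, (ηγ γ).f₁ = η.f₁) :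
    h ∈ (boundedSpace hη hε hπ hQ 1)ᗮ := by
  have hreg := fun η' (hη' : Nuisance.IsDensity M η') => ae_isRegularPoint hη' hε hπ
  have hi : Integrable h.1 (obsLaw M θ η) := hQ ▸ (Lp.memLp h.1).integrable one_le_two
  have h0 : ∫ o, h.1 o ∂obsLaw M θ η = 0 := hQ ▸ h.2
  have hB' : h.1 =ᵐ[obsLaw M θ η] fun o => B (S o) := hQ ▸ hB
  have hm := Lp.stronglyMeasurable h.1
  rw [mem_orthogonal_boundedSpace₁_iff,
    defect₁_eq_zero_iff hη (hreg η hη) hm hi]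
  exact fun b hb => hsub.integral_inner_score hreg hB' hi h0
    (stronglyMeasurable_score₁ hb.stronglyMeasurable) (ae_bounded_score₁ hb)
    fun γ hγ => integral_score₁ hγ (hreg _ hγ) (hf γ) hb

theorem mem_orthogonal_boundedSpace₂ (hsub : IsSubmodel M θ η ηγ S)
    (hB : h.1 =ᵐ[Q] fun o => B (S o)) (hg : ∀ γ, (ηγ γ).g = η.g) :
    h ∈ (boundedSpace hη hε hπ hQ 2)ᗮ := by
  have hreg := fun η' (hη' : Nuisance.IsDensity M η') => ae_isRegularPoint hη' hε hπ
  have hi : Integrable h.1 (obsLaw M θ η) := hQ ▸ (Lp.memLp h.1).integrable one_le_two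
  have h0 : ∫ o, h.1 o ∂obsLaw M θ η = 0 := hQ ▸ h.2
  have hB' : h.1 =ᵐ[obsLaw M θ η] fun o => B (S o) := hQ ▸ hB
  have hm := Lp.stronglyMeasurable h.1
  rw [mem_orthogonal_boundedSpace₂_iff,
    defect₂_eq_zero_iff hη (hreg η hη) hm hi h0]
  rintro a ha ⟨K, hK⟩ ha0
  refine hsub.integral_inner_score hreg hB' hi h0
    (stronglyMeasurable_score₂ ha) ⟨K, .of_forall fun o => hK _⟩ fun γ hγ => ?_
  rw [integral_score₂ hγ (hreg _ hγ) ha ⟨K, hK⟩, covLaw, hg γ]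
  exact ha0

theorem mem_orthogonal_boundedSpace₃ (hsub : IsSubmodel M θ η ηγ S)
    (hB : h.1 =ᵐ[Q] fun o => B (S o)) : h ∈ (boundedSpace hη hε hπ hQ 3)ᗮ := by
  have hreg := fun η' (hη' : Nuisance.IsDensity M η') => ae_isRegularPoint hη' hε hπ
  have hi : Integrable h.1 (obsLaw M θ η) := hQ ▸ (Lp.memLp h.1).integrable one_le_two
  have h0 : ∫ o, h.1 o ∂obsLaw M θ η = 0 := hQ ▸ h.2
  have hB' : h.1 =ᵐ[obsLaw M θ η] fun o => B (S o) := hQ ▸ hB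
  have hm := Lp.stronglyMeasurable h.1
  rw [mem_orthogonal_boundedSpace₃_iff,
    defect₃_eq_zero_iff hη hε (hreg η hη) hm hi hπ]
  rintro g hg ⟨K, hK⟩
  exact hsub.integral_inner_score hreg hB' hi h0
    (stronglyMeasurable_residual hg) (ae_bounded_residual hε hπ hg hK) fun γ hγ =>
      integral_residual hγ hε hπ hg ⟨K, hK⟩

end IsSubmodel

end ATT

namespace ATT

/-! ### Differentiability in quadratic mean of a likelihood ratio -/

/-- Uses √R - 1 - s/2 = (R - 1 - s)/2 - (√R - 1)²/2 and |√R - 1| ≤ |R - 1| ≤ 4m + 16m² ≤ 12m; the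
two halves give 8m² + 72m². -/
theorem abs_sqrt_sub_one_sub_le {R s m : ℝ} (hR : 0 ≤ R) (hm : 0 ≤ m) (hm' : m ≤ 1 / 2)
    (hs : |s| ≤ 4 * m) (h : |R - 1 - s| ≤ 16 * m ^ 2) : |√R - 1 - 1 / 2 * s| ≤ 80 * m ^ 2 := by
  have hq := Real.sq_sqrt hR
  have hq0 := Real.sqrt_nonneg R
  have h1 : |R - 1| ≤ 12 * m := by
    rw [abs_le] at *
    constructor <;> nlinarith
  have h2 : (√R - 1) ^ 2 ≤ (12 * m) ^ 2 := by
    have : |√R - 1| ≤ |R - 1| := by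
      have e : R - 1 = (√R - 1) * (√R + 1) := by nlinarith
      rw [e, abs_mul]
      refine le_mul_of_one_le_right (abs_nonneg _) ?_
      rw [abs_of_nonneg (by linarith)]
      linarith
    rw [← sq_abs]
    exact pow_le_pow_left₀ (abs_nonneg _) (this.trans h1) 2
  rw [abs_le] at *
  constructor <;> nlinarith [sq_nonneg (√R - 1)]

/-- Over the common denominator the error is a sum of eight products, each at most m² in size, and
the denominator is at least 1/2. -/
theorem ratio_bounds {u₁ u₂ u₃ u₄ m : ℝ} (hm' : m ≤ 1 / 2) (h₁ : |u₁| ≤ m) (h₂ : |u₂| ≤ m)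
    (h₃ : |u₃| ≤ m) (h₄ : |u₄| ≤ m) :
    0 ≤ (1 + u₁) * (1 + u₂) * (1 + u₃) / (1 + u₄) ∧
      |(1 + u₁) * (1 + u₂) * (1 + u₃) / (1 + u₄) - 1 - (u₁ + u₂ + u₃ - u₄)| ≤ 16 * m ^ 2 := by
  have hm : 0 ≤ m := (abs_nonneg _).trans h₁
  have k₁ := abs_le.1 h₁
  have k₂ := abs_le.1 h₂
  have k₃ := abs_le.1 h₃
  have k₄ := abs_le.1 h₄
  have hpos : 0 < 1 + u₄ := by linarith
  refine ⟨div_nonneg (mul_nonneg (mul_nonneg (by linarith) (by linarith)) (by linarith)) hpos.le,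
    ?_⟩
  have e : (1 + u₁) * (1 + u₂) * (1 + u₃) / (1 + u₄) - 1 - (u₁ + u₂ + u₃ - u₄) =
      (u₁ * u₂ + u₁ * u₃ + u₂ * u₃ + u₁ * u₂ * u₃ -
        (u₁ * u₄ + u₂ * u₄ + u₃ * u₄ - u₄ * u₄)) / (1 + u₄) := by
    field_simp
    ring
  have hmul : ∀ {a b p q : ℝ}, |a| ≤ p → |b| ≤ q → |a * b| ≤ p * q := fun {a b p q} ha hb => by
    rw [abs_mul]
    exact mul_le_mul ha hb (abs_nonneg _) ((abs_nonneg _).trans ha)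
  have a₁ := abs_le.1 (hmul h₁ h₂)
  have a₂ := abs_le.1 (hmul h₁ h₃)
  have a₃ := abs_le.1 (hmul h₂ h₃)
  have a₄ := abs_le.1 (hmul (hmul h₁ h₂) h₃)
  have a₅ := abs_le.1 (hmul h₁ h₄)
  have a₆ := abs_le.1 (hmul h₂ h₄)
  have a₇ := abs_le.1 (hmul h₃ h₄)
  have a₈ := abs_le.1 (hmul h₄ h₄)
  have hm3 : m * m * m ≤ m * m := by nlinarith [mul_nonneg hm hm]
  rw [e, abs_div, abs_of_pos hpos, div_le_iff₀ hpos]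
  have : |u₁ * u₂ + u₁ * u₃ + u₂ * u₃ + u₁ * u₂ * u₃ -
        (u₁ * u₄ + u₂ * u₄ + u₃ * u₄ - u₄ * u₄)| ≤ 8 * m ^ 2 :=
    abs_le.2 ⟨by nlinarith, by nlinarith⟩
  refine this.trans ?_
  nlinarith [mul_nonneg hm hm]

/-- For small γ the remainder is pointwise at most 80 K² ‖γ‖² √p₀, hence of order ‖γ‖² in L². Three
factors in the numerator and one in the denominator are what tilting all nuisance parts produces. -/
theorem tendsto_score_of_ratio {α V : Type*} [MeasurableSpace α] {μ : Measure α}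
    [NormedAddCommGroup V] [InnerProductSpace ℝ V] {p : V → α → ℝ} {p₀ : α → ℝ}
    {α₁ α₂ α₃ α₄ S : α → V} {K : ℝ}
    (hK : ∀ᵐ o ∂μ, ‖α₁ o‖ ≤ K ∧ ‖α₂ o‖ ≤ K ∧ ‖α₃ o‖ ≤ K ∧ ‖α₄ o‖ ≤ K)
    (h0 : ∀ᵐ o ∂μ, 0 ≤ p₀ o) (hi : Integrable p₀ μ)
    (hS : ∀ᵐ o ∂μ, S o = α₁ o + α₂ o + α₃ o - α₄ o)
    (hp : ∀ᵐ o ∂μ, ∀ γ, p γ o = p₀ o * ((1 + inner ℝ γ (α₁ o)) * (1 + inner ℝ γ (α₂ o)) *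
      (1 + inner ℝ γ (α₃ o)) / (1 + inner ℝ γ (α₄ o)))) :
    Tendsto (fun γ : V =>
      eLpNorm (fun o => √(p γ o) - √(p₀ o) - 1 / 2 * inner ℝ γ (S o) * √(p₀ o)) 2 μ / ‖γ‖ₑ)
      (𝓝[≠] 0) (𝓝 0) := by
  have hN : eLpNorm (fun o => √(p₀ o)) 2 μ ≠ ⊤ := (memLp_sqrt h0 hi).2.ne
  set N := eLpNorm (fun o => √(p₀ o)) 2 μ
  have hlim : Tendsto (fun γ : V => ENNReal.ofReal (80 * K ^ 2 * ‖γ‖) * N) (𝓝[≠] 0) (𝓝 0) := by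
    have h1 : Tendsto (fun γ : V => ENNReal.ofReal (80 * K ^ 2 * ‖γ‖)) (𝓝 0) (𝓝 0) := by
      have : Continuous fun γ : V => ENNReal.ofReal (80 * K ^ 2 * ‖γ‖) :=
        ENNReal.continuous_ofReal.comp (by fun_prop)
      simpa using this.tendsto 0
    simpa using (ENNReal.Tendsto.mul_const h1 (.inr hN)).mono_left nhdsWithin_le_nhds
  have hsmall : ∀ᶠ γ : V in 𝓝[≠] 0, K * ‖γ‖ < 1 / 2 := by
    have : Continuous fun γ : V => K * ‖γ‖ := by fun_prop
    have h := (this.tendsto 0).mono_left (nhdsWithin_le_nhds (s := {0}ᶜ))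
    exact h.eventually_lt_const (by simp)
  refine tendsto_of_tendsto_of_tendsto_of_le_of_le' tendsto_const_nhds hlim
    (.of_forall fun _ => zero_le) ?_
  filter_upwards [hsmall, self_mem_nhdsWithin] with γ hγ hne
  have hne : γ ≠ 0 := hne
  have hbound : eLpNorm (fun o => √(p γ o) - √(p₀ o) - 1 / 2 * inner ℝ γ (S o) * √(p₀ o)) 2 μ ≤
      ENNReal.ofReal (80 * (K * ‖γ‖) ^ 2) * N := by
    refine eLpNorm_le_mul_eLpNorm_of_ae_le_mul ?_ 2
    filter_upwards [hK, h0, hS, hp] with o hKo h0o hSo hpo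
    have hin : ∀ {v : V}, ‖v‖ ≤ K → |inner ℝ γ v| ≤ K * ‖γ‖ := fun {v} hv => by
      refine (abs_real_inner_le_norm _ _).trans ?_
      rw [mul_comm]
      exact mul_le_mul_of_nonneg_right hv (norm_nonneg _)
    have b₁ := hin hKo.1
    have b₂ := hin hKo.2.1
    have b₃ := hin hKo.2.2.1
    have b₄ := hin hKo.2.2.2
    obtain ⟨hR, hRs⟩ := ratio_bounds hγ.le b₁ b₂ b₃ b₄
    have hm : 0 ≤ K * ‖γ‖ := (abs_nonneg _).trans b₁
    have hs : |inner ℝ γ (α₁ o) + inner ℝ γ (α₂ o) + inner ℝ γ (α₃ o) - inner ℝ γ (α₄ o)| ≤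
        4 * (K * ‖γ‖) := by
      have k₁ := abs_le.1 b₁
      have k₂ := abs_le.1 b₂
      have k₃ := abs_le.1 b₃
      have k₄ := abs_le.1 b₄
      exact abs_le.2 ⟨by linarith, by linarith⟩
    have key := abs_sqrt_sub_one_sub_le hR hm hγ.le hs hRs
    rw [hpo γ, Real.sqrt_mul h0o, hSo, inner_sub_right, inner_add_right, inner_add_right,
      Real.norm_eq_abs, Real.norm_eq_abs]
    refine le_of_eq_of_le ?_ (mul_le_mul_of_nonneg_right key (abs_nonneg _))
    rw [← abs_mul]
    congr 1
    ring
  refine (ENNReal.div_le_div_right hbound _).trans (le_of_eq ?_)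
  have e1 : ‖γ‖ₑ ≠ 0 := by simpa using hne
  have e2 : ENNReal.ofReal (80 * (K * ‖γ‖) ^ 2) =
      ENNReal.ofReal (80 * K ^ 2 * ‖γ‖) * ‖γ‖ₑ := by
    rw [← ofReal_norm, ← ENNReal.ofReal_mul (by positivity)]
    congr 1
    ring
  rw [e2, mul_right_comm, ENNReal.mul_div_cancel_right e1 (by simp)]

end ATT

namespace ATT

/-! ### Submodels with given bounded scores -/

variable {d r : ℕ} {𝒰 𝒵 : Type*} [MeasurableSpace 𝒰] [MeasurableSpace 𝒵]
variable {M : Model d 𝒰 𝒵} {θ : EuclideanSpace ℝ (Fin d)} {η : Nuisance 𝒰 𝒵} {ε : ℝ}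

/-- The nuisance parts, with densities multiplied by `1 + ⟨γ, direction⟩`. -/
def Nuisance.tilt (η : Nuisance 𝒰 𝒵) (c b : ℝ → 𝒰 × 𝒵 → EuclideanSpace ℝ (Fin r))
    (a : 𝒰 × 𝒵 → EuclideanSpace ℝ (Fin r)) (γ : EuclideanSpace ℝ (Fin r)) : Nuisance 𝒰 𝒵 where
  f₀ x y := η.f₀ x y * (1 + inner ℝ γ (c y x))
  f₁ x y := η.f₁ x y * (1 + inner ℝ γ (b y x))
  g x := η.g x * (1 + inner ℝ γ (a x))

variable {c b : ℝ → 𝒰 × 𝒵 → EuclideanSpace ℝ (Fin r)} {a : 𝒰 × 𝒵 → EuclideanSpace ℝ (Fin r)}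

theorem one_add_inner_nonneg {γ v : EuclideanSpace ℝ (Fin r)} {K : ℝ} (hγ : ‖γ‖ * K ≤ 1)
    (hv : ‖v‖ ≤ K) : 0 ≤ 1 + inner ℝ γ v := by
  have := (abs_le.1 (abs_real_inner_le_norm γ v)).1
  have := mul_le_mul_of_nonneg_left hv (norm_nonneg γ)
  linarith

/-- The perturbation integrates to zero, and the bound on γ keeps the tilted density nonnegative, so
that `ENNReal.ofReal` does not truncate. -/
theorem lintegral_mul_one_add_inner {α : Type*} [MeasurableSpace α] {μ : Measure α} {f : α → ℝ}
    (hf : Measurable f) (hf0 : ∀ y, 0 ≤ f y)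
    [IsProbabilityMeasure (μ.withDensity fun y => ENNReal.ofReal (f y))]
    {c : α → EuclideanSpace ℝ (Fin r)} (hc : StronglyMeasurable c) {K : ℝ} (hK : ∀ y, ‖c y‖ ≤ K)
    (h0 : ∫ y, c y ∂μ.withDensity (fun y => ENNReal.ofReal (f y)) = 0)
    {γ : EuclideanSpace ℝ (Fin r)} (hγ : ‖γ‖ * K ≤ 1) :
    ∫⁻ y, ENNReal.ofReal (f y * (1 + inner ℝ γ (c y))) ∂μ = 1 := by
  have hi : Integrable c (μ.withDensity fun y => ENNReal.ofReal (f y)) :=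
    .of_bound hc.aestronglyMeasurable K (.of_forall hK)
  have hm : Measurable fun y => 1 + inner ℝ γ (c y) :=
    measurable_const.add (measurable_const.inner hc.measurable)
  have hint : Integrable (fun y => 1 + inner ℝ γ (c y))
      (μ.withDensity fun y => ENNReal.ofReal (f y)) :=
    (integrable_const _).add (hi.const_inner γ)
  have e := lintegral_withDensity_eq_lintegral_mul μ hf.ennreal_ofReal hm.ennreal_ofReal
  simp only [Pi.mul_apply, ← ENNReal.ofReal_mul (hf0 _)] at e
  rw [← e, ← ofReal_integral_eq_lintegral_ofReal hint
    (.of_forall fun y => one_add_inner_nonneg hγ (hK y)),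
    integral_add (integrable_const _) (hi.const_inner γ), integral_inner hi, h0]
  simp

theorem isCondDensity_tilt {μ : Measure ℝ} [SFinite μ] {f : 𝒰 × 𝒵 → ℝ → ℝ}
    (hf : IsCondDensity M.ν μ f) (hc : IsDirection M.ν (condKernel μ f) c) {K : ℝ}
    (hK : ∀ y x, ‖c y x‖ ≤ K) {γ : EuclideanSpace ℝ (Fin r)} (hγ : ‖γ‖ * K ≤ 1) :
    IsCondDensity M.ν μ fun x y => f x y * (1 + inner ℝ γ (c y x)) where
  measurable := hf.measurable.mul
    (measurable_const.add (measurable_const.inner hc.stronglyMeasurable.measurable))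
  nonneg x y := mul_nonneg (hf.nonneg x y) (one_add_inner_nonneg hγ (hK y x))
  lintegral_eq_one := by
    filter_upwards [hf.lintegral_eq_one, hc.integral_eq_zero] with x h1 h0
    rw [condKernel_apply hf.measurable] at h0
    have : IsProbabilityMeasure (μ.withDensity fun y => ENNReal.ofReal (f x y)) := ⟨by
      rw [withDensity_apply _ .univ, Measure.restrict_univ, h1]⟩
    exact lintegral_mul_one_add_inner (measurable_section hf.measurable x) (hf.nonneg x)
      (stronglyMeasurable_section hc.stronglyMeasurable x) (fun y => hK y x) h0 hγ

theorem isDensity_tilt (hη : η.IsDensity M) (hc : IsDirection M.ν (kernel₀ M η) c)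
    (hb : IsDirection M.ν (kernel₁ M η) b) (ha : StronglyMeasurable a)
    (ha0 : ∫ x, a x ∂covLaw M η = 0) {K : ℝ} (hcK : ∀ y x, ‖c y x‖ ≤ K)
    (hbK : ∀ y x, ‖b y x‖ ≤ K) (haK : ∀ x, ‖a x‖ ≤ K)
    {γ : EuclideanSpace ℝ (Fin r)} (hγ : ‖γ‖ * K ≤ 1) : (η.tilt c b a γ).IsDensity M where
  f₀ := isCondDensity_tilt hη.f₀ hc hcK hγ
  f₁ := isCondDensity_tilt hη.f₁ hb hbK hγ
  g_measurable := hη.g_measurable.mul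
    (measurable_const.add (measurable_const.inner ha.measurable))
  g_nonneg x := mul_nonneg (hη.g_nonneg x) (one_add_inner_nonneg hγ (haK x))
  g_lintegral := by
    have : IsProbabilityMeasure (M.ν.withDensity fun x => ENNReal.ofReal (η.g x)) :=
      isProbabilityMeasure_covLaw hη
    exact lintegral_mul_one_add_inner hη.g_measurable hη.g_nonneg ha haK ha0 hγ

/-- D is linear in f₀, and the (1-π)⁻¹-weighted integral of c is D times its `outcomeMean`. -/
theorem IsRegularPoint.oddsIntegral_tilt {x : 𝒰 × 𝒵} (hx : IsRegularPoint M θ η ε x)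
    (hη : η.IsDensity M) (hε : 0 < ε) (hc : IsDirection M.ν (kernel₀ M η) c)
    (γ : EuclideanSpace ℝ (Fin r)) : M.oddsIntegral θ (η.tilt c b a γ) x =
      M.oddsIntegral θ η x * (1 + inner ℝ γ (outcomeMean M θ η c x)) := by
  have := hx.prob₀
  have hi := hx.integrable_inv_smul hε (hc.integrable (x := x))
  have e : M.oddsIntegral θ (η.tilt c b a γ) x = ∫ y, ((1 - M.π θ y x.1)⁻¹ +
      inner ℝ γ ((1 - M.π θ y x.1)⁻¹ • c y x)) ∂kernel₀ M η x := by
    rw [integral_condKernel hη.f₀.measurable hη.f₀.nonneg, Model.oddsIntegral]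
    refine integral_congr_ae (.of_forall fun y => ?_)
    simp only [Nuisance.tilt, inner_smul_right, smul_eq_mul]
    ring
  rw [e, integral_add (hx.integrable_inv hε) (hi.const_inner γ), integral_inner hi,
    ← oddsIntegral_eq hη, outcomeMean, inner_smul_right, mul_add, mul_one,
    mul_inv_cancel_left₀ hx.odds_pos.ne']

/-- With e the `outcomeMean` of c, tilting multiplies D by 1 + ⟨γ, e⟩, which is the denominator. In
the arm t = 1, D - 1 is multiplied by 1 + ⟨γ, D e/(D - 1)⟩, and D e/(D - 1) is the score plus e; in
the arm t = 0 the score plus e is c. -/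
theorem IsRegularPoint.likelihood_tilt {x : 𝒰 × 𝒵} (hx : IsRegularPoint M θ η ε x)
    (hη : η.IsDensity M) (hε : 0 < ε) (hc : IsDirection M.ν (kernel₀ M η) c)
    (γ : EuclideanSpace ℝ (Fin r)) (t : Bool) (y : ℝ) :
    M.likelihood θ (η.tilt c b a γ) (t, y, x) = M.likelihood θ η (t, y, x) *
      ((1 + inner ℝ γ (score₀ M θ η c (t, y, x) + outcomeMean M θ η c x)) *
        (1 + inner ℝ γ (score₁ b (t, y, x))) * (1 + inner ℝ γ (score₂ a (t, y, x))) /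
        (1 + inner ℝ γ (outcomeMean M θ η c x))) := by
  have hD := hx.odds_pos
  have hD1 := hx.odds_sub_one_pos
  have e := hx.oddsIntegral_tilt (b := b) (a := a) hη hε hc γ
  cases t
  · simp only [Model.likelihood, e, Bool.false_eq_true, if_false, score₀, score₁, score₂,
      sub_add_cancel, inner_zero_right, mul_inv, div_eq_mul_inv]
    simp only [Nuisance.tilt]
    ring
  · have e1 : M.oddsIntegral θ η x * (1 + inner ℝ γ (outcomeMean M θ η c x)) - 1 =
        (M.oddsIntegral θ η x - 1) * (1 + inner ℝ γ
          ((M.oddsIntegral θ η x - 1)⁻¹ • outcomeMean M θ η c x + outcomeMean M θ η c x)) := by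
      rw [inner_add_right, inner_smul_right]
      field_simp
      ring
    simp only [Model.likelihood, e, e1, if_true, score₀, score₁, score₂, mul_inv, div_eq_mul_inv]
    simp only [Nuisance.tilt]
    ring

theorem isSubmodel_tilt (hη : η.IsDensity M) (hε : 0 < ε)
    (hreg : ∀ᵐ x ∂M.ν, IsRegularPoint M θ η ε x) (hc : IsDirection M.ν (kernel₀ M η) c)
    (hb : IsDirection M.ν (kernel₁ M η) b) (ha : StronglyMeasurable a)
    (haK : ∃ K, ∀ x, ‖a x‖ ≤ K) (ha0 : ∫ x, a x ∂covLaw M η = 0) :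
    IsSubmodel M θ η (η.tilt c b a) (score₀ M θ η c + score₁ b + score₂ a) := by
  obtain ⟨K₁, hK₁⟩ := hc.bounded
  obtain ⟨K₂, hK₂⟩ := hb.bounded
  obtain ⟨K₃, hK₃⟩ := haK
  obtain ⟨K, k₁, k₂, k₃, k0⟩ : ∃ K, K₁ ≤ K ∧ K₂ ≤ K ∧ K₃ ≤ K ∧ 0 ≤ K :=
    ⟨max (max K₁ K₂) (max K₃ 0), by simp, by simp, by simp, by simp⟩
  have hp := isProbabilityMeasure_obsLaw hη hreg
  refine ⟨by simp [Nuisance.tilt], ?_, ?_, ?_⟩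
  · have hsmall : ∀ᶠ γ : EuclideanSpace ℝ (Fin r) in 𝓝 0, ‖γ‖ * K < 1 := by
      have : Continuous fun γ : EuclideanSpace ℝ (Fin r) => ‖γ‖ * K := by fun_prop
      exact (this.tendsto 0).eventually_lt_const (by simp)
    filter_upwards [hsmall] with γ hγ
    exact isDensity_tilt hη hc hb ha ha0 (fun y x => (hK₁ y x).trans k₁)
      (fun y x => (hK₂ y x).trans k₂) (fun x => (hK₃ x).trans k₃) hγ.le
  · exact (((stronglyMeasurable_score₀ hη hc.stronglyMeasurable).add
      (stronglyMeasurable_score₁ hb.stronglyMeasurable)).add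
        (stronglyMeasurable_score₂ ha)).measurable
  -- The bound is doubled because the first factor involves, for t = 1, a sum of two vectors of norm
  -- at most K.
  · refine tendsto_score_of_ratio (K := K + K)
      (α₁ := fun o => score₀ M θ η c o + outcomeMean M θ η c o.2.2) (α₂ := score₁ b)
      (α₃ := score₂ a) (α₄ := fun o => outcomeMean M θ η c o.2.2) ?_ (ae_likelihood_nonneg hη hreg)
      (by simpa using (integrable_obsLaw_iff hη hreg).1 (integrable_const (1 : ℝ)))
      (.of_forall fun o => ?_) ?_
    · have h : ∀ᵐ x ∂M.ν, ‖outcomeMean M θ η c x‖ ≤ K ∧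
          ‖(M.oddsIntegral θ η x - 1)⁻¹ • outcomeMean M θ η c x‖ ≤ K := by
        filter_upwards [hreg, hc.integral_eq_zero] with x hx h0
        exact ⟨(hx.norm_outcomeMean_le hη hε fun y => hK₁ y x).trans k₁,
          (hx.norm_inv_smul_outcomeMean_le hη hε
            (stronglyMeasurable_section hc.stronglyMeasurable x) (fun y => hK₁ y x) h0).trans k₁⟩
      filter_upwards [ae_base_of_ae h] with o ho
      rcases o with ⟨t, y, x⟩
      have hc' := (hK₁ y x).trans k₁
      have hb' := (hK₂ y x).trans k₂
      have ha' := (hK₃ x).trans k₃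
      refine ⟨?_, ?_, ha'.trans (by linarith), ho.1.trans (by linarith)⟩
      · cases t
        · simp only [score₀, Bool.false_eq_true, if_false, sub_add_cancel]
          linarith
        · simp only [score₀, if_true]
          exact (norm_add_le _ _).trans (add_le_add ho.2 ho.1)
      · cases t
        · simp only [score₁, Bool.false_eq_true, if_false, norm_zero]
          linarith
        · simp only [score₁, if_true]
          linarith
    · simp only [Pi.add_apply]
      abel
    · filter_upwards [ae_base_of_ae hreg] with o ho γ
      exact ho.likelihood_tilt hη hε hc γ _ _

end ATT

namespace ATT

/-! ### The nuisance tangent spaces -/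

variable {d : ℕ} {𝒰 𝒵 : Type*} [MeasurableSpace 𝒰] [MeasurableSpace 𝒵]
variable {M : Model d 𝒰 𝒵} {θ : EuclideanSpace ℝ (Fin d)} {η : Nuisance 𝒰 𝒵} {ε : ℝ}

/-- The union of the tangent spaces of the regular parametric submodels that satisfy `free`. -/
def tangentVectors (M : Model d 𝒰 𝒵) (θ : EuclideanSpace ℝ (Fin d)) (η : Nuisance 𝒰 𝒵)
    (Q : Measure (Obs 𝒰 𝒵)) [IsFiniteMeasure Q] (free : Nuisance 𝒰 𝒵 → Prop) :
    Set (meanZero d Q) :=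
  {h | ∃ (r : ℕ) (ηγ : EuclideanSpace ℝ (Fin r) → Nuisance 𝒰 𝒵)
    (S : Obs 𝒰 𝒵 → EuclideanSpace ℝ (Fin r))
    (B : EuclideanSpace ℝ (Fin r) →ₗ[ℝ] EuclideanSpace ℝ (Fin d)),
    IsSubmodel M θ η ηγ S ∧ (∀ γ, free (ηγ γ)) ∧ h.1 =ᵐ[Q] fun o => B (S o)}

/-- A union of tangent spaces over different submodels need not visibly be a subspace; squeezing it
between G and the closure of G avoids the question. -/
theorem closure_eq_of_le_of_le {H : Type*} [NormedAddCommGroup H] [InnerProductSpace ℝ H]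
    {G L : Submodule ℝ H} {A : Set H} (hGA : (G : Set H) ⊆ A) (hAL : A ⊆ L)
    (hGL : G.topologicalClosure = L) : closure A = L := by
  have hL : IsClosed (L : Set H) := hGL ▸ Submodule.isClosed_topologicalClosure G
  refine (closure_minimal hAL hL).antisymm ?_
  rw [← hGL, Submodule.topologicalClosure_coe]
  exact closure_mono hGA

variable {hη : η.IsDensity M} {hε : 0 < ε}
  {hπ : ∀ᵐ p ∂(M.ν.prod M.μ₀), 0 < M.π θ p.2 p.1.1 ∧ M.π θ p.2 p.1.1 ≤ 1 - ε}
  {Q : Measure (Obs 𝒰 𝒵)} [IsFiniteMeasure Q] {hQ : Q = obsLaw M θ η}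

/-- With as many parameters as components of h, h is itself the score of the tilted submodel and B
is the identity. -/
theorem mem_tangentVectors (hη : η.IsDensity M) (hε : 0 < ε)
    (hπ : ∀ᵐ p ∂(M.ν.prod M.μ₀), 0 < M.π θ p.2 p.1.1 ∧ M.π θ p.2 p.1.1 ≤ 1 - ε)
    {c b : ℝ → 𝒰 × 𝒵 → EuclideanSpace ℝ (Fin d)} {a : 𝒰 × 𝒵 → EuclideanSpace ℝ (Fin d)}
    (hc : IsDirection M.ν (kernel₀ M η) c) (hb : IsDirection M.ν (kernel₁ M η) b)
    (ha : StronglyMeasurable a) (haK : ∃ K, ∀ x, ‖a x‖ ≤ K) (ha0 : ∫ x, a x ∂covLaw M η = 0)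
    {free : Nuisance 𝒰 𝒵 → Prop} (hfree : ∀ γ, free (η.tilt c b a γ)) {h : meanZero d Q}
    (he : h.1 =ᵐ[Q] score₀ M θ η c + score₁ b + score₂ a) : h ∈ tangentVectors M θ η Q free :=
  ⟨d, _, _, LinearMap.id, isSubmodel_tilt hη hε (ae_isRegularPoint hη hε hπ) hc hb ha haK ha0,
    hfree, he⟩

theorem score₀_zero : score₀ M θ η (0 : ℝ → 𝒰 × 𝒵 → EuclideanSpace ℝ (Fin d)) = 0 := by
  ext o i
  rcases o with ⟨_ | _, y, x⟩ <;> simp [score₀, outcomeMean]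

theorem score₁_zero {𝒰 𝒵 : Type*} : score₁ (0 : ℝ → 𝒰 × 𝒵 → EuclideanSpace ℝ (Fin d)) = 0 := by
  ext o i
  rcases o with ⟨_ | _, y, x⟩ <;> simp [score₁]

theorem score₂_zero {𝒰 𝒵 : Type*} : score₂ (0 : 𝒰 × 𝒵 → EuclideanSpace ℝ (Fin d)) = 0 := rfl

theorem boundedSpace₀_subset_tangentVectors :
    (boundedSpace hη hε hπ hQ 0 : Set (meanZero d Q)) ⊆
      tangentVectors M θ η Q fun η' => η'.f₁ = η.f₁ ∧ η'.g = η.g := by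
  rintro h ⟨_, ⟨c, hc, rfl⟩, he⟩
  refine mem_tangentVectors hη hε hπ hc isDirection_zero (a := 0) stronglyMeasurable_const
    ⟨0, by simp⟩ (by simp) (fun γ => ?_) ?_
  · simp [Nuisance.tilt]
  · rwa [score₁_zero, score₂_zero, add_zero, add_zero]

theorem boundedSpace₁_subset_tangentVectors :
    (boundedSpace hη hε hπ hQ 1 : Set (meanZero d Q)) ⊆
      tangentVectors M θ η Q fun η' => η'.f₀ = η.f₀ ∧ η'.g = η.g := by
  rintro h ⟨_, ⟨b, hb, rfl⟩, he⟩
  refine mem_tangentVectors hη hε hπ isDirection_zero hb (a := 0) stronglyMeasurable_const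
    ⟨0, by simp⟩ (by simp) (fun γ => ?_) ?_
  · simp [Nuisance.tilt]
  · rwa [score₀_zero, score₂_zero, zero_add, add_zero]

theorem boundedSpace₂_subset_tangentVectors :
    (boundedSpace hη hε hπ hQ 2 : Set (meanZero d Q)) ⊆
      tangentVectors M θ η Q fun η' => η'.f₀ = η.f₀ ∧ η'.f₁ = η.f₁ := by
  rintro h ⟨_, ⟨a, ha, haK, ha0, rfl⟩, he⟩
  refine mem_tangentVectors hη hε hπ isDirection_zero isDirection_zero ha haK ha0 (fun γ => ?_) ?_
  · simp [Nuisance.tilt]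
  · rwa [score₀_zero, score₁_zero, add_zero, zero_add]

theorem sup_boundedSpace_subset_tangentVectors :
    ((boundedSpace hη hε hπ hQ 0 ⊔ boundedSpace hη hε hπ hQ 1 ⊔ boundedSpace hη hε hπ hQ 2 :
      Submodule ℝ (meanZero d Q)) : Set (meanZero d Q)) ⊆
      tangentVectors M θ η Q fun _ => True := by
  intro h hh
  obtain ⟨h', hh', h₂, ⟨_, ⟨a, ha, haK, ha0, rfl⟩, e₂⟩, rfl⟩ := Submodule.mem_sup.1 hh
  obtain ⟨h₀, ⟨_, ⟨c, hc, rfl⟩, e₀⟩, h₁, ⟨_, ⟨b, hb, rfl⟩, e₁⟩, rfl⟩ := Submodule.mem_sup.1 hh'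
  refine mem_tangentVectors hη hε hπ hc hb ha haK ha0 (fun _ => trivial) ?_
  exact (Lp.coeFn_add _ _).trans (((Lp.coeFn_add _ _).trans (e₀.add e₁)).add e₂)

/-- The subspaces that the nuisance tangent spaces are equal to, and the orthogonal complement of
their sum. -/
def tangentSpace (hη : η.IsDensity M) (hε : 0 < ε)
    (hπ : ∀ᵐ p ∂(M.ν.prod M.μ₀), 0 < M.π θ p.2 p.1.1 ∧ M.π θ p.2 p.1.1 ≤ 1 - ε)
    (hQ : Q = obsLaw M θ η) : Fin 4 → Submodule ℝ (meanZero d Q) :=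
  orthogonalToOthers (boundedSpace hη hε hπ hQ)

theorem topologicalClosure_boundedSpace (i : Fin 4) :
    (boundedSpace hη hε hπ hQ i).topologicalClosure = tangentSpace hη hε hπ hQ i :=
  topologicalClosure_eq_orthogonalToOthers (fun _ _ => isOrtho_boundedSpace)
    (fun _ => eq_zero_of_mem_orthogonal_boundedSpace) i

/-- A submodel that moves f₀ only has its tangent vectors orthogonal to the bounded scores for f₁
and g and to the residuals, which is membership in the upper space. -/
theorem closure_tangentVectors₀ :
    closure (tangentVectors M θ η Q fun η' => η'.f₁ = η.f₁ ∧ η'.g = η.g) =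
      tangentSpace hη hε hπ hQ 0 := by
  refine closure_eq_of_le_of_le boundedSpace₀_subset_tangentVectors ?_
    (topologicalClosure_boundedSpace 0)
  rintro h ⟨r, ηγ, S, B, hsub, hfree, hB⟩
  refine mem_orthogonalToOthers.2 fun j hj => ?_
  fin_cases j
  · exact absurd rfl hj
  · exact hsub.mem_orthogonal_boundedSpace₁ hB fun γ => (hfree γ).1
  · exact hsub.mem_orthogonal_boundedSpace₂ hB fun γ => (hfree γ).2
  · exact hsub.mem_orthogonal_boundedSpace₃ hB

theorem closure_tangentVectors₁ :
    closure (tangentVectors M θ η Q fun η' => η'.f₀ = η.f₀ ∧ η'.g = η.g) =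
      tangentSpace hη hε hπ hQ 1 := by
  refine closure_eq_of_le_of_le boundedSpace₁_subset_tangentVectors ?_
    (topologicalClosure_boundedSpace 1)
  rintro h ⟨r, ηγ, S, B, hsub, hfree, hB⟩
  refine mem_orthogonalToOthers.2 fun j hj => ?_
  fin_cases j
  · exact hsub.mem_orthogonal_boundedSpace₀ hB fun γ => (hfree γ).1
  · exact absurd rfl hj
  · exact hsub.mem_orthogonal_boundedSpace₂ hB fun γ => (hfree γ).2
  · exact hsub.mem_orthogonal_boundedSpace₃ hB

theorem closure_tangentVectors₂ :
    closure (tangentVectors M θ η Q fun η' => η'.f₀ = η.f₀ ∧ η'.f₁ = η.f₁) =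
      tangentSpace hη hε hπ hQ 2 := by
  refine closure_eq_of_le_of_le boundedSpace₂_subset_tangentVectors ?_
    (topologicalClosure_boundedSpace 2)
  rintro h ⟨r, ηγ, S, B, hsub, hfree, hB⟩
  refine mem_orthogonalToOthers.2 fun j hj => ?_
  fin_cases j
  · exact hsub.mem_orthogonal_boundedSpace₀ hB fun γ => (hfree γ).1
  · exact hsub.mem_orthogonal_boundedSpace₁ hB fun γ => (hfree γ).2
  · exact absurd rfl hj
  · exact hsub.mem_orthogonal_boundedSpace₃ hB

theorem sup_tangentSpace : tangentSpace hη hε hπ hQ 0 ⊔ tangentSpace hη hε hπ hQ 1 ⊔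
    tangentSpace hη hε hπ hQ 2 = (tangentSpace hη hε hπ hQ 3)ᗮ :=
  sup_orthogonalToOthers (fun _ _ => isOrtho_boundedSpace)
    (fun _ => eq_zero_of_mem_orthogonal_boundedSpace)

/-- With all parts free, only orthogonality to the bounded residuals survives. It suffices, since
their complement is the sum of the three nuisance tangent spaces. -/
theorem closure_tangentVectors :
    closure (tangentVectors M θ η Q fun _ => True) =
      (tangentSpace hη hε hπ hQ 0 ⊔ tangentSpace hη hε hπ hQ 1 ⊔ tangentSpace hη hε hπ hQ 2 :
        Submodule ℝ (meanZero d Q)) := by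
  have h3 : (tangentSpace hη hε hπ hQ 3)ᗮ = (boundedSpace hη hε hπ hQ 3)ᗮ :=
    orthogonal_orthogonalToOthers (fun _ _ => isOrtho_boundedSpace)
      (fun _ => eq_zero_of_mem_orthogonal_boundedSpace) 3
  refine closure_eq_of_le_of_le (sup_boundedSpace_subset_tangentVectors (hη := hη) (hε := hε)
    (hπ := hπ) (hQ := hQ)) ?_ (le_antisymm ?_ ?_)
  · rw [sup_tangentSpace, h3]
    rintro h ⟨r, ηγ, S, B, hsub, -, hB⟩
    exact hsub.mem_orthogonal_boundedSpace₃ hB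
  · refine Submodule.topologicalClosure_minimal _ (sup_le_sup (sup_le_sup ?_ ?_) ?_) ?_
    · exact boundedSpace_le_orthogonalToOthers 0
    · exact boundedSpace_le_orthogonalToOthers 1
    · exact boundedSpace_le_orthogonalToOthers 2
    · rw [sup_tangentSpace]
      exact Submodule.isClosed_orthogonal _
  · simp only [← topologicalClosure_boundedSpace]
    exact sup_le (sup_le (Submodule.topologicalClosure_mono (le_sup_left.trans le_sup_left))
      (Submodule.topologicalClosure_mono (le_sup_right.trans le_sup_left)))
      (Submodule.topologicalClosure_mono le_sup_right)

theorem tangentSpace_three_eq_orthogonal : tangentSpace hη hε hπ hQ 3 =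
    (tangentSpace hη hε hπ hQ 0 ⊔ tangentSpace hη hε hπ hQ 1 ⊔ tangentSpace hη hε hπ hQ 2)ᗮ := by
  have : CompleteSpace (tangentSpace hη hε hπ hQ 3) :=
    (isClosed_orthogonalToOthers 3).completeSpace_coe
  rw [sup_tangentSpace, Submodule.orthogonal_orthogonal]

end ATT

end

/-! ### The main theorem -/

theorem proposition1 {d : ℕ} {Ω 𝒰 𝒵 : Type*}
    [MeasurableSpace Ω] [MeasurableSpace 𝒰] [MeasurableSpace 𝒵]
    (M : ATT.Model d 𝒰 𝒵) (D : ATT.PotentialOutcomes Ω 𝒰 𝒵)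
    (P : Measure Ω) [IsProbabilityMeasure P]
    (θ : EuclideanSpace ℝ (Fin d)) (η : ATT.Nuisance 𝒰 𝒵)
    (hmodel : ATT.FollowsModel M D P θ η) (hoverlap : ATT.Overlap M θ) :
    ∃ Λ : Fin 4 → Submodule ℝ (ATT.HSpace d D P),
      -- the explicit descriptions
      (Λ 0 : Set (ATT.HSpace d D P)) = ATT.lambda₀ d D P ∧
      (Λ 1 : Set (ATT.HSpace d D P)) = ATT.lambda₁ d D P ∧
      (Λ 2 : Set (ATT.HSpace d D P)) = ATT.lambda₂ d D P ∧
      (Λ 3 : Set (ATT.HSpace d D P)) = ATT.lambdaPerp M D P θ ∧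
      -- the nuisance tangent spaces for `f₀`, `f₁`, `g`, each with the other parts fixed
      ATT.nuisanceTangentSpace M D P θ η (fun η' => η'.f₁ = η.f₁ ∧ η'.g = η.g) = Λ 0 ∧
      ATT.nuisanceTangentSpace M D P θ η (fun η' => η'.f₀ = η.f₀ ∧ η'.g = η.g) = Λ 1 ∧
      ATT.nuisanceTangentSpace M D P θ η (fun η' => η'.f₀ = η.f₀ ∧ η'.f₁ = η.f₁) = Λ 2 ∧
      -- the nuisance tangent space for all three parts, and its orthogonal complement
      ATT.nuisanceTangentSpace M D P θ η (fun _ => True) = (Λ 0 ⊔ Λ 1 ⊔ Λ 2 : Submodule ℝ _) ∧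
      Λ 3 = (Λ 0 ⊔ Λ 1 ⊔ Λ 2)ᗮ ∧
      -- the orthogonal direct sum
      OrthogonalFamily ℝ (fun i => Λ i) (fun i => (Λ i).subtypeₗᵢ) ∧
      DirectSum.IsInternal Λ := by
  obtain ⟨ε, hε, hπ⟩ := hoverlap
  have hη := hmodel.isDensity
  have hQ := hmodel.map_W hε hπ
  have horth := fun i j => ATT.isOrtho_boundedSpace (hη := hη) (hε := hε) (hπ := hπ) (hQ := hQ)
    (i := i) (j := j)
  have htot := fun h => ATT.eq_zero_of_mem_orthogonal_boundedSpace (hη := hη) (hε := hε)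
    (hπ := hπ) (hQ := hQ) (h := h)
  refine ⟨ATT.tangentSpace hη hε hπ hQ, ?_, ?_, ?_, ?_, ATT.closure_tangentVectors₀,
    ATT.closure_tangentVectors₁, ATT.closure_tangentVectors₂, ATT.closure_tangentVectors,
    ATT.tangentSpace_three_eq_orthogonal, ATT.orthogonalFamily_orthogonalToOthers horth htot,
    ATT.isInternal_orthogonalToOthers horth htot⟩
  · ext h
    exact (ATT.mem_orthogonalToOthers_iff_isScore₀ h).trans
      (hmodel.mem_lambda₀_iff hε hπ h).symm
  · ext h
    exact (ATT.mem_orthogonalToOthers_iff_isScore₁ h).trans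
      (hmodel.mem_lambda₁_iff hε hπ h).symm
  · ext h
    exact (ATT.mem_orthogonalToOthers_iff_isScore₂ h).trans
      (hmodel.mem_lambda₂_iff hε hπ h).symm
  · ext h
    exact (ATT.mem_orthogonalToOthers_iff_isResidual h).trans
      (hmodel.mem_lambdaPerp_iff hε hπ h).symm
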